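/- \textbf{Setting.} There are two groups $G\in\{0,1\}$ and two periods $T\in\{0,1\}$, with $P(G=g,T=t)>0$ for all $g,t$. Treatment is $D=1\{V\ge v_{GT}\}$ for a real random variable $V$ and real thresholds $v_{gt}$, potential outcomes are $Y(0),Y(1)$, and $Y=DY(1)+(1-D)Y(0)$ is observed. Put $D(t)=1\{V\ge v_{Gt}\}$. A subscript $gt$ (resp. $dgt$) denotes conditioning on $G=g,T=t$ (resp. on $D=d,G=g,T=t$). $\mathrm{Supp}$ denotes the support and $\underline y=\inf\mathrm{Supp}(Y)$, $\overline y=\sup\mathrm{Supp}(Y)$ (possibly infinite). Let $S=\{D(0)<D(1),G=1\}$, $\Delta=E(Y_{11}(1)-Y_{11}(0)\mid S)$ and, for $q\in(0,1)$, $\tau_q=F^{-1}_{Y_{11}(1)|S}(q)-F^{-1}_{Y_{11}(0)|S}(q)$, where $F^{-1}(q)=\inf\{x\in\mathbb R:F(x)\ge q\}\in[-\infty,\infty]$. Throughout, $P(A)F_{R|A}$ is read as $0$ if $P(A)=0$. \textbf{Standing assumptions.} $V\perp T\mid G$; $E(D_{11})>E(D_{10})$ and $E(D_{11})-E(D_{10})>E(D_{01})-E(D_{00})$;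 $0<P(D_{0t}=1)<1$ for $t\in\{0,1\}$, and $P(D_{01}=1)\ne P(D_{00}=1)$. \textbf{Notation.} $M_{01}(x)=\min(1,\max(0,x))$, $\lambda_{gd}=P(D_{g1}=d)/P(D_{g0}=d)$, $$\underline F_{d01}(y)=M_{01}(1-\lambda_{0d}(1-F_{Y_{d01}}(y)))-M_{01}(1-\lambda_{0d})1\{y<\overline y\},$$ $$\overline F_{d01}(y)=M_{01}(\lambda_{0d}F_{Y_{d01}}(y))+(1-M_{01}(\lambda_{0d}))1\{y\ge\underline y\},$$ $\underline\delta_d=\int y\,d\overline F_{d01}(y)-E(Y_{d00})$, $\overline\delta_d=\int y\,d\underline F_{d01}(y)-E(Y_{d00})$, $$\underline W_{TC}=\frac{E(Y_{11})-E(Y_{10}+\overline\delta_{D_{10}})}{E(D_{11})-E(D_{10})},\qquad \overline W_{TC}=\frac{E(Y_{11})-E(Y_{10}+\underline\delta_{D_{10}})}{E(D_{11})-E(D_{10})}.$$ Let $H_d=F_{Y_{d10}}\circ F^{-1}_{Y_{d00}}$ on $[0,1]$, with generalized inverse $H_d^{-1}$ extended by $0$ for $q<0$ and by $1$ for $q>1$,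 and $$G_d(K)=\lambda_{0d}F_{Y_{d01}}+(1-\lambda_{0d})K,\qquad C_d(K)=\frac{P(D_{11}=d)F_{Y_{d11}}-P(D_{10}=d)H_d\circ G_d(K)}{P(D_{11}=d)-P(D_{10}=d)},$$ $$\underline T_d=M_{01}\Big(\frac{\lambda_{0d}F_{Y_{d01}}-H_d^{-1}(\lambda_{1d}F_{Y_{d11}})}{\lambda_{0d}-1}\Big),\qquad \overline T_d=M_{01}\Big(\frac{\lambda_{0d}F_{Y_{d01}}-H_d^{-1}(\lambda_{1d}F_{Y_{d11}}+1-\lambda_{1d})}{\lambda_{0d}-1}\Big),$$ $$\underline F_{CIC,d}(y)=\sup_{y'\le y}C_d(\underline T_d)(y'),\qquad \overline F_{CIC,d}(y)=\inf_{y'\ge y}C_d(\overline T_d)(y').$$ (If $P(D_{10}=d)=0$, then $C_d(\cdot)=F_{Y_{d11}}$.) Integrals $\int y\,dF(y)$ of these two functions are Stieltjes integrals over $[\underline y,\overline y]$ in which the mass missing below $\underline y$ or above $\overline y$ is placed at that (possibly infinite) endpoint, so they may be infinite. Let $$\underline W_{CIC}=\int y\,d\overline F_{CIC,1}-\int y\,d\underline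 F_{CIC,0},\qquad \overline W_{CIC}=\int y\,d\underline F_{CIC,1}-\int y\,d\overline F_{CIC,0},$$ $$\underline\tau_q=\max(\overline F^{-1}_{CIC,1}(q),\underline y)-\min(\underline F^{-1}_{CIC,0}(q),\overline y),\qquad \overline\tau_q=\min(\underline F^{-1}_{CIC,1}(q),\overline y)-\max(\overline F^{-1}_{CIC,0}(q),\underline y).$$ \textbf{Conditions.} \begin{itemize} \item[(B)] $P(\underline y\le Y(d)\le\overline y)=1$ for $d\in\{0,1\}$. \item[(T)] For each $d$ such that $P(D(0)=d\mid G=g)>0$ for both $g$, $E(Y(d)\mid G=g,T=1,D(0)=d)-E(Y(d)\mid G=g,T=0,D(0)=d)$ does not depend on $g$. \item[(M)] $Y(d)=h_d(U_d,T)$ with $U_d$ real, $h_d(\cdot,t)$ strictly increasing, and $U_d\perp T\mid G,D(0)$. \item[(R)] $\mathrm{Supp}(Y)$ is a closed interval and, for every $(d,g,t)$ with $P(D=d,G=g,T=t)>0$, $\mathrm{Supp}(Y_{dgt})=\mathrm{Supp}(Y)$ and $F_{Y_{dgt}}$ is continuous, and strictly increasing on $\mathrm{Supp}(Y)$. \item[(E)]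 $\int|y|\,d\overline F_{CIC,d}$ and $\int|y|\,d\underline F_{CIC,d}$, taken over the real numbers in $[\underline y,\overline y]$, are finite for $d\in\{0,1\}$. \item[(I)] For every $(d,g,t)$ with $P(D=d,G=g,T=t)>0$, $F_{Y_{dgt}}$ is continuously differentiable with positive derivative on the interior of $\mathrm{Supp}(Y)$. For every $d$ with $P(D_{10}=d)>0$, the functions $\underline T_d,\overline T_d,G_d(\underline T_d),G_d(\overline T_d),C_d(\underline T_d),C_d(\overline T_d)$ are nondecreasing on $\mathrm{Supp}(Y)$. \end{itemize} \textbf{Theorem.} Under the standing assumptions: \begin{enumerate} \item If $Y$ has bounded support and (T), (B) hold, then $\underline W_{TC}\le\Delta\le\overline W_{TC}$. \item Assume (M) and (R). Then \begin{itemize} \item[(a)] $\underline F_{CIC,d}(y)\le F_{Y_{11}(d)|S}(y)\le\overline F_{CIC,d}(y)$ for all $d\in\{0,1\}$ and $y\in\mathbb R$; \item[(b)] if (B) and (E) hold, then $Y_{11}(1)$ is integrable given $S$, so is $Y_{11}(0)$ if $\underline W_{CIC}$ and $\overline W_{CIC}$ are finite, and whenever $Y_{11}(0)$ is integrable given $S$,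 $\underline W_{CIC}\le\Delta\le\overline W_{CIC}$; \item[(c)] if (B) holds, $\underline\tau_q\le\tau_q\le\overline\tau_q$ for all $q\in(0,1)$; \item[(d)] if (I) holds, these bounds are sharp, in the following sense. Call a data generating process admissible if it yields the same joint law of $(D,G,T,Y)$ and satisfies the standing assumptions, (M), (R) and (B). For each $d$ there is a sequence of admissible processes along which $F_{Y_{11}(d)|S}(y)\to\underline F_{CIC,d}(y)$ for every $y$ in the interior of $\mathrm{Supp}(Y)$, and another one along which $F_{Y_{11}(d)|S}(y)\to\overline F_{CIC,d}(y)$ for every such $y$. For each $q\in(0,1)$ there are sequences of admissible processes along which $\tau_q\to\underline\tau_q$, resp. $\tau_q\to\overline\tau_q$. If (E) holds too, there are sequences of admissible processes with $Y_{11}(0)$ and $Y_{11}(1)$ integrable given $S$ along which $\Delta\to\underline W_{CIC}$, resp. $\Delta\to\overline W_{CIC}$. (Limits are taken in $[-\infty,\infty]$.) \end{itemize} \end{enumerate} -/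

import Mathlib

open MeasureTheory ProbabilityTheory Filter Topology

universe u

noncomputable section

/-! ### Generalized inverses, Stieltjes integrals -/

/-- Truncation to the unit interval. -/
def M01 (x : ℝ) : ℝ := min 1 (max 0 x)

/-- Generalized inverse `F⁻¹(q) = inf {x ∈ ℝ : F x ≥ q}`, the infimum being taken in the extended
reals (so it is `⊤` if no real `x` qualifies, and `⊥` if the set is not bounded below). -/
def genInv (F : ℝ → ℝ) (q : ℝ) : EReal := sInf (Real.toEReal '' {x : ℝ | q ≤ F x})

/-- Evaluation of a cdf at an extended real: `F(-∞) = 0` and `F(+∞) = 1`. -/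
def cdfAt (F : ℝ → ℝ) (x : EReal) : ℝ :=
  if x = ⊥ then 0 else if x = ⊤ then 1 else F x.toReal

open Classical in
/-- The Lebesgue-Stieltjes measure `dF` on `ℝ` of a nondecreasing function `F`
(the zero measure if `F` is not nondecreasing). -/
def stieltjesOf (F : ℝ → ℝ) : Measure ℝ :=
  if h : Monotone F then h.stieltjesFunction.measure else 0

/-- The cdf `F` on the interval with endpoints `a ≤ b` (possibly infinite): it is `0` strictly below
`a` and `1` from `b` on. If `F` is defective, i.e. `F` does not vanish below `a` or does
not reach `1` at `b`, this puts the missing mass on the endpoint, when that endpoint is finite. -/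
def cdfOnInterval (a b : EReal) (F : ℝ → ℝ) (y : ℝ) : ℝ :=
  if (y : EReal) < a then 0 else if b ≤ (y : EReal) then 1 else F y

/-- `∫ y dF(y)` for a possibly defective cdf: the integral over `ℝ`, plus `+∞` times the mass
`1 - lim_{+∞} F` at `+∞`, plus `-∞` times the mass `lim_{-∞} F` at `-∞` (with `0 * ∞ = 0`). -/
def extMean (F : ℝ → ℝ) : EReal :=
  ((∫ y, y ∂(stieltjesOf F) : ℝ) : EReal)
    + ((1 - ⨆ y, F y : ℝ) : EReal) * ⊤ + ((⨅ y, F y : ℝ) : EReal) * ⊥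

/-! ### The model -/

/-- A two-group, two-period data generating process with binary treatment: the group `G`, the
period `T`, the propensity `V` to be treated, thresholds `v g t`, and potential outcomes `Y d`.
All four group `×` period cells have positive probability. -/
structure FuzzyDiD where
  Ω : Type u
  [mΩ : MeasurableSpace Ω]
  P : Measure Ω
  [prob : IsProbabilityMeasure P]
  G : Ω → Fin 2
  T : Ω → Fin 2
  V : Ω → ℝ
  v : Fin 2 → Fin 2 → ℝ
  Y : Fin 2 → Ω → ℝ
  measurable_G : Measurable G
  measurable_T : Measurable T
  measurable_V : Measurable V
  measurable_Y : ∀ d, Measurable (Y d)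
  cell_pos : ∀ g t, 0 < P {ω | G ω = g ∧ T ω = t}

namespace FuzzyDiD

attribute [instance] FuzzyDiD.mΩ FuzzyDiD.prob

variable (M : FuzzyDiD.{u})

/-- Treatment status `D(t) = 1{V ≥ v_{Gt}}` at period `t`. -/
def Dpot (t : Fin 2) (ω : M.Ω) : Fin 2 := if M.v (M.G ω) t ≤ M.V ω then 1 else 0

/-- Treatment `D = 1{V ≥ v_{GT}} = D(T)`. -/
def D (ω : M.Ω) : Fin 2 := M.Dpot (M.T ω) ω

/-- Observed outcome `Y = D Y(1) + (1 - D) Y(0)`. -/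
def Yobs (ω : M.Ω) : ℝ := M.Y (M.D ω) ω

/-- The event `G = g, T = t`. -/
def cell (g t : Fin 2) : Set M.Ω := {ω | M.G ω = g ∧ M.T ω = t}

/-- The event `D = d, G = g, T = t`. -/
def dcell (d g t : Fin 2) : Set M.Ω := {ω | M.D ω = d ∧ M.G ω = g ∧ M.T ω = t}

/-- Conditional expectation `E(R | A)` given an event. -/
def condE (A : Set M.Ω) (R : M.Ω → ℝ) : ℝ := ∫ ω, R ω ∂(cond M.P A)

/-- Conditional cdf `F_{R | A}` given an event; it is identically `0` if `A` has probability `0`. -/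
def condCdf (A : Set M.Ω) (R : M.Ω → ℝ) (y : ℝ) : ℝ := (cond M.P A).real {ω | R ω ≤ y}

/-- `P(D_{gt} = d) = P(D = d | G = g, T = t)`. In particular `E(D_{gt}) = rate 1 g t`. -/
def rate (d g t : Fin 2) : ℝ := (cond M.P (M.cell g t)).real {ω | M.D ω = d}

/-- `F_{Y_{dgt}}`. -/
def F (d g t : Fin 2) : ℝ → ℝ := M.condCdf (M.dcell d g t) M.Yobs

/-- Support of the observed outcome. -/
def suppY : Set ℝ := (M.P.map M.Yobs).support

/-- Support of `Y_{dgt}`. -/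
def suppYcell (d g t : Fin 2) : Set ℝ := ((cond M.P (M.dcell d g t)).map M.Yobs).support

/-- Lower bound of the support of `Y`. -/
def yLow : EReal := sInf (Real.toEReal '' M.suppY)

/-- Upper bound of the support of `Y`. -/
def yHigh : EReal := sSup (Real.toEReal '' M.suppY)

/-- Treatment group switchers `S = {D(0) < D(1), G = 1}`, observed in period 1: conditioning
on this event is conditioning on `G = 1, T = 1` and on `S`. -/
def switchers : Set M.Ω := {ω | M.Dpot 0 ω < M.Dpot 1 ω ∧ M.G ω = 1 ∧ M.T ω = 1}

/-- `Δ = E(Y_{11}(1) - Y_{11}(0) | S)`. -/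
def late : ℝ := M.condE M.switchers (fun ω => M.Y 1 ω - M.Y 0 ω)

/-- `F_{Y_{11}(d) | S}`. -/
def switcherCdf (d : Fin 2) : ℝ → ℝ := M.condCdf M.switchers (M.Y d)

/-- `τ_q = F_{Y_{11}(1) | S}⁻¹(q) - F_{Y_{11}(0) | S}⁻¹(q)` (for `q ∈ (0,1)` both are real). -/
def lqte (q : ℝ) : EReal := genInv (M.switcherCdf 1) q - genInv (M.switcherCdf 0) q

/-! ### Assumptions -/

/-- Treatment participation equation: `V ⊥ T | G` (`D = 1{V ≥ v_{GT}}` holds by construction). -/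
def Participation : Prop := ∀ g, IndepFun M.V M.T (cond M.P {ω | M.G ω = g})

/-- First stage: `E(D_11) > E(D_10)` and `E(D_11) - E(D_10) > E(D_01) - E(D_00)`. -/
def FirstStage : Prop :=
  M.rate 1 1 0 < M.rate 1 1 1 ∧
    M.rate 1 0 1 - M.rate 1 0 0 < M.rate 1 1 1 - M.rate 1 1 0

/-- `E(Y(d) | G = g, T = 1, D(0) = d) - E(Y(d) | G = g, T = 0, D(0) = d)`. -/
def trend (d g : Fin 2) : ℝ :=
  M.condE {ω | M.G ω = g ∧ M.T ω = 1 ∧ M.Dpot 0 ω = d} (M.Y d)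
    - M.condE {ω | M.G ω = g ∧ M.T ω = 0 ∧ M.Dpot 0 ω = d} (M.Y d)

/-- Conditional common trends: `trend d g` does not depend on `g`. Nothing is required for a `d`
such that `D(0) = d` has probability zero in one of the groups. -/
def ConditionalCommonTrends : Prop :=
  ∀ d, (∀ g, 0 < M.rate d g 0) → M.trend d 1 = M.trend d 0

/-- The potential outcomes lie between the bounds of the support of the outcome:
`P(y̲ ≤ Y(d) ≤ y̅) = 1`. -/
def OutcomesInBounds : Prop :=
  ∀ d, ∀ᵐ ω ∂M.P, M.yLow ≤ (M.Y d ω : EReal) ∧ (M.Y d ω : EReal) ≤ M.yHigh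

/-- Monotonicity and time invariance of unobservables: `Y(d) = h_d(U_d, T)` with `h_d(u, t)`
strictly increasing in `u`, and `U_d ⊥ T | G, D(0)`. -/
def MonotoneInvariant : Prop :=
  ∃ (U : Fin 2 → M.Ω → ℝ) (h : Fin 2 → ℝ → Fin 2 → ℝ),
    (∀ d, Measurable (U d)) ∧
    (∀ d t, StrictMono (fun x => h d x t)) ∧
    (∀ d, ∀ᵐ ω ∂M.P, M.Y d ω = h d (U d ω) (M.T ω)) ∧
    (∀ d g e, IndepFun (U d) M.T (cond M.P {ω | M.G ω = g ∧ M.Dpot 0 ω = e}))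

/-- Data restrictions: in every nonempty treatment `×` group `×` period cell, the outcome has support
`Supp(Y)`, which is a closed interval (supports are closed), and its cdf is continuous and strictly
increasing on `Supp(Y)`. -/
def DataRestrictions : Prop :=
  M.suppY.OrdConnected ∧
  ∀ d g t, 0 < M.rate d g t →
    M.suppYcell d g t = M.suppY ∧ Continuous (M.F d g t) ∧ StrictMonoOn (M.F d g t) M.suppY

/-! ### TC bounds -/

/-- `λ_{gd} = P(D_{g1} = d) / P(D_{g0} = d)`. -/
def lam (g d : Fin 2) : ℝ := M.rate d g 1 / M.rate d g 0

open Classical in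
/-- The lower cdf `F̲_{d01}`. -/
def trimLow (d : Fin 2) (y : ℝ) : ℝ :=
  M01 (1 - M.lam 0 d * (1 - M.F d 0 1 y))
    - M01 (1 - M.lam 0 d) * (if (y : EReal) < M.yHigh then 1 else 0)

open Classical in
/-- The upper cdf `F̅_{d01}`. -/
def trimHigh (d : Fin 2) (y : ℝ) : ℝ :=
  M01 (M.lam 0 d * M.F d 0 1 y)
    + (1 - M01 (M.lam 0 d)) * (if M.yLow ≤ (y : EReal) then 1 else 0)

/-- `δ̲_d = ∫ y dF̅_{d01}(y) - E(Y_{d00})`. -/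
def deltaLow (d : Fin 2) : ℝ :=
  (∫ y, y ∂(stieltjesOf (M.trimHigh d))) - M.condE (M.dcell d 0 0) M.Yobs

/-- `δ̅_d = ∫ y dF̲_{d01}(y) - E(Y_{d00})`. -/
def deltaHigh (d : Fin 2) : ℝ :=
  (∫ y, y ∂(stieltjesOf (M.trimLow d))) - M.condE (M.dcell d 0 0) M.Yobs

/-- `(E(Y_{11}) - E(Y_{10} + δ_{D_{10}})) / (E(D_{11}) - E(D_{10}))`. -/
def tcRatio (δ : Fin 2 → ℝ) : ℝ :=
  (M.condE (M.cell 1 1) M.Yobs - M.condE (M.cell 1 0) (fun ω => M.Yobs ω + δ (M.D ω)))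
    / (M.rate 1 1 1 - M.rate 1 1 0)

/-- Lower TC bound. -/
def tcLow : ℝ := M.tcRatio M.deltaHigh

/-- Upper TC bound. -/
def tcHigh : ℝ := M.tcRatio M.deltaLow

/-! ### CIC bounds -/

/-- `H_d = F_{Y_{d10}} ∘ F_{Y_{d00}}⁻¹`. -/
def H (d : Fin 2) (x : ℝ) : ℝ := cdfAt (M.F d 1 0) (genInv (M.F d 0 0) x)

/-- `H_d⁻¹`: as `H_d` is the cdf of the `[0,1]`-valued variable `F_{Y_{d00}}(Y_{d10})`, it equals `0`
for `q < 0` and `1` for `q > 1`. -/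
def Hinv (d : Fin 2) (q : ℝ) : ℝ :=
  if q < 0 then 0 else if 1 < q then 1 else sInf {x : ℝ | x ∈ Set.Icc 0 1 ∧ q ≤ M.H d x}

/-- `G_d(T) = λ_{0d} F_{Y_{d01}} + (1 - λ_{0d}) T`. -/
def Gop (d : Fin 2) (T : ℝ → ℝ) (y : ℝ) : ℝ := M.lam 0 d * M.F d 0 1 y + (1 - M.lam 0 d) * T y

/-- `C_d(T) = (P(D_11=d) F_{Y_{d11}} - P(D_10=d) H_d ∘ G_d(T)) / (P(D_11=d) - P(D_10=d))`. -/
def Cop (d : Fin 2) (T : ℝ → ℝ) (y : ℝ) : ℝ :=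
  (M.rate d 1 1 * M.F d 1 1 y - M.rate d 1 0 * M.H d (M.Gop d T y))
    / (M.rate d 1 1 - M.rate d 1 0)

/-- `T̲_d`. -/
def Tlow (d : Fin 2) (y : ℝ) : ℝ :=
  M01 ((M.lam 0 d * M.F d 0 1 y - M.Hinv d (M.lam 1 d * M.F d 1 1 y)) / (M.lam 0 d - 1))

/-- `T̅_d`. -/
def Thigh (d : Fin 2) (y : ℝ) : ℝ :=
  M01 ((M.lam 0 d * M.F d 0 1 y - M.Hinv d (M.lam 1 d * M.F d 1 1 y + (1 - M.lam 1 d)))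
    / (M.lam 0 d - 1))

/-- `F̲_{CIC,d}(y) = sup_{y' ≤ y} C_d(T̲_d)(y')`. -/
def cicLow (d : Fin 2) (y : ℝ) : ℝ := sSup (M.Cop d (M.Tlow d) '' Set.Iic y)

/-- `F̅_{CIC,d}(y) = inf_{y' ≥ y} C_d(T̅_d)(y')`. -/
def cicHigh (d : Fin 2) (y : ℝ) : ℝ := sInf (M.Cop d (M.Thigh d) '' Set.Ici y)

/-- `F̲_{CIC,d}` as a cdf on `[y̲, y̅]`. -/
def cicLowOn (d : Fin 2) : ℝ → ℝ := cdfOnInterval M.yLow M.yHigh (M.cicLow d)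

/-- `F̅_{CIC,d}` as a cdf on `[y̲, y̅]`. -/
def cicHighOn (d : Fin 2) : ℝ → ℝ := cdfOnInterval M.yLow M.yHigh (M.cicHigh d)

/-- Lower CIC bound on `Δ`. -/
def wCicLow : EReal := extMean (M.cicHighOn 1) - extMean (M.cicLowOn 0)

/-- Upper CIC bound on `Δ`. -/
def wCicHigh : EReal := extMean (M.cicLowOn 1) - extMean (M.cicHighOn 0)

/-- Lower CIC bound on `τ_q`. -/
def tauLow (q : ℝ) : EReal :=
  max (genInv (M.cicHigh 1) q) M.yLow - min (genInv (M.cicLow 0) q) M.yHigh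

/-- Upper CIC bound on `τ_q`. -/
def tauHigh (q : ℝ) : EReal :=
  min (genInv (M.cicLow 1) q) M.yHigh - max (genInv (M.cicHigh 0) q) M.yLow

/-- Existence of moments: `∫ |y| dF̅_{CIC,d}(y)` and `∫ |y| dF̲_{CIC,d}(y)` are finite (integrals
over `ℝ`). -/
def MomentsExist : Prop :=
  ∀ d, Integrable (fun y : ℝ => y) (stieltjesOf (M.cicHighOn d)) ∧
    Integrable (fun y : ℝ => y) (stieltjesOf (M.cicLowOn d))

/-- Increasing bounds ("increasing" in the weak sense). The second condition bears on the `d` for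
which `T̲_d` and `T̅_d` are defined, i.e. such that `P(D_10 = d) > 0`. -/
def IncreasingBounds : Prop :=
  (∀ d g t, 0 < M.rate d g t →
    ContDiffOn ℝ 1 (M.F d g t) (interior M.suppY) ∧
      ∀ y ∈ interior M.suppY, 0 < deriv (M.F d g t) y) ∧
  (∀ d, 0 < M.rate d 1 0 →
    MonotoneOn (M.Tlow d) M.suppY ∧ MonotoneOn (M.Thigh d) M.suppY ∧
    MonotoneOn (M.Gop d (M.Tlow d)) M.suppY ∧ MonotoneOn (M.Gop d (M.Thigh d)) M.suppY ∧
    MonotoneOn (M.Cop d (M.Tlow d)) M.suppY ∧ MonotoneOn (M.Cop d (M.Thigh d)) M.suppY)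

/-- The law of the observed variables `(D, G, T, Y)`. -/
def obsLaw : Measure (Fin 2 × Fin 2 × Fin 2 × ℝ) :=
  M.P.map (fun ω => (M.D ω, M.G ω, M.T ω, M.Yobs ω))

/-- `N` is a data generating process compatible with the distribution of the data in `M` and with
the assumptions. (The treatment rates, the CIC bounds, the existence of moments and the increasing
bounds condition depend on the law of the data only, and hence are shared by `M` and `N`.) -/
def Admissible (N : FuzzyDiD.{0}) : Prop :=
  N.obsLaw = M.obsLaw ∧ N.Participation ∧ N.FirstStage ∧ N.MonotoneInvariant ∧
    N.DataRestrictions ∧ N.OutcomesInBounds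

end FuzzyDiD

end

/-! Fix `d`. In each group the sets of propensities with treatment `d` at the two periods are nested
half-lines, so in period 1 the units with `D = d` are those with `D(0) = d`, plus or minus the
switchers. With `λ` the ratio of the two rates, one affine identity covers both signs
(`Participation.rate_mul_sub_stay`). In the control group the cdf of `Y(d)` given `D(0) = d` is `Φ =
λ F_{d01} + (1 - λ) K`, with `K` the unknown cdf of the control switchers. In the treatment group
the same identity holds with `λ'`, `F_{d11}` and the target `C`, the cdf of `Y_{11}(d)` given `S`.
All the indeterminacy sits in `K`, of which one knows that it is a cdf.

TC. The numerator of the Wald ratio is `P(S) Δ` plus the sum over `d` of `P(D_10 = d)` times the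
error made on the trend of `Y(d)`. Common trends move this error to the control group, where `0 ≤ K
≤ 1` and `0 ≤ Φ ≤ 1` squeeze `Φ` between the trimmed cdfs, and means decrease in the cdf
(`trend_bounds`, `tc_bounds`).

CIC. An order isomorphism `e` of the line extends `H_d`. Since `h_d(·, t)` is increasing, the events
`Y(d) ≤ y` of both periods are lower sets in the unobservable, hence nested, and the cdf given `D(0)
= d` in the treatment group is `e ∘ Φ` (`MonotoneInvariant.stay_eq`). So `C = (λ' F_{d11} - e ∘ Φ) /
(λ' - 1)`, and `C = 0` or `C = 1` correspond to explicit targets for `Φ`. The function `T̲_d` (resp.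
`T̅_d`) is the value of `K` in the unit interval that brings `Φ` closest to the target of `C = 0`
(resp. `C = 1`); this gives the pointwise bounds (`cic_scalar`, `cop_bounds`), and monotonicity of
`C` gives the supremum and infimum. Means are handled through tail integrals, which remain
meaningful when mass is missing at infinity (`SubCdf.extMean_eq`).

Sharpness. Conversely, let `Φ` be a continuous cdf, strictly increasing on the interior of the
support, whose implied `K` and `C` are nondecreasing (`Feasible`). It comes from an admissible
process: keep the law of `(G, T, V)`, draw outcomes stratum by stratum, and let `h_d(·, 1)` be the
change of variable that turns `F_{d00}` into `Φ` (`Completion`, `Standing.exists_completion`).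
Monotonicity of `K` and `C` is a constraint on increments of `Φ`, stable under maximum and minimum.
The `Φ` attached to a bound satisfies this constraint but may be flat or fail to reach its limit, so
it is perturbed by such lattice operations, in four cases according to the signs of `λ - 1` and `λ'
- 1` (`CicData.lowSeq`); the upper bound follows by the reflection `y ↦ -y`. Quantiles and means are
then passed to the limit, the means with care because the limits may be infinite. -/

noncomputable section

/-! ### Tail integrals and means of possibly defective cdfs -/

open Set ENNReal in
lemma lintegral_Ioi_comp_add (c : ℝ) (G : ℝ → ENNReal) :
    ∫⁻ t in Ioi (0 : ℝ), G (c + t) = ∫⁻ y in Ioi c, G y := by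
  have h := (measurePreserving_add_left volume c).setLIntegral_comp_emb
    (MeasurableEquiv.addLeft c).measurableEmbedding G (Ioi 0)
  rw [show (fun x => c + x) '' Ioi (0 : ℝ) = Ioi c by simp] at h
  exact h

open Set ENNReal in
lemma lintegral_Ioi_comp_sub (c : ℝ) (G : ℝ → ENNReal) :
    ∫⁻ t in Ioi (0 : ℝ), G (c - t) = ∫⁻ y in Iic c, G y := by
  have h := (Measure.measurePreserving_sub_left volume c).setLIntegral_comp_emb
    (MeasurableEquiv.subLeft c).measurableEmbedding G (Ioi 0)
  rw [show (fun x => c - x) '' Ioi (0 : ℝ) = Iio c by simp] at h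
  rw [← restrict_Iio_eq_restrict_Iic]
  exact h

/-- Upper tail integral of a cdf. -/
def upT (c : ℝ) (F : ℝ → ℝ) : ENNReal := ∫⁻ y in Set.Ioi c, ENNReal.ofReal (1 - F y)

/-- Lower tail integral of a cdf. -/
def loT (c : ℝ) (F : ℝ → ℝ) : ENNReal := ∫⁻ y in Set.Iic c, ENNReal.ofReal (F y)

lemma upT_anti {c : ℝ} {F F' : ℝ → ℝ} (h : ∀ y, F y ≤ F' y) : upT c F' ≤ upT c F :=
  lintegral_mono fun y => ENNReal.ofReal_le_ofReal (by linarith [h y])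

lemma loT_mono {c : ℝ} {F F' : ℝ → ℝ} (h : ∀ y, F y ≤ F' y) : loT c F ≤ loT c F' :=
  lintegral_mono fun y => ENNReal.ofReal_le_ofReal (h y)

/-- The layer-cake formula for the positive part of `y - c`, followed by the shift `t ↦ c + t`. -/
lemma lintegral_pos_tail (m : Measure ℝ) (c : ℝ) :
    ∫⁻ y, ENNReal.ofReal (y - c) ∂m = ∫⁻ y in Set.Ioi c, m (Set.Ioi y) := by
  have h1 : ∫⁻ y, ENNReal.ofReal (y - c) ∂m = ∫⁻ y, ENNReal.ofReal (max (y - c) 0) ∂m := by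
    refine lintegral_congr fun y => ?_
    rcases le_total (y - c) 0 with h | h
    · rw [max_eq_right h, ENNReal.ofReal_of_nonpos h, ENNReal.ofReal_zero]
    · rw [max_eq_left h]
  rw [h1, lintegral_eq_lintegral_meas_lt m (f := fun y => max (y - c) 0) (Eventually.of_forall fun y => le_max_right _ _)
    (by fun_prop), ← lintegral_Ioi_comp_add c]
  refine setLIntegral_congr_fun measurableSet_Ioi fun t ht => ?_
  congr 1
  ext y
  simp only [Set.mem_ofPred_eq, lt_max_iff, Set.mem_Ioi] at ht ⊢
  constructor
  · rintro (h | h) <;> linarith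
  · intro h; left; linarith

lemma lintegral_neg_tail (m : Measure ℝ) (c : ℝ) :
    ∫⁻ y, ENNReal.ofReal (c - y) ∂m = ∫⁻ y in Set.Iic c, m (Set.Iic y) := by
  have h1 : ∫⁻ y, ENNReal.ofReal (c - y) ∂m = ∫⁻ y, ENNReal.ofReal (max (c - y) 0) ∂m := by
    refine lintegral_congr fun y => ?_
    rcases le_total (c - y) 0 with h | h
    · rw [max_eq_right h, ENNReal.ofReal_of_nonpos h, ENNReal.ofReal_zero]
    · rw [max_eq_left h]
  rw [h1, lintegral_eq_lintegral_meas_le m (f := fun y => max (c - y) 0) (Eventually.of_forall fun y => le_max_right _ _)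
    (by fun_prop), ← lintegral_Ioi_comp_sub c]
  refine setLIntegral_congr_fun measurableSet_Ioi fun t ht => ?_
  congr 1
  ext y
  simp only [Set.mem_ofPred_eq, le_max_iff, Set.mem_Ioi, Set.mem_Iic] at ht ⊢
  constructor
  · rintro (h | h) <;> linarith
  · intro h; left; linarith

lemma integrable_id_iff_tails (m : Measure ℝ) [IsFiniteMeasure m] (c : ℝ) :
    Integrable (fun y : ℝ => y) m ↔
      ∫⁻ y in Set.Ioi c, m (Set.Ioi y) < ⊤ ∧ ∫⁻ y in Set.Iic c, m (Set.Iic y) < ⊤ := by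
  rw [← lintegral_pos_tail, ← lintegral_neg_tail]
  have h0 : Integrable (fun y : ℝ => y) m ↔ Integrable (fun y : ℝ => y - c) m := by
    constructor
    · intro h; exact h.sub (integrable_const c)
    · intro h; exact (h.add (integrable_const c)).congr (Eventually.of_forall fun y => by simp)
  rw [h0]
  constructor
  · intro h
    refine ⟨h.lintegral_lt_top, ?_⟩
    simpa using h.neg.lintegral_lt_top
  · rintro ⟨h1, h2⟩
    refine ⟨by fun_prop, ?_⟩
    rw [hasFiniteIntegral_iff_norm]
    have h3 : ∀ y : ℝ, ENNReal.ofReal ‖y - c‖ ≤ ENNReal.ofReal (y - c) + ENNReal.ofReal (c - y) := by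
      intro y
      rw [Real.norm_eq_abs]
      rcases abs_cases (y - c) with ⟨h, -⟩ | ⟨h, -⟩ <;> rw [h]
      · exact le_self_add
      · rw [neg_sub]; exact le_add_self
    refine (lintegral_mono h3).trans_lt ?_
    rw [lintegral_add_left (by fun_prop)]
    exact ENNReal.add_lt_top.2 ⟨h1, h2⟩

lemma integral_eq_tails (m : Measure ℝ) [IsFiniteMeasure m] (c : ℝ)
    (h : Integrable (fun y : ℝ => y) m) :
    ∫ y, y ∂m = c * m.real Set.univ + ((∫⁻ y in Set.Ioi c, m (Set.Ioi y)).toReal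
      - (∫⁻ y in Set.Iic c, m (Set.Iic y)).toReal) := by
  rw [← lintegral_pos_tail, ← lintegral_neg_tail]
  have h2 := integral_eq_lintegral_pos_part_sub_lintegral_neg_part (h.sub (integrable_const c))
  simp only [Pi.sub_apply, neg_sub] at h2
  rw [← h2, integral_sub h (integrable_const c), integral_const]
  simp [mul_comm]

/-- A monotone function has countably many discontinuities. This allows `F` itself, rather than its
right-continuous version, in the tail integrals. -/
lemma ae_rightLim_eq {F : ℝ → ℝ} (hF : Monotone F) :
    ∀ᵐ y, Function.rightLim F y = F y := by
  have h := hF.countable_not_continuousAt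
  refine (h.ae_notMem volume).mono fun y hy => ?_
  have : ContinuousAt F y := by simpa using hy
  exact (this.continuousWithinAt).rightLim_eq


lemma ofReal_one_sub_real_Iic (m : Measure ℝ) [IsProbabilityMeasure m] (y : ℝ) :
    ENNReal.ofReal (1 - m.real (Set.Iic y)) = m (Set.Ioi y) := by
  rw [← probReal_compl_eq_one_sub measurableSet_Iic, Set.compl_Iic, ofReal_measureReal]

lemma ofReal_real_Iic (m : Measure ℝ) [IsProbabilityMeasure m] (y : ℝ) :
    ENNReal.ofReal (m.real (Set.Iic y)) = m (Set.Iic y) := ofReal_measureReal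

lemma integrable_id_iff_upT_loT (m : Measure ℝ) [IsProbabilityMeasure m] (c : ℝ) :
    Integrable (fun y : ℝ => y) m ↔
      upT c (fun y => m.real (Set.Iic y)) < ⊤ ∧ loT c (fun y => m.real (Set.Iic y)) < ⊤ := by
  rw [integrable_id_iff_tails m c, upT, loT]
  simp only [ofReal_one_sub_real_Iic, ofReal_real_Iic]

lemma integral_eq_upT_loT (m : Measure ℝ) [IsProbabilityMeasure m] (c : ℝ)
    (h : Integrable (fun y : ℝ => y) m) :
    ∫ y, y ∂m = c + ((upT c (fun y => m.real (Set.Iic y))).toReal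
      - (loT c (fun y => m.real (Set.Iic y))).toReal) := by
  rw [integral_eq_tails m c h, upT, loT]
  simp only [ofReal_one_sub_real_Iic, ofReal_real_Iic]
  simp

/-- A nondecreasing function with values in the unit interval. -/
structure SubCdf (F : ℝ → ℝ) : Prop where
  mono : Monotone F
  nonneg : ∀ y, 0 ≤ F y
  le_one : ∀ y, F y ≤ 1

namespace SubCdf

variable {F : ℝ → ℝ} (h : SubCdf F)
include h

lemma bddAbove : BddAbove (Set.range F) := ⟨1, by rintro _ ⟨y, rfl⟩; exact h.le_one y⟩
lemma bddBelow : BddBelow (Set.range F) := ⟨0, by rintro _ ⟨y, rfl⟩; exact h.nonneg y⟩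

lemma iSup_le_one : ⨆ y, F y ≤ 1 := ciSup_le h.le_one
lemma iInf_nonneg : 0 ≤ ⨅ y, F y := le_ciInf h.nonneg

lemma tendsto_rightLim_top : Tendsto (Function.rightLim F) atTop (𝓝 (⨆ y, F y)) := by
  have h1 := tendsto_atTop_ciSup h.mono h.bddAbove
  refine tendsto_of_tendsto_of_tendsto_of_le_of_le h1
    (h1.comp (tendsto_atTop_add_const_right _ 1 tendsto_id)) (fun y => h.mono.le_rightLim le_rfl)
    fun y => h.mono.rightLim_le (by simp)

lemma tendsto_rightLim_bot : Tendsto (Function.rightLim F) atBot (𝓝 (⨅ y, F y)) := by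
  have h1 := tendsto_atBot_ciInf h.mono h.bddBelow
  refine tendsto_of_tendsto_of_tendsto_of_le_of_le h1
    (h1.comp (tendsto_atBot_add_const_right _ 1 tendsto_id)) (fun y => h.mono.le_rightLim le_rfl)
    fun y => h.mono.rightLim_le (by simp)

lemma stieltjesOf_Ioi (y : ℝ) :
    stieltjesOf F (Set.Ioi y) = ENNReal.ofReal ((⨆ y, F y) - Function.rightLim F y) := by
  rw [stieltjesOf, dif_pos h.mono]
  exact StieltjesFunction.measure_Ioi _ h.tendsto_rightLim_top y

lemma stieltjesOf_Iic (y : ℝ) :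
    stieltjesOf F (Set.Iic y) = ENNReal.ofReal (Function.rightLim F y - ⨅ y, F y) := by
  rw [stieltjesOf, dif_pos h.mono]
  exact StieltjesFunction.measure_Iic _ h.tendsto_rightLim_bot y

lemma stieltjesOf_univ :
    stieltjesOf F Set.univ = ENNReal.ofReal ((⨆ y, F y) - ⨅ y, F y) := by
  rw [stieltjesOf, dif_pos h.mono]
  exact StieltjesFunction.measure_univ _ h.tendsto_rightLim_bot h.tendsto_rightLim_top

lemma isFiniteMeasure : IsFiniteMeasure (stieltjesOf F) :=
  ⟨by rw [h.stieltjesOf_univ]; exact ENNReal.ofReal_lt_top⟩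

lemma upT_eq (c : ℝ) (hS : ⨆ y, F y = 1) :
    upT c F = ∫⁻ y in Set.Ioi c, stieltjesOf F (Set.Ioi y) := by
  simp_rw [h.stieltjesOf_Ioi, hS]
  refine lintegral_congr_ae (ae_restrict_of_ae ?_)
  filter_upwards [ae_rightLim_eq h.mono] with y hy
  rw [hy]

lemma loT_eq (c : ℝ) (hi : ⨅ y, F y = 0) :
    loT c F = ∫⁻ y in Set.Iic c, stieltjesOf F (Set.Iic y) := by
  simp_rw [h.stieltjesOf_Iic, hi, sub_zero]
  refine lintegral_congr_ae (ae_restrict_of_ae ?_)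
  filter_upwards [ae_rightLim_eq h.mono] with y hy
  rw [hy]

/-- Mass escaping to `+∞` keeps `1 - F` above a positive constant on a half-line of infinite length.
-/
lemma upT_eq_top (c : ℝ) (hS : ⨆ y, F y < 1) : upT c F = ⊤ := by
  have h1 : ∫⁻ _ in Set.Ioi c, ENNReal.ofReal (1 - ⨆ y, F y) ≤ upT c F :=
    lintegral_mono fun y => ENNReal.ofReal_le_ofReal (by linarith [le_ciSup h.bddAbove y])
  rw [setLIntegral_const, Real.volume_Ioi, ENNReal.mul_top (by simpa using hS)] at h1
  exact top_le_iff.1 h1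

lemma loT_eq_top (c : ℝ) (hi : 0 < ⨅ y, F y) : loT c F = ⊤ := by
  have h1 : ∫⁻ _ in Set.Iic c, ENNReal.ofReal (⨅ y, F y) ≤ loT c F :=
    lintegral_mono fun y => ENNReal.ofReal_le_ofReal (ciInf_le h.bddBelow y)
  rw [setLIntegral_const, Real.volume_Iic, ENNReal.mul_top (ENNReal.ofReal_pos.2 hi).ne'] at h1
  exact top_le_iff.1 h1

lemma upT_lt_top (c : ℝ) (hI : Integrable (fun y : ℝ => y) (stieltjesOf F))
    (hS : ⨆ y, F y = 1) : upT c F < ⊤ := by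
  have := h.isFiniteMeasure
  rw [h.upT_eq c hS]
  exact ((integrable_id_iff_tails _ c).1 hI).1

lemma loT_lt_top (c : ℝ) (hI : Integrable (fun y : ℝ => y) (stieltjesOf F))
    (hi : ⨅ y, F y = 0) : loT c F < ⊤ := by
  have := h.isFiniteMeasure
  rw [h.loT_eq c hi]
  exact ((integrable_id_iff_tails _ c).1 hI).2

/-- This is `E X = c + ∫_c^∞ (1 - F) - ∫_{-∞}^c F`. The conventions on mass at infinity agree with
it, because a defect at either end makes the corresponding tail integral infinite. Both tail
integrals being monotone in `F`, pointwise order of cdfs becomes order of extended means. -/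
lemma extMean_eq (c : ℝ) (hI : Integrable (fun y : ℝ => y) (stieltjesOf F)) :
    extMean F = (c : EReal) + (upT c F : EReal) - (loT c F : EReal) := by
  have := h.isFiniteMeasure
  rw [extMean]
  rcases h.iSup_le_one.lt_or_eq with hS | hS <;> rcases h.iInf_nonneg.lt_or_eq with hi | hi
  -- With mass missing at both ends, both sides equal `⊥`, since `⊤ + ⊥ = ⊥` in `EReal`.
  · rw [h.upT_eq_top c hS, h.loT_eq_top c hi, EReal.coe_mul_top_of_pos (by linarith),
      EReal.coe_mul_bot_of_pos hi]
    simp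
  · rw [h.upT_eq_top c hS, EReal.coe_mul_top_of_pos (by linarith), ← hi]
    have h1 := (h.loT_lt_top c hI hi.symm).ne
    lift loT c F to NNReal using h1 with r
    simp
  · rw [h.loT_eq_top c hi, EReal.coe_mul_bot_of_pos hi]
    simp
  · rw [integral_eq_tails _ c hI, ← h.upT_eq c hS, ← h.loT_eq c hi.symm, measureReal_def,
      h.stieltjesOf_univ, hS, ← hi]
    have h1 := (h.loT_lt_top c hI hi.symm).ne
    have h2 := (h.upT_lt_top c hI hS).ne
    rw [← EReal.coe_ennreal_toReal h1, ← EReal.coe_ennreal_toReal h2]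
    simp only [sub_zero, ENNReal.ofReal_one, ENNReal.toReal_one, mul_one, sub_self, EReal.coe_zero,
      zero_mul, add_zero]
    rw [← EReal.coe_add, ← EReal.coe_sub, add_sub_assoc]

end SubCdf

lemma subCdf_real_Iic (m : Measure ℝ) [IsProbabilityMeasure m] :
    SubCdf (fun y => m.real (Set.Iic y)) :=
  ⟨fun _ _ h => measureReal_mono (Set.Iic_subset_Iic.2 h), fun _ => measureReal_nonneg,
    fun _ => measureReal_le_one⟩

lemma integral_eq_ereal (m : Measure ℝ) [IsProbabilityMeasure m] (c : ℝ)
    (h : Integrable (fun y : ℝ => y) m) :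
    ((∫ y, y ∂m : ℝ) : EReal) = (c : EReal) + (upT c (fun y => m.real (Set.Iic y)) : EReal)
      - (loT c (fun y => m.real (Set.Iic y)) : EReal) := by
  obtain ⟨h1, h2⟩ := (integrable_id_iff_upT_loT m c).1 h
  rw [integral_eq_upT_loT m c h, ← EReal.coe_ennreal_toReal h1.ne, ← EReal.coe_ennreal_toReal h2.ne,
    ← EReal.coe_add, ← EReal.coe_sub, add_sub_assoc]

lemma extMean_le_integral (m : Measure ℝ) [IsProbabilityMeasure m] {F : ℝ → ℝ} (hF : SubCdf F)
    (h : Integrable (fun y : ℝ => y) m) (hI : Integrable (fun y : ℝ => y) (stieltjesOf F))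
    (hle : ∀ y, m.real (Set.Iic y) ≤ F y) : extMean F ≤ ((∫ y, y ∂m : ℝ) : EReal) := by
  rw [hF.extMean_eq 0 hI, integral_eq_ereal m 0 h]
  refine EReal.sub_le_sub (add_le_add le_rfl ?_) ?_
  · exact_mod_cast upT_anti hle
  · exact_mod_cast loT_mono hle

lemma integral_le_extMean (m : Measure ℝ) [IsProbabilityMeasure m] {F : ℝ → ℝ} (hF : SubCdf F)
    (h : Integrable (fun y : ℝ => y) m) (hI : Integrable (fun y : ℝ => y) (stieltjesOf F))
    (hle : ∀ y, F y ≤ m.real (Set.Iic y)) : ((∫ y, y ∂m : ℝ) : EReal) ≤ extMean F := by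
  rw [hF.extMean_eq 0 hI, integral_eq_ereal m 0 h]
  refine EReal.sub_le_sub (add_le_add le_rfl ?_) ?_
  · exact_mod_cast upT_anti hle
  · exact_mod_cast loT_mono hle

/-! ### Conditional laws in cells, stayers and switchers -/

lemma cond_real_apply {Ω : Type*} [MeasurableSpace Ω] (P : Measure Ω) {s : Set Ω}
    (hs : MeasurableSet s) (t : Set Ω) : (cond P s).real t = (P.real s)⁻¹ * P.real (s ∩ t) := by
  rw [measureReal_def, cond_apply hs, ENNReal.toReal_mul, ENNReal.toReal_inv]
  rfl

lemma real_mul_cond_real {Ω : Type*} [MeasurableSpace Ω] (P : Measure Ω) [IsFiniteMeasure P]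
    {s : Set Ω} (hs : MeasurableSet s) (t : Set Ω) :
    P.real s * (cond P s).real t = P.real (s ∩ t) := by
  rw [cond_real_apply P hs]
  by_cases h : P.real s = 0
  · have : P.real (s ∩ t) = 0 :=
      le_antisymm (h ▸ measureReal_mono Set.inter_subset_left) measureReal_nonneg
    rw [h, this, zero_mul]
  · rw [mul_inv_cancel_left₀ h]

namespace FuzzyDiD

variable (M : FuzzyDiD.{u})

/-- Values of the propensity for which treatment at period `t` in group `g` is `d`. -/
def thr (g t d : Fin 2) : Set ℝ := {x | (if M.v g t ≤ x then 1 else 0) = d}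

/-- Law of the propensity in group `g`. -/
def propLaw (g : Fin 2) : Measure ℝ := (cond M.P {ω | M.G ω = g}).map M.V

/-- Law of the outcome in the cell `D = d, G = g, T = t`. -/
def cellLaw (d g t : Fin 2) : Measure ℝ := (cond M.P (M.dcell d g t)).map M.Yobs

lemma thr_one (g t : Fin 2) : M.thr g t 1 = Set.Ici (M.v g t) := by
  ext x; simp [thr]

lemma thr_zero (g t : Fin 2) : M.thr g t 0 = Set.Iio (M.v g t) := by
  ext x; simp [thr]

lemma measurableSet_thr (g t d : Fin 2) : MeasurableSet (M.thr g t d) := by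
  fin_cases d
  · exact (M.thr_zero g t) ▸ measurableSet_Iio
  · exact (M.thr_one g t) ▸ measurableSet_Ici

/-- Half-lines with the same orientation are nested. This is what excludes switchers in opposite
directions within a group. -/
lemma thr_total (g d : Fin 2) : M.thr g 0 d ⊆ M.thr g 1 d ∨ M.thr g 1 d ⊆ M.thr g 0 d := by
  fin_cases d
  · simp only [Fin.zero_eta, thr_zero, Set.Iio_subset_Iio_iff]; exact le_total _ _
  · simp only [Fin.mk_one, thr_one, Set.Ici_subset_Ici]; exact le_total _ _

lemma Dpot_eq_iff (t d : Fin 2) (ω : M.Ω) : M.Dpot t ω = d ↔ M.V ω ∈ M.thr (M.G ω) t d := Iff.rfl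

lemma measurable_Dpot (t : Fin 2) : Measurable (M.Dpot t) := by
  refine Measurable.ite ?_ measurable_const measurable_const
  exact measurableSet_le ((measurable_of_finite fun g => M.v g t).comp M.measurable_G)
    M.measurable_V

lemma measurable_D : Measurable M.D := by
  have : M.D = fun ω => if M.T ω = 0 then M.Dpot 0 ω else M.Dpot 1 ω := by
    ext ω
    rw [D]
    rcases Fin.exists_fin_two.1 ⟨M.T ω, rfl⟩ with h | h <;> simp [h]
  rw [this]
  exact Measurable.ite (M.measurable_T (measurableSet_singleton 0)) (M.measurable_Dpot 0)
    (M.measurable_Dpot 1)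

lemma measurable_Yobs : Measurable M.Yobs := by
  have : M.Yobs = fun ω => if M.D ω = 0 then M.Y 0 ω else M.Y 1 ω := by
    ext ω
    rw [Yobs]
    rcases Fin.exists_fin_two.1 ⟨M.D ω, rfl⟩ with h | h <;> simp [h]
  rw [this]
  exact Measurable.ite (M.measurable_D (measurableSet_singleton 0)) (M.measurable_Y 0)
    (M.measurable_Y 1)

lemma measurableSet_cell (g t : Fin 2) : MeasurableSet (M.cell g t) :=
  (M.measurable_G (measurableSet_singleton g)).inter (M.measurable_T (measurableSet_singleton t))

lemma measurableSet_dcell (d g t : Fin 2) : MeasurableSet (M.dcell d g t) :=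
  (M.measurable_D (measurableSet_singleton d)).inter (M.measurableSet_cell g t)

lemma cell_real_pos (g t : Fin 2) : 0 < M.P.real (M.cell g t) :=
  ENNReal.toReal_pos (M.cell_pos g t).ne' (measure_ne_top _ _)

instance (g t : Fin 2) : IsProbabilityMeasure (cond M.P (M.cell g t)) :=
  cond_isProbabilityMeasure (M.cell_pos g t).ne'

lemma group_pos (g : Fin 2) : 0 < M.P {ω | M.G ω = g} :=
  (M.cell_pos g 0).trans_le (measure_mono fun _ h => h.1)

instance (g : Fin 2) : IsProbabilityMeasure (cond M.P {ω | M.G ω = g}) :=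
  cond_isProbabilityMeasure (M.group_pos g).ne'

instance (g : Fin 2) : IsProbabilityMeasure (M.propLaw g) :=
  Measure.isProbabilityMeasure_map M.measurable_V.aemeasurable

variable {M}

/-- Since `V ⊥ T | G`, the propensity has the same law in both periods of a group. Counterfactual
statuses such as `D(0)` in period 1 therefore have probabilities given by observed rates. -/
lemma Participation.real_cell_inter (h : M.Participation) (g t : Fin 2) {B : Set ℝ}
    (hB : MeasurableSet B) :
    M.P.real (M.cell g t ∩ M.V ⁻¹' B) = M.P.real (M.cell g t) * (M.propLaw g).real B := by
  have hG : MeasurableSet {ω | M.G ω = g} := M.measurable_G (measurableSet_singleton g)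
  have h1 := (h g).measure_inter_preimage_eq_mul B {t} hB (measurableSet_singleton t)
  have h2 := congrArg ENNReal.toReal h1
  rw [ENNReal.toReal_mul] at h2
  simp only [← measureReal_def] at h2
  have hpos : M.P.real {ω | M.G ω = g} ≠ 0 :=
    (ENNReal.toReal_pos (M.group_pos g).ne' (measure_ne_top _ _)).ne'
  have e1 := real_mul_cond_real M.P hG (M.V ⁻¹' B ∩ M.T ⁻¹' {t})
  have e2 := real_mul_cond_real M.P hG (M.T ⁻¹' {t})
  have s1 : {ω | M.G ω = g} ∩ (M.V ⁻¹' B ∩ M.T ⁻¹' {t}) = M.cell g t ∩ M.V ⁻¹' B := by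
    ext ω; simp only [cell, Set.mem_inter_iff, Set.mem_ofPred_eq, Set.mem_preimage,
      Set.mem_singleton_iff]; tauto
  have s2 : {ω | M.G ω = g} ∩ (M.T ⁻¹' {t}) = M.cell g t := by
    ext ω; simp [cell]
  rw [s1] at e1
  rw [s2] at e2
  rw [← e1, ← e2, h2, propLaw, map_measureReal_apply M.measurable_V hB]
  ring

lemma Participation.cond_real (h : M.Participation) (g t : Fin 2) {B : Set ℝ}
    (hB : MeasurableSet B) :
    (cond M.P (M.cell g t)).real (M.V ⁻¹' B) = (M.propLaw g).real B := by
  rw [cond_real_apply _ (M.measurableSet_cell g t), h.real_cell_inter g t hB,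
    inv_mul_cancel_left₀ (M.cell_real_pos g t).ne']

lemma cond_cell_congr {g t : Fin 2} {s s' : Set M.Ω}
    (h : ∀ ω, M.G ω = g → M.T ω = t → (ω ∈ s ↔ ω ∈ s')) :
    (cond M.P (M.cell g t)).real s = (cond M.P (M.cell g t)).real s' := by
  rw [cond_real_apply _ (M.measurableSet_cell g t), cond_real_apply _ (M.measurableSet_cell g t)]
  congr 2
  ext ω
  simp only [cell, Set.mem_inter_iff, Set.mem_ofPred_eq]
  constructor
  · rintro ⟨⟨h1, h2⟩, h3⟩; exact ⟨⟨h1, h2⟩, (h ω h1 h2).1 h3⟩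
  · rintro ⟨⟨h1, h2⟩, h3⟩; exact ⟨⟨h1, h2⟩, (h ω h1 h2).2 h3⟩

lemma Participation.real_Dpot (h : M.Participation) (g t s d : Fin 2) :
    (cond M.P (M.cell g t)).real {ω | M.Dpot s ω = d} = (M.propLaw g).real (M.thr g s d) := by
  rw [← h.cond_real g t (M.measurableSet_thr g s d)]
  refine cond_cell_congr fun ω hg ht => ?_
  simp only [Set.mem_ofPred_eq, Dpot_eq_iff, hg, Set.mem_preimage]

lemma Participation.rate_eq (h : M.Participation) (d g t : Fin 2) :
    M.rate d g t = (M.propLaw g).real (M.thr g t d) := by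
  rw [← h.real_Dpot g t t d]
  refine cond_cell_congr fun ω hg ht => ?_
  simp only [Set.mem_ofPred_eq, D, ht]

variable (M) in
lemma rate_nonneg (d g t : Fin 2) : 0 ≤ M.rate d g t := measureReal_nonneg

variable (M) in
lemma rate_zero (g t : Fin 2) : M.rate 0 g t = 1 - M.rate 1 g t := by
  rw [rate, rate]
  rw [← probReal_compl_eq_one_sub (s := {ω | M.D ω = 1})
    (M.measurable_D (measurableSet_singleton 1))]
  congr 1
  ext ω
  simp only [Set.mem_ofPred_eq, Set.mem_compl_iff]
  rcases Fin.exists_fin_two.1 ⟨M.D ω, rfl⟩ with h | h <;> simp [h]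

variable (M) in
lemma real_dcell (d g t : Fin 2) :
    M.P.real (M.dcell d g t) = M.P.real (M.cell g t) * M.rate d g t := by
  rw [rate, real_mul_cond_real _ (M.measurableSet_cell g t)]
  congr 1
  ext ω
  simp only [dcell, cell, Set.mem_ofPred_eq, Set.mem_inter_iff]
  tauto

lemma dcell_pos {d g t : Fin 2} (h : 0 < M.rate d g t) : M.P (M.dcell d g t) ≠ 0 := by
  intro h0
  have := M.real_dcell d g t
  rw [measureReal_def, h0] at this
  exact (mul_pos (M.cell_real_pos g t) h).ne this

lemma isProbabilityMeasure_cond_dcell {d g t : Fin 2} (h : 0 < M.rate d g t) :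
    IsProbabilityMeasure (cond M.P (M.dcell d g t)) :=
  cond_isProbabilityMeasure (dcell_pos h)

lemma isProbabilityMeasure_cellLaw {d g t : Fin 2} (h : 0 < M.rate d g t) :
    IsProbabilityMeasure (M.cellLaw d g t) :=
  have := isProbabilityMeasure_cond_dcell h
  Measure.isProbabilityMeasure_map M.measurable_Yobs.aemeasurable

variable (M) in
lemma F_eq (d g t : Fin 2) (y : ℝ) : M.F d g t y = (M.cellLaw d g t).real (Set.Iic y) := by
  rw [cellLaw, map_measureReal_apply M.measurable_Yobs measurableSet_Iic]
  rfl

variable (M) in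
/-- Sub-distribution of `Y(d)` over `D(t) = d` in the cell `(g, t)`. -/
lemma rate_mul_cellLaw (d g t : Fin 2) {A : Set ℝ} (hA : MeasurableSet A) :
    M.rate d g t * (M.cellLaw d g t).real A
      = (cond M.P (M.cell g t)).real {ω | M.Dpot t ω = d ∧ M.Y d ω ∈ A} := by
  have h1 := real_mul_cond_real M.P (M.measurableSet_dcell d g t) (M.Yobs ⁻¹' A)
  rw [M.real_dcell] at h1
  rw [cellLaw, map_measureReal_apply M.measurable_Yobs hA,
    cond_real_apply _ (M.measurableSet_cell g t), eq_inv_mul_iff_mul_eq₀ (M.cell_real_pos g t).ne',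
    ← mul_assoc, h1]
  congr 1
  ext ω
  simp only [dcell, cell, Set.mem_inter_iff, Set.mem_ofPred_eq, Set.mem_preimage, Yobs]
  constructor
  · rintro ⟨⟨h1, h2, h3⟩, h4⟩
    refine ⟨⟨h2, h3⟩, ?_, h1 ▸ h4⟩
    rw [D, h3] at h1; exact h1
  · rintro ⟨⟨h2, h3⟩, h1, h4⟩
    have h5 : M.D ω = d := by rw [D, h3]; exact h1
    exact ⟨⟨h5, h2, h3⟩, h5 ▸ h4⟩

variable (M) in
/-- Sub-distribution of `Y(d)` over `D(0) = d` in the cell `(g, 1)`. -/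
def stay (d g : Fin 2) (A : Set ℝ) : ℝ :=
  (cond M.P (M.cell g 1)).real {ω | M.Dpot 0 ω = d ∧ M.Y d ω ∈ A}

variable (M) in
/-- Sub-distribution of `Y(d)` over `D(0) ≠ D(1)` in the cell `(g, 1)`. -/
def swit (d g : Fin 2) (A : Set ℝ) : ℝ :=
  (cond M.P (M.cell g 1)).real {ω | M.Dpot 0 ω ≠ M.Dpot 1 ω ∧ M.Y d ω ∈ A}

lemma measurableSet_Y (d : Fin 2) {A : Set ℝ} (hA : MeasurableSet A) :
    MeasurableSet {ω | M.Y d ω ∈ A} := M.measurable_Y d hA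

lemma measurableSet_Dpot (t d : Fin 2) : MeasurableSet {ω | M.Dpot t ω = d} :=
  M.measurable_Dpot t (measurableSet_singleton d)

lemma measurableSet_switch : MeasurableSet {ω | M.Dpot 0 ω ≠ M.Dpot 1 ω} :=
  (measurableSet_eq_fun (M.measurable_Dpot 0) (M.measurable_Dpot 1)).compl

/-- Decomposition of `D(t) = d` according to whether the unit switches. -/
lemma real_Dpot_eq_add (d g t : Fin 2) {A : Set ℝ} (hA : MeasurableSet A) :
    (cond M.P (M.cell g 1)).real {ω | M.Dpot t ω = d ∧ M.Y d ω ∈ A}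
      = (cond M.P (M.cell g 1)).real {ω | M.Dpot 0 ω = d ∧ M.Dpot 1 ω = d ∧ M.Y d ω ∈ A}
      + (cond M.P (M.cell g 1)).real
          {ω | M.Dpot t ω = d ∧ M.Dpot 0 ω ≠ M.Dpot 1 ω ∧ M.Y d ω ∈ A} := by
  rw [← measureReal_union]
  · congr 1
    ext ω
    simp only [Set.mem_ofPred_eq, Set.mem_union]
    rcases Fin.exists_fin_two.1 ⟨t, rfl⟩ with h | h <;> subst h <;>
    by_cases h0 : M.Dpot 0 ω = d <;> by_cases h1 : M.Dpot 1 ω = d <;> simp [h0, h1]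
    · exact fun _ => Ne.symm h1
  · rw [Set.disjoint_left]
    rintro ω ⟨h1, h2, -⟩ ⟨-, h3, -⟩
    exact h3 (h1.trans h2.symm)
  · exact (measurableSet_Dpot t d).inter (measurableSet_switch.inter (measurableSet_Y d hA))

/-- Switchers and stayers, when the set of units with treatment status `d` expands. -/
lemma swit_of_subset {d g : Fin 2} (hs : M.thr g 0 d ⊆ M.thr g 1 d) {A : Set ℝ}
    (hA : MeasurableSet A) :
    M.rate d g 1 * (M.cellLaw d g 1).real A = M.stay d g A + M.swit d g A := by
  rw [rate_mul_cellLaw M d g 1 hA, stay, real_Dpot_eq_add d g 1 hA, real_Dpot_eq_add d g 0 hA, swit,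
    add_assoc]
  congr 1
  have key : ∀ ω, M.G ω = g → M.Dpot 0 ω = d → M.Dpot 1 ω = d := by
    intro ω hg
    rw [Dpot_eq_iff, Dpot_eq_iff, hg]; exact fun h => hs h
  have h0 : (cond M.P (M.cell g 1)).real
      {ω | M.Dpot 0 ω = d ∧ M.Dpot 0 ω ≠ M.Dpot 1 ω ∧ M.Y d ω ∈ A} = 0 := by
    rw [cond_cell_congr (s' := ∅), measureReal_empty]
    intro ω hg _
    simp only [Set.mem_ofPred_eq, Set.mem_empty_iff_false, iff_false]
    rintro ⟨h1, h2, -⟩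
    exact h2 (h1.trans (key ω hg h1).symm)
  rw [h0, zero_add]
  refine cond_cell_congr fun ω hg _ => ?_
  have := key ω hg
  simp only [Set.mem_ofPred_eq]
  constructor
  · exact fun h => h.2
  · rintro ⟨h1, h2⟩
    exact ⟨by omega, h1, h2⟩

/-- Switchers and stayers, when the set of units with treatment status `d` shrinks. -/
lemma swit_of_superset {d g : Fin 2} (hs : M.thr g 1 d ⊆ M.thr g 0 d) {A : Set ℝ}
    (hA : MeasurableSet A) :
    M.stay d g A = M.rate d g 1 * (M.cellLaw d g 1).real A + M.swit d g A := by
  rw [rate_mul_cellLaw M d g 1 hA, stay, real_Dpot_eq_add d g 1 hA, real_Dpot_eq_add d g 0 hA, swit,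
    add_assoc]
  congr 1
  have key : ∀ ω, M.G ω = g → M.Dpot 1 ω = d → M.Dpot 0 ω = d := by
    intro ω hg
    rw [Dpot_eq_iff, Dpot_eq_iff, hg]; exact fun h => hs h
  have h0 : (cond M.P (M.cell g 1)).real
      {ω | M.Dpot 1 ω = d ∧ M.Dpot 0 ω ≠ M.Dpot 1 ω ∧ M.Y d ω ∈ A} = 0 := by
    rw [cond_cell_congr (s' := ∅), measureReal_empty]
    intro ω hg _
    simp only [Set.mem_ofPred_eq, Set.mem_empty_iff_false, iff_false]
    rintro ⟨h1, h2, -⟩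
    exact h2 ((key ω hg h1).trans h1.symm)
  rw [h0, zero_add]
  refine cond_cell_congr fun ω hg _ => ?_
  have := key ω hg
  simp only [Set.mem_ofPred_eq]
  constructor
  · exact fun h => h.2
  · rintro ⟨h1, h2⟩
    exact ⟨by omega, h1, h2⟩

lemma swit_nonneg (d g : Fin 2) (A : Set ℝ) : 0 ≤ M.swit d g A := measureReal_nonneg

lemma swit_mono {d g : Fin 2} {A B : Set ℝ} (h : A ⊆ B) : M.swit d g A ≤ M.swit d g B :=
  measureReal_mono fun _ hω => ⟨hω.1, h hω.2⟩

lemma cellLaw_univ {d g t : Fin 2} (h : 0 < M.rate d g t) :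
    (M.cellLaw d g t).real Set.univ = 1 :=
  have := isProbabilityMeasure_cellLaw h
  probReal_univ

lemma rate_mul_cellLaw_univ (d g t : Fin 2) :
    M.rate d g t * (M.cellLaw d g t).real Set.univ = M.rate d g t := by
  rcases (M.rate_nonneg d g t).eq_or_lt with h | h
  · rw [← h, zero_mul]
  · rw [cellLaw_univ h, mul_one]

lemma Participation.stay_univ (h : M.Participation) (d g : Fin 2) :
    M.stay d g Set.univ = M.rate d g 0 := by
  rw [stay, h.rate_eq]
  simp only [Set.mem_univ, and_true]
  exact h.real_Dpot g 1 0 d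

/-- The law of `Y(d)` over the switchers, in terms of that of the stayers. -/
lemma Participation.rate_mul_sub_stay (h : M.Participation) {d g : Fin 2}
    (hne : M.rate d g 1 ≠ M.rate d g 0) {A : Set ℝ} (hA : MeasurableSet A) :
    0 < M.swit d g Set.univ ∧ M.rate d g 1 * (M.cellLaw d g 1).real A - M.stay d g A
      = (M.rate d g 1 - M.rate d g 0) * (M.swit d g A / M.swit d g Set.univ) := by
  rcases M.thr_total g d with hs | hs
  · have h1 := swit_of_subset hs hA
    have h2 := swit_of_subset hs MeasurableSet.univ
    rw [rate_mul_cellLaw_univ, h.stay_univ] at h2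
    have h3 : M.swit d g Set.univ = M.rate d g 1 - M.rate d g 0 := by linarith
    have h4 : M.swit d g Set.univ ≠ 0 := by rw [h3]; exact sub_ne_zero.2 hne
    refine ⟨lt_of_le_of_ne (swit_nonneg _ _ _) h4.symm, ?_⟩
    rw [← h3, mul_div_cancel₀ _ h4]
    linarith
  · have h1 := swit_of_superset hs hA
    have h2 := swit_of_superset hs MeasurableSet.univ
    rw [rate_mul_cellLaw_univ, h.stay_univ] at h2
    have h3 : M.rate d g 1 - M.rate d g 0 = - M.swit d g Set.univ := by linarith
    have h4 : M.swit d g Set.univ ≠ 0 := by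
      intro h0; rw [h0, neg_zero] at h3; exact sub_ne_zero.2 hne h3
    refine ⟨lt_of_le_of_ne (swit_nonneg _ _ _) h4.symm, ?_⟩
    rw [h3, neg_mul, mul_div_cancel₀ _ h4]
    linarith

variable (M) in
lemma measurableSet_switchers : MeasurableSet M.switchers :=
  (measurableSet_lt (M.measurable_Dpot 0) (M.measurable_Dpot 1)).inter (M.measurableSet_cell 1 1)

lemma Participation.thr_subset (h : M.Participation) {d g : Fin 2}
    (hr : M.rate d g 0 < M.rate d g 1) : M.thr g 0 d ⊆ M.thr g 1 d := by
  rcases M.thr_total g d with hs | hs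
  · exact hs
  · rw [h.rate_eq, h.rate_eq] at hr
    exact absurd (measureReal_mono hs) (not_le.2 hr)

lemma Participation.switchers_real (h : M.Participation) (hFS : M.FirstStage) (d : Fin 2)
    (A : Set ℝ) :
    M.P.real (M.switchers ∩ {ω | M.Y d ω ∈ A}) = M.P.real (M.cell 1 1) * M.swit d 1 A := by
  have hs := h.thr_subset hFS.1
  rw [swit, real_mul_cond_real _ (M.measurableSet_cell 1 1)]
  congr 1
  ext ω
  have key : M.G ω = 1 → M.Dpot 0 ω = 1 → M.Dpot 1 ω = 1 := by
    intro hg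
    rw [Dpot_eq_iff, Dpot_eq_iff, hg]; exact fun h => hs h
  simp only [switchers, cell, Set.mem_inter_iff, Set.mem_ofPred_eq]
  constructor
  · rintro ⟨⟨h1, h2⟩, h3⟩
    exact ⟨h2, h1.ne, h3⟩
  · rintro ⟨h1, h2, h3⟩
    have := key h1.1
    exact ⟨⟨by omega, h1⟩, h3⟩

lemma Participation.real_switchers (h : M.Participation) (hFS : M.FirstStage) (d : Fin 2) :
    M.P.real M.switchers = M.P.real (M.cell 1 1) * M.swit d 1 Set.univ := by
  rw [← h.switchers_real hFS d Set.univ]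
  congr 1
  ext ω
  simp

variable (M) in
/-- Law of `Y(d)` among switchers. -/
def switLaw (d : Fin 2) : Measure ℝ := (cond M.P M.switchers).map (M.Y d)

lemma FirstStage.rate_ne (hFS : M.FirstStage) (d : Fin 2) : M.rate d 1 1 ≠ M.rate d 1 0 := by
  have h1 := M.rate_zero 1 1
  have h2 := M.rate_zero 1 0
  have h3 := hFS.1
  fin_cases d
  · simp only [Fin.zero_eta]; intro h; linarith
  · exact hFS.1.ne'

lemma Participation.switchers_pos (h : M.Participation) (hFS : M.FirstStage) :
    0 < M.P.real M.switchers := by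
  rw [h.real_switchers hFS 1]
  exact mul_pos (M.cell_real_pos 1 1) (h.rate_mul_sub_stay (hFS.rate_ne 1) MeasurableSet.univ).1

lemma Participation.isProbabilityMeasure_cond_switchers (h : M.Participation)
    (hFS : M.FirstStage) : IsProbabilityMeasure (cond M.P M.switchers) :=
  cond_isProbabilityMeasure fun h0 => by
    have := h.switchers_pos hFS
    rw [measureReal_def, h0] at this
    exact lt_irrefl _ this

lemma Participation.isProbabilityMeasure_switLaw (h : M.Participation)
    (hFS : M.FirstStage) (d : Fin 2) : IsProbabilityMeasure (M.switLaw d) :=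
  have := h.isProbabilityMeasure_cond_switchers hFS
  Measure.isProbabilityMeasure_map (M.measurable_Y d).aemeasurable

lemma Participation.switLaw_real (h : M.Participation) (hFS : M.FirstStage) (d : Fin 2)
    {A : Set ℝ} (hA : MeasurableSet A) :
    (M.switLaw d).real A = M.swit d 1 A / M.swit d 1 Set.univ := by
  have h1 := h.real_switchers hFS d
  rw [switLaw, map_measureReal_apply (M.measurable_Y d) hA,
    cond_real_apply _ M.measurableSet_switchers]
  change _ * M.P.real (M.switchers ∩ {ω | M.Y d ω ∈ A}) = _
  rw [h.switchers_real hFS d A, h1]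
  have := (M.cell_real_pos 1 1).ne'
  field_simp

variable (M) in
lemma switcherCdf_eq (d : Fin 2) (y : ℝ) :
    M.switcherCdf d y = (M.switLaw d).real (Set.Iic y) := by
  rw [switLaw, map_measureReal_apply (M.measurable_Y d) measurableSet_Iic]
  rfl

/-- The law of `Y_{11}(d)` among switchers. -/
lemma Participation.switLaw_eq (h : M.Participation) (hFS : M.FirstStage) (d : Fin 2)
    {A : Set ℝ} (hA : MeasurableSet A) :
    M.rate d 1 1 * (M.cellLaw d 1 1).real A - M.stay d 1 A
      = (M.rate d 1 1 - M.rate d 1 0) * (M.switLaw d).real A := by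
  rw [h.switLaw_real hFS d hA]
  exact (h.rate_mul_sub_stay (hFS.rate_ne d) hA).2

end FuzzyDiD

/-! ### Trimming and the Wald-TC bounds -/

lemma M01_mono : Monotone M01 := fun _ _ h => min_le_min le_rfl (max_le_max le_rfl h)

lemma M01_nonneg (x : ℝ) : 0 ≤ M01 x := le_min zero_le_one (le_max_left _ _)

lemma M01_le_one (x : ℝ) : M01 x ≤ 1 := min_le_left _ _

lemma M01_of_mem {x : ℝ} (h0 : 0 ≤ x) (h1 : x ≤ 1) : M01 x = x := by
  rw [M01, max_eq_right h0, min_eq_right h1]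

lemma M01_of_nonpos {x : ℝ} (h : x ≤ 0) : M01 x = 0 := by
  rw [M01, max_eq_left h, min_eq_right zero_le_one]

lemma M01_of_one_le {x : ℝ} (h : 1 ≤ x) : M01 x = 1 := by
  rw [M01, min_eq_left (h.trans (le_max_right _ _))]

lemma le_M01 {x z : ℝ} (hx : x ≤ 1) (h : x ≤ z) : x ≤ M01 z :=
  le_min hx (h.trans (le_max_right _ _))

lemma M01_le {x z : ℝ} (hx : 0 ≤ x) (h : z ≤ x) : M01 z ≤ x :=
  (min_le_right _ _).trans (max_le hx h)

lemma SubCdf.of_ends {F : ℝ → ℝ} {a b : ℝ} (hF : Monotone F) (h0 : ∀ y < a, F y = 0)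
    (h1 : ∀ y, b ≤ y → F y = 1) : SubCdf F where
  mono := hF
  nonneg y := by
    rw [← h0 (min y (a - 1)) ((min_le_right _ _).trans_lt (by linarith))]
    exact hF (min_le_left _ _)
  le_one y := by
    rw [← h1 (max y b) (le_max_right _ _)]
    exact hF (le_max_left _ _)

lemma SubCdf.iSup_eq_one {F : ℝ → ℝ} (h : SubCdf F) {b : ℝ} (hb : F b = 1) : ⨆ y, F y = 1 :=
  le_antisymm h.iSup_le_one (hb ▸ le_ciSup h.bddAbove b)

lemma SubCdf.iInf_eq_zero {F : ℝ → ℝ} (h : SubCdf F) {a : ℝ} (ha : F a = 0) : ⨅ y, F y = 0 :=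
  le_antisymm (ha ▸ ciInf_le h.bddBelow a) h.iInf_nonneg

lemma SubCdf.extMean_of_ends {F : ℝ → ℝ} (h : SubCdf F) {a b : ℝ} (h0 : ∀ y < a, F y = 0)
    (h1 : ∀ y, b ≤ y → F y = 1) :
    Integrable (fun y : ℝ => y) (stieltjesOf F) ∧ extMean F = ((∫ y, y ∂(stieltjesOf F) : ℝ) : EReal) := by
  have hS := h.iSup_eq_one (h1 b le_rfl)
  have hi := h.iInf_eq_zero (h0 (a - 1) (by linarith))
  have := h.isFiniteMeasure
  constructor
  · have e1 : stieltjesOf F (Set.Ioi b) = 0 := by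
      rw [h.stieltjesOf_Ioi, hS, ENNReal.ofReal_eq_zero]
      linarith [h.mono.le_rightLim (le_refl b), h1 b le_rfl]
    have e2 : stieltjesOf F (Set.Iic (a - 1)) = 0 := by
      rw [h.stieltjesOf_Iic, hi, ENNReal.ofReal_eq_zero]
      linarith [h.mono.rightLim_le (show a - 1 < a - 1 / 2 by linarith),
        h0 (a - 1 / 2) (by linarith)]
    refine Integrable.of_bound (C := max |a - 1| |b|) (by fun_prop) ?_
    filter_upwards [measure_eq_zero_iff_ae_notMem.1 e1, measure_eq_zero_iff_ae_notMem.1 e2] with y hy1 hy2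
    simp only [Set.mem_Ioi, not_lt, Set.mem_Iic, not_le] at hy1 hy2
    rw [Real.norm_eq_abs]
    exact abs_le_max_abs_abs hy2.le hy1
  · rw [extMean, hS, hi]
    simp

lemma real_eq_one_of_ae {Ω : Type*} [MeasurableSpace Ω] {P : Measure Ω} [IsProbabilityMeasure P]
    {s : Set Ω} (h : ∀ᵐ ω ∂P, ω ∈ s) : P.real s = 1 := by
  rw [measureReal_congr (show s =ᵐ[P] Set.univ from eventuallyEq_univ.2 h), probReal_univ]

lemma setIntegral_cond {Ω : Type*} [MeasurableSpace Ω] (P : Measure Ω) [IsFiniteMeasure P]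
    {c s : Set Ω} (hc : MeasurableSet c) (hs : MeasurableSet s) (R : Ω → ℝ) :
    ∫ ω in s, R ω ∂(cond P c) = (cond P c).real s * ∫ ω, R ω ∂(cond P (c ∩ s)) := by
  rw [← cond_cond_eq_cond_inter hc hs P]
  change _ = _ * ∫ ω, R ω ∂(((cond P c) s)⁻¹ • (cond P c).restrict s)
  rw [integral_smul_measure]
  by_cases h : (cond P c) s = 0
  · rw [measureReal_def, h, Measure.restrict_eq_zero.2 h]
    simp
  · rw [measureReal_def, ENNReal.toReal_inv, smul_eq_mul, ← mul_assoc, mul_inv_cancel₀, one_mul]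
    exact (ENNReal.toReal_pos h (measure_ne_top _ _)).ne'

namespace FuzzyDiD

variable {M : FuzzyDiD.{u}}

instance : IsProbabilityMeasure (M.P.map M.Yobs) :=
  Measure.isProbabilityMeasure_map M.measurable_Yobs.aemeasurable

variable (M) in
lemma suppY_nonempty : M.suppY.Nonempty :=
  Measure.nonempty_support (IsProbabilityMeasure.ne_zero _)

lemma exists_bounds (hb : Bornology.IsBounded M.suppY) :
    ∃ a b : ℝ, a ≤ b ∧ M.yLow = a ∧ M.yHigh = b := by
  have h1 : IsCompact M.suppY := Metric.isCompact_of_isClosed_isBounded Measure.isClosed_support hb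
  have hL := h1.isLeast_sInf M.suppY_nonempty
  have hG := h1.isGreatest_sSup M.suppY_nonempty
  refine ⟨sInf M.suppY, sSup M.suppY, hL.2 hG.1, ?_, ?_⟩
  · exact (show IsLeast (Real.toEReal '' M.suppY) (sInf M.suppY : ℝ) from ⟨⟨_, hL.1, rfl⟩, by
      rintro _ ⟨y, hy, rfl⟩; exact_mod_cast hL.2 hy⟩).isGLB.sInf_eq
  · exact (show IsGreatest (Real.toEReal '' M.suppY) (sSup M.suppY : ℝ) from ⟨⟨_, hG.1, rfl⟩, by
      rintro _ ⟨y, hy, rfl⟩; exact_mod_cast hG.2 hy⟩).isLUB.sSup_eq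

lemma OutcomesInBounds.Yobs (h : M.OutcomesInBounds) :
    ∀ᵐ ω ∂M.P, M.yLow ≤ (M.Yobs ω : EReal) ∧ (M.Yobs ω : EReal) ≤ M.yHigh := by
  filter_upwards [h 0, h 1] with ω h0 h1
  rw [FuzzyDiD.Yobs]
  rcases Fin.exists_fin_two.1 ⟨M.D ω, rfl⟩ with h | h <;> rw [h] <;> assumption

lemma ae_cond_of_ae {p : M.Ω → Prop} (h : ∀ᵐ ω ∂M.P, p ω) (s : Set M.Ω) :
    ∀ᵐ ω ∂(cond M.P s), p ω := cond_absolutelyContinuous.ae_le h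

lemma condE_Dpot_eq (d g : Fin 2) :
    M.condE {ω | M.G ω = g ∧ M.T ω = 0 ∧ M.Dpot 0 ω = d} (M.Y d)
      = M.condE (M.dcell d g 0) M.Yobs := by
  have h1 : {ω | M.G ω = g ∧ M.T ω = 0 ∧ M.Dpot 0 ω = d} = M.dcell d g 0 := by
    ext ω
    simp only [dcell, Set.mem_ofPred_eq, D]
    constructor
    · rintro ⟨h1, h2, h3⟩; exact ⟨h2 ▸ h3, h1, h2⟩
    · rintro ⟨h1, h2, h3⟩; exact ⟨h2, h3, h3 ▸ h1⟩
  rw [h1, condE, condE]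
  refine integral_congr_ae ?_
  filter_upwards [ae_cond_of_forall_mem (p := fun ω => M.Y d ω = M.Yobs ω)
    (M.measurableSet_dcell d g 0) fun ω hω => by rw [FuzzyDiD.Yobs, hω.1]] with ω h
  exact h

/-- Under conditional common trends, the time trend of `Y(d)` is bounded using the control group. -/
lemma trend_bounds (hPart : M.Participation) {d : Fin 2} (hb : Bornology.IsBounded M.suppY)
    (hB : M.OutcomesInBounds) (h0 : 0 < M.rate d 0 0) (h1 : 0 < M.rate d 0 1)
    (hne : M.rate d 0 1 ≠ M.rate d 0 0) :
    M.deltaLow d ≤ M.trend d 0 ∧ M.trend d 0 ≤ M.deltaHigh d := by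
  obtain ⟨a, b, hab, ha, hb'⟩ := exists_bounds hb
  set A : Set M.Ω := {ω | M.G ω = 0 ∧ M.T ω = 1 ∧ M.Dpot 0 ω = d} with hAdef
  have hAeq : A = M.cell 0 1 ∩ {ω | M.Dpot 0 ω = d} := by
    ext ω; simp only [hAdef, cell, Set.mem_inter_iff, Set.mem_ofPred_eq]; tauto
  have hAm : MeasurableSet A := hAeq ▸ (M.measurableSet_cell 0 1).inter (measurableSet_Dpot 0 d)
  have hAreal : ∀ B : Set ℝ, M.P.real (A ∩ M.Y d ⁻¹' B) = M.P.real (M.cell 0 1) * M.stay d 0 B := by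
    intro B
    rw [stay, real_mul_cond_real _ (M.measurableSet_cell 0 1)]
    congr 1
    ext ω
    simp only [hAdef, cell, Set.mem_inter_iff, Set.mem_ofPred_eq, Set.mem_preimage]
    tauto
  have hApos : M.P.real A = M.P.real (M.cell 0 1) * M.rate d 0 0 := by
    rw [← hPart.stay_univ, ← hAreal]; simp
  have hA0 : M.P A ≠ 0 := by
    intro h
    have : M.P.real A = 0 := by rw [measureReal_def, h]; rfl
    exact (mul_pos (M.cell_real_pos 0 1) h0).ne' (hApos ▸ this)
  have hprob : IsProbabilityMeasure (cond M.P A) := cond_isProbabilityMeasure hA0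
  set ζ := (cond M.P A).map (M.Y d) with hζ
  have hζp : IsProbabilityMeasure ζ :=
    Measure.isProbabilityMeasure_map (M.measurable_Y d).aemeasurable
  -- The cdf of `Y(d)` among the switchers of the control group, whichever way they switch. Only `0
  -- ≤ K ≤ 1` is used, and this is where the bounds come from.
  set K : ℝ → ℝ := fun y => M.swit d 0 (Set.Iic y) / M.swit d 0 Set.univ with hK
  have hKpos := (hPart.rate_mul_sub_stay hne MeasurableSet.univ).1
  have hζreal : ∀ y, ζ.real (Set.Iic y)
      = M.lam 0 d * M.F d 0 1 y + (1 - M.lam 0 d) * K y := by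
    intro y
    have e := (hPart.rate_mul_sub_stay hne (measurableSet_Iic (a := y))).2
    rw [hζ, map_measureReal_apply (M.measurable_Y d) measurableSet_Iic, cond_real_apply _ hAm,
      hAreal, hApos, F_eq, lam]
    have := (M.cell_real_pos 0 1).ne'
    have h0' := h0.ne'
    have : M.stay d 0 (Set.Iic y) = M.rate d 0 1 * (M.cellLaw d 0 1).real (Set.Iic y)
      - (M.rate d 0 1 - M.rate d 0 0) * K y := by rw [hK]; linarith
    rw [this]
    field_simp
    ring
  have hK0 : ∀ y, 0 ≤ K y := fun y => div_nonneg (swit_nonneg _ _ _) hKpos.le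
  have hK1 : ∀ y, K y ≤ 1 := fun y => (div_le_one hKpos).2 (swit_mono (Set.subset_univ _))
  -- bounds on the outcomes
  have hYd : ∀ᵐ ω ∂M.P, a ≤ M.Y d ω ∧ M.Y d ω ≤ b := by
    filter_upwards [hB d] with ω hω
    rw [ha, hb', EReal.coe_le_coe_iff, EReal.coe_le_coe_iff] at hω
    exact hω
  have hYo : ∀ᵐ ω ∂M.P, a ≤ M.Yobs ω ∧ M.Yobs ω ≤ b := by
    filter_upwards [hB.Yobs] with ω hω
    rw [ha, hb', EReal.coe_le_coe_iff, EReal.coe_le_coe_iff] at hω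
    exact hω
  have := isProbabilityMeasure_cond_dcell h1
  have hF0 : ∀ y < a, M.F d 0 1 y = 0 := by
    intro y hy
    rw [F, condCdf, measureReal_def, measure_eq_zero_iff_ae_notMem.2, ENNReal.toReal_zero]
    filter_upwards [ae_cond_of_ae hYo (M.dcell d 0 1)] with ω hω h
    exact absurd h (not_le.2 (hy.trans_le hω.1))
  have hF1 : ∀ y, b ≤ y → M.F d 0 1 y = 1 := by
    intro y hy
    refine real_eq_one_of_ae ?_
    filter_upwards [ae_cond_of_ae hYo (M.dcell d 0 1)] with ω hω
    exact hω.2.trans hy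
  have hFb : ∀ y, 0 ≤ M.F d 0 1 y ∧ M.F d 0 1 y ≤ 1 := fun y => ⟨measureReal_nonneg, measureReal_le_one⟩
  have hFm : Monotone (M.F d 0 1) := fun x y hxy => measureReal_mono fun ω (h : _ ≤ x) => h.trans hxy
  have hζ0 : ∀ y < a, ζ.real (Set.Iic y) = 0 := by
    intro y hy
    rw [hζ, map_measureReal_apply (M.measurable_Y d) measurableSet_Iic,
      measureReal_def, measure_eq_zero_iff_ae_notMem.2, ENNReal.toReal_zero]
    filter_upwards [ae_cond_of_ae hYd A] with ω hω h
    exact absurd h (not_le.2 (hy.trans_le hω.1))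
  have hlam : 0 < M.lam 0 d := div_pos h1 h0
  have hζI : Integrable (fun y : ℝ => y) ζ := by
    rw [hζ, integrable_map_measure (by fun_prop) (M.measurable_Y d).aemeasurable]
    refine Integrable.of_bound (C := max |a| |b|) (by have := M.measurable_Y d; fun_prop) ?_
    filter_upwards [ae_cond_of_ae hYd A] with ω hω
    exact abs_le_max_abs_abs hω.1 hω.2
  have hζ1 : ∀ y, b ≤ y → ζ.real (Set.Iic y) = 1 := by
    intro y hy
    rw [hζ, map_measureReal_apply (M.measurable_Y d) measurableSet_Iic]
    refine real_eq_one_of_ae ?_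
    filter_upwards [ae_cond_of_ae hYd A] with ω hω
    exact hω.2.trans hy
  have hζE : ∫ y, y ∂ζ = M.condE A (M.Y d) := by
    rw [hζ, integral_map (M.measurable_Y d).aemeasurable (by fun_prop)]
    rfl
  have htr : M.trend d 0 = M.condE A (M.Y d) - M.condE (M.dcell d 0 0) M.Yobs := by
    rw [trend, condE_Dpot_eq]
  have hlowM : Monotone (M.trimLow d) := by
    intro x y hxy
    refine sub_le_sub (M01_mono ?_) (mul_le_mul_of_nonneg_left ?_ (M01_nonneg _))
    · nlinarith [hFm hxy]
    · split_ifs with h1 h2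
      · exact le_rfl
      · exact absurd ((EReal.coe_le_coe_iff.2 hxy).trans_lt h1) h2
      · exact zero_le_one
      · exact le_rfl
  have hhighM : Monotone (M.trimHigh d) := by
    intro x y hxy
    refine add_le_add (M01_mono (mul_le_mul_of_nonneg_left (hFm hxy) hlam.le))
      (mul_le_mul_of_nonneg_left ?_ (sub_nonneg.2 (M01_le_one _)))
    split_ifs with h1 h2
    · exact le_rfl
    · exact absurd (h1.trans (EReal.coe_le_coe_iff.2 hxy)) h2
    · exact zero_le_one
    · exact le_rfl
  have hlow0 : ∀ y < a, M.trimLow d y = 0 := by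
    intro y hy
    rw [trimLow, hF0 y hy, hb', if_pos (by exact_mod_cast hy.trans_le hab)]
    simp
  have hlow1 : ∀ y, b ≤ y → M.trimLow d y = 1 := by
    intro y hy
    rw [trimLow, hF1 y hy, hb', if_neg (by exact_mod_cast not_lt.2 hy)]
    simp [M01]
  have hhigh0 : ∀ y < a, M.trimHigh d y = 0 := by
    intro y hy
    rw [trimHigh, hF0 y hy, ha, if_neg (by exact_mod_cast not_le.2 hy)]
    simp [M01]
  have hhigh1 : ∀ y, b ≤ y → M.trimHigh d y = 1 := by
    intro y hy
    rw [trimHigh, hF1 y hy, ha, if_pos (by exact_mod_cast hab.trans hy)]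
    simp
  have hle1 : ∀ y, M.trimLow d y ≤ ζ.real (Set.Iic y) := by
    intro y
    rcases le_or_gt b y with hy | hy
    · rw [hlow1 y hy, hζ1 y hy]
    · rw [trimLow, hb', if_pos (by exact_mod_cast hy), mul_one]
      have k0 := hK0 y
      have k1 := hK1 y
      have f1 := hFb y
      have hz := hζreal y
      -- If `λ ≤ 1` the truncations are inactive and the bound is `λ F`, the case `K = 0`. If `λ ≥
      -- 1` it is the positive part of `1 - λ (1 - F)`, the case `K = 1`.
      rcases le_total (M.lam 0 d) 1 with hl | hl
      · rw [M01_of_mem, M01_of_mem] <;> nlinarith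
      · rw [M01_of_nonpos (x := 1 - M.lam 0 d) (by linarith), sub_zero]
        exact M01_le measureReal_nonneg (by nlinarith)
  have hle2 : ∀ y, ζ.real (Set.Iic y) ≤ M.trimHigh d y := by
    intro y
    rcases lt_or_ge y a with hy | hy
    · rw [hhigh0 y hy, hζ0 y hy]
    · rw [trimHigh, ha, if_pos (by exact_mod_cast hy), mul_one]
      have k0 := hK0 y
      have k1 := hK1 y
      have f1 := hFb y
      have hz := hζreal y
      -- The roles are exchanged: `K = 1` gives `λ F + 1 - λ` if `λ ≤ 1`, and `K = 0` gives `min 1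
      -- (λ F)` if `λ ≥ 1`.
      rcases le_total (M.lam 0 d) 1 with hl | hl
      · rw [M01_of_mem, M01_of_mem] <;> nlinarith
      · rw [M01_of_one_le hl, sub_self, add_zero]
        exact le_M01 measureReal_le_one (by nlinarith)
  have hsl := SubCdf.of_ends hlowM hlow0 hlow1
  have hsh := SubCdf.of_ends hhighM hhigh0 hhigh1
  have r1 := integral_le_extMean ζ hsl hζI (hsl.extMean_of_ends hlow0 hlow1).1 hle1
  have r2 := extMean_le_integral ζ hsh hζI (hsh.extMean_of_ends hhigh0 hhigh1).1 hle2
  rw [(hsl.extMean_of_ends hlow0 hlow1).2, EReal.coe_le_coe_iff] at r1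
  rw [(hsh.extMean_of_ends hhigh0 hhigh1).2, EReal.coe_le_coe_iff] at r2
  rw [htr, deltaLow, deltaHigh, ← hζE]
  exact ⟨by linarith, by linarith⟩


lemma cell_inter_Dpot (g t d : Fin 2) :
    {ω | M.G ω = g ∧ M.T ω = t ∧ M.Dpot 0 ω = d} = M.cell g t ∩ {ω | M.Dpot 0 ω = d} := by
  ext ω; simp only [cell, Set.mem_inter_iff, Set.mem_ofPred_eq]; tauto

/-- Expectation of `Y(D(0))` in a cell. -/
lemma integral_Y_Dpot (hPart : M.Participation) (g t : Fin 2) (δ : Fin 2 → ℝ)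
    (hI : ∀ d, Integrable (M.Y d) M.P) :
    ∫ ω, (M.Y (M.Dpot 0 ω) ω + δ (M.Dpot 0 ω)) ∂(cond M.P (M.cell g t))
      = ∑ d, M.rate d g 0 *
        (M.condE {ω | M.G ω = g ∧ M.T ω = t ∧ M.Dpot 0 ω = d} (M.Y d) + δ d) := by
  have hI' : ∀ (d : Fin 2) (s : Set M.Ω), Integrable (M.Y d) (cond M.P s) := by
    intro d s
    by_cases hs : M.P s = 0
    · rw [cond_eq_zero_of_meas_eq_zero hs]; exact integrable_zero_measure
    · exact ((hI d).mono_measure Measure.restrict_le_self).smul_measure (ENNReal.inv_ne_top.2 hs)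
  have hpt : ∀ ω, M.Y (M.Dpot 0 ω) ω + δ (M.Dpot 0 ω)
      = ∑ d, Set.indicator {ω | M.Dpot 0 ω = d} (fun ω => M.Y d ω + δ d) ω := by
    intro ω
    rcases Fin.exists_fin_two.1 ⟨M.Dpot 0 ω, rfl⟩ with h | h <;> simp [Set.indicator, h]
  simp_rw [hpt]
  rw [integral_finsetSum]
  · refine Finset.sum_congr rfl fun d _ => ?_
    rw [integral_indicator (measurableSet_Dpot 0 d),
      setIntegral_cond _ (M.measurableSet_cell g t) (measurableSet_Dpot 0 d), hPart.real_Dpot,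
      ← hPart.rate_eq, ← cell_inter_Dpot]
    by_cases hr : M.rate d g 0 = 0
    · rw [hr, zero_mul, zero_mul]
    · have : IsProbabilityMeasure (cond M.P {ω | M.G ω = g ∧ M.T ω = t ∧ M.Dpot 0 ω = d}) := by
        refine cond_isProbabilityMeasure fun h0 => hr ?_
        rw [hPart.rate_eq, ← hPart.real_Dpot g t 0 d,
          cond_real_apply _ (M.measurableSet_cell g t), ← cell_inter_Dpot,
          measureReal_def (s := {ω | M.G ω = g ∧ M.T ω = t ∧ M.Dpot 0 ω = d}), h0]
        simp
      rw [integral_add (hI' d _) (integrable_const _), integral_const]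
      simp [condE]
  · intro d _
    exact ((hI' d _).add (integrable_const _)).indicator (measurableSet_Dpot 0 d)

/-- The Wald-TC bounds on the effect among switchers. -/
theorem tc_bounds (hPart : M.Participation) (hFS : M.FirstStage)
    (hRate : ∀ t, 0 < M.rate 1 0 t ∧ M.rate 1 0 t < 1)
    (hChange : M.rate 1 0 1 ≠ M.rate 1 0 0) (hT : M.ConditionalCommonTrends)
    (hb : Bornology.IsBounded M.suppY) (hB : M.OutcomesInBounds) :
    M.tcLow ≤ M.late ∧ M.late ≤ M.tcHigh := by
  obtain ⟨a, b, hab, ha, hb'⟩ := exists_bounds hb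
  have hI : ∀ d, Integrable (M.Y d) M.P := by
    intro d
    refine Integrable.of_bound (C := max |a| |b|) (by have := M.measurable_Y d; fun_prop) ?_
    filter_upwards [hB d] with ω hω
    rw [ha, hb', EReal.coe_le_coe_iff, EReal.coe_le_coe_iff] at hω
    exact abs_le_max_abs_abs hω.1 hω.2
  have hI' : ∀ (d : Fin 2) (s : Set M.Ω), Integrable (M.Y d) (cond M.P s) := by
    intro d s
    by_cases hs : M.P s = 0
    · rw [cond_eq_zero_of_meas_eq_zero hs]; exact integrable_zero_measure
    · exact ((hI d).mono_measure Measure.restrict_le_self).smul_measure (ENNReal.inv_ne_top.2 hs)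
  have hpos : ∀ d t, 0 < M.rate d 0 t := by
    intro d t
    have := hRate t
    have := M.rate_zero 0 t
    rcases Fin.exists_fin_two.1 ⟨d, rfl⟩ with h | h <;> subst h <;> linarith
  have hne : ∀ d, M.rate d 0 1 ≠ M.rate d 0 0 := by
    intro d
    have h1 := M.rate_zero 0 1
    have h2 := M.rate_zero 0 0
    rcases Fin.exists_fin_two.1 ⟨d, rfl⟩ with h | h <;> subst h
    · intro h; exact hChange (by linarith)
    · exact hChange
  have hden : 0 < M.rate 1 1 1 - M.rate 1 1 0 := sub_pos.2 hFS.1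
  have hs := hPart.thr_subset hFS.1
  set Q := cond M.P (M.cell 1 1) with hQ
  -- the effect among switchers
  have hsw : M.cell 1 1 ∩ {ω | M.Dpot 0 ω ≠ M.Dpot 1 ω} = M.switchers := by
    ext ω
    have key : M.G ω = 1 → M.Dpot 0 ω = 1 → M.Dpot 1 ω = 1 := by
      intro hg
      rw [Dpot_eq_iff, Dpot_eq_iff, hg]; exact fun h => hs h
    simp only [switchers, cell, Set.mem_inter_iff, Set.mem_ofPred_eq]
    constructor
    · rintro ⟨h1, h2⟩
      have := key h1.1
      exact ⟨by omega, h1⟩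
    · rintro ⟨h1, h2⟩
      exact ⟨h2, h1.ne⟩
  have hQsw : Q.real {ω | M.Dpot 0 ω ≠ M.Dpot 1 ω} = M.rate 1 1 1 - M.rate 1 1 0 := by
    have h1 := swit_of_subset hs MeasurableSet.univ
    rw [rate_mul_cellLaw_univ, hPart.stay_univ] at h1
    rw [h1, add_sub_cancel_left, swit]
    simp
    rfl
  -- In this cell switchers can only move from `0` to `1`, so the observed outcome is `Y(D(0))` plus
  -- the treatment effect on the switchers. The `+ 0` matches `integral_Y_Dpot` with `δ = 0`.
  have hpt : ∀ ω, M.G ω = 1 ∧ M.T ω = 1 → M.Yobs ω = (M.Y (M.Dpot 0 ω) ω + 0)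
      + Set.indicator {ω | M.Dpot 0 ω ≠ M.Dpot 1 ω} (fun ω => M.Y 1 ω - M.Y 0 ω) ω := by
    rintro ω ⟨hg, ht⟩
    have key : M.Dpot 0 ω = 1 → M.Dpot 1 ω = 1 := by
      rw [Dpot_eq_iff, Dpot_eq_iff, hg]; exact fun h => hs h
    rw [FuzzyDiD.Yobs, D, ht]
    rcases Fin.exists_fin_two.1 ⟨M.Dpot 0 ω, rfl⟩ with h | h
    · rcases Fin.exists_fin_two.1 ⟨M.Dpot 1 ω, rfl⟩ with h' | h' <;> simp [Set.indicator, h, h']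
    · simp [Set.indicator, h, key h]
  have hE11 : M.condE (M.cell 1 1) M.Yobs
      = ∑ d, M.rate d 1 0 * M.condE {ω | M.G ω = 1 ∧ M.T ω = 1 ∧ M.Dpot 0 ω = d} (M.Y d)
        + (M.rate 1 1 1 - M.rate 1 1 0) * M.late := by
    have h1 := integral_Y_Dpot hPart 1 1 (fun _ => 0) hI
    simp only [add_zero] at h1
    have h3 : ∫ ω in {ω | M.Dpot 0 ω ≠ M.Dpot 1 ω}, (M.Y 1 ω - M.Y 0 ω) ∂Q
        = (M.rate 1 1 1 - M.rate 1 1 0) * M.late := by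
      rw [hQ, setIntegral_cond _ (M.measurableSet_cell 1 1) measurableSet_switch, hsw, ← hQ, hQsw]
      rfl
    rw [← h1, ← h3, ← integral_indicator measurableSet_switch, ← integral_add]
    · refine integral_congr_ae ?_
      filter_upwards [ae_cond_of_forall_mem (M.measurableSet_cell 1 1) hpt] with ω h
      simpa using h
    · have hpt2 : ∀ ω, M.Y (M.Dpot 0 ω) ω
          = ∑ d, Set.indicator {ω | M.Dpot 0 ω = d} (M.Y d) ω := by
        intro ω
        rcases Fin.exists_fin_two.1 ⟨M.Dpot 0 ω, rfl⟩ with h | h <;> simp [Set.indicator, h]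
      simp_rw [hpt2]
      exact integrable_finsetSum _ fun d _ => (hI' d _).indicator (measurableSet_Dpot 0 d)
    · exact ((hI' 1 _).sub (hI' 0 _)).indicator measurableSet_switch
  have hE10 : ∀ δ : Fin 2 → ℝ, M.condE (M.cell 1 0) (fun ω => M.Yobs ω + δ (M.D ω))
      = ∑ d, M.rate d 1 0 *
        (M.condE {ω | M.G ω = 1 ∧ M.T ω = 0 ∧ M.Dpot 0 ω = d} (M.Y d) + δ d) := by
    intro δ
    rw [← integral_Y_Dpot hPart 1 0 δ hI]
    refine integral_congr_ae ?_
    filter_upwards [ae_cond_of_forall_mem (M.measurableSet_cell 1 0)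
      (p := fun ω => M.Yobs ω + δ (M.D ω) = M.Y (M.Dpot 0 ω) ω + δ (M.Dpot 0 ω))
      fun ω hω => by rw [FuzzyDiD.Yobs, D, hω.2]] with ω h
    exact h
  -- The distribution of `D(0)` in the treatment group is the same in both periods, so the
  -- difference of the means of `Y(D(0))` is a weighted sum of trends with period-0 weights. What
  -- remains is the error made when `δ d` stands for the trend of `Y(d)`; terms of zero weight need
  -- no assumption.
  have hratio : ∀ δ : Fin 2 → ℝ, (M.rate 1 1 1 - M.rate 1 1 0) * M.tcRatio δ
      = (M.rate 1 1 1 - M.rate 1 1 0) * M.late + ∑ d, M.rate d 1 0 * (M.trend d 1 - δ d) := by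
    intro δ
    rw [tcRatio, mul_div_cancel₀ _ hden.ne', hE11, hE10, add_sub_right_comm, add_comm,
      ← Finset.sum_sub_distrib]
    congr 1
    refine Finset.sum_congr rfl fun d _ => ?_
    rw [trend]
    ring
  have htr : ∀ d, 0 < M.rate d 1 0 → M.deltaLow d ≤ M.trend d 1 ∧ M.trend d 1 ≤ M.deltaHigh d := by
    intro d hd
    rw [hT d fun g => by
      rcases Fin.exists_fin_two.1 ⟨g, rfl⟩ with h | h <;> subst h
      · exact hpos d 0
      · exact hd]
    exact trend_bounds hPart hb hB (hpos d 0) (hpos d 1) (hne d)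
  constructor
  · refine le_of_mul_le_mul_left ?_ hden
    rw [tcLow, hratio]
    refine add_le_of_nonpos_right (Finset.sum_nonpos fun d _ => ?_)
    rcases (M.rate_nonneg d 1 0).eq_or_lt with h | h
    · rw [← h, zero_mul]
    · exact mul_nonpos_of_nonneg_of_nonpos h.le (sub_nonpos.2 (htr d h).2)
  · refine le_of_mul_le_mul_left ?_ hden
    rw [tcHigh, hratio]
    refine le_add_of_nonneg_right (Finset.sum_nonneg fun d _ => ?_)
    rcases (M.rate_nonneg d 1 0).eq_or_lt with h | h
    · rw [← h, zero_mul]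
    · exact mul_nonneg h.le (sub_nonneg.2 (htr d h).1)

end FuzzyDiD

/-! ### Regular cdfs and the quantile-quantile transform -/

/-- A continuous cdf, increasing on the set `I` where it is in `(0, 1)`. -/
structure RegCdf (I : Set ℝ) (f : ℝ → ℝ) : Prop where
  cont : Continuous f
  mono : Monotone f
  strict : StrictMonoOn f I
  mem_iff : ∀ x, x ∈ I ↔ 0 < f x ∧ f x < 1
  bot : Tendsto f atBot (𝓝 0)
  top : Tendsto f atTop (𝓝 1)

namespace RegCdf

variable {I : Set ℝ} {f g : ℝ → ℝ} (hf : RegCdf I f) (hg : RegCdf I g)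

include hf

lemma nonneg (x : ℝ) : 0 ≤ f x := hf.mono.le_of_tendsto hf.bot x

lemma le_one (x : ℝ) : f x ≤ 1 := hf.mono.ge_of_tendsto hf.top x

lemma ordConnected : I.OrdConnected :=
  ⟨fun x hx y hy z hz => (hf.mem_iff z).2
    ⟨((hf.mem_iff x).1 hx).1.trans_le (hf.mono hz.1), (hf.mono hz.2).trans_lt ((hf.mem_iff y).1 hy).2⟩⟩

lemma isOpen : IsOpen I := by
  have : I = f ⁻¹' Set.Ioo 0 1 := by ext x; exact hf.mem_iff x
  rw [this]
  exact isOpen_Ioo.preimage hf.cont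

lemma exists_eq {u : ℝ} (h0 : 0 < u) (h1 : u < 1) : ∃ x ∈ I, f x = u := by
  obtain ⟨a, ha⟩ := (hf.bot.eventually (gt_mem_nhds h0)).exists
  obtain ⟨b, hb⟩ := (hf.top.eventually (lt_mem_nhds h1)).exists
  obtain ⟨x, hx⟩ := mem_range_of_exists_le_of_exists_ge hf.cont ⟨a, ha.le⟩ ⟨b, hb.le⟩
  exact ⟨x, (hf.mem_iff x).2 (hx.symm ▸ ⟨h0, h1⟩), hx⟩

lemma eq_zero_or_one {x : ℝ} (hx : x ∉ I) : f x = 0 ∨ f x = 1 := by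
  rw [hf.mem_iff, not_and_or, not_lt, not_lt] at hx
  rcases hx with h | h
  · exact Or.inl (le_antisymm h (hf.nonneg x))
  · exact Or.inr (le_antisymm (hf.le_one x) h)

lemma nonempty : I.Nonempty := by
  obtain ⟨x, hx, -⟩ := hf.exists_eq (u := 1 / 2) (by norm_num) (by norm_num)
  exact ⟨x, hx⟩

lemma lt_of_lt {x y : ℝ} (h : x < y) (h0 : 0 < f y) (h1 : f x < 1) : f x < f y := by
  by_cases hx : x ∈ I
  · by_cases hy : y ∈ I
    · exact hf.strict hx hy h
    · rcases hf.eq_zero_or_one hy with h2 | h2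
      · exact absurd h2 h0.ne'
      · rwa [h2]
  · rcases hf.eq_zero_or_one hx with h2 | h2
    · rwa [h2]
    · exact absurd h2 h1.ne

include hg

/-- Two regular cdfs on the same `I` vanish together: outside `I` only the values `0` and `1` occur,
and which one is decided by the side of `I` on which the point lies. -/
lemma zero_of_zero {x : ℝ} (h : f x = 0) : g x = 0 := by
  have hx : x ∉ I := fun hx => ((hf.mem_iff x).1 hx).1.ne' h
  refine (hg.eq_zero_or_one hx).resolve_right fun h1 => ?_
  obtain ⟨z, hz⟩ := hf.nonempty
  have hxz : x < z := lt_of_not_ge fun h2 => by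
    have := hf.mono h2
    linarith [((hf.mem_iff z).1 hz).1]
  have := hg.mono hxz.le
  linarith [((hg.mem_iff z).1 hz).2]

lemma one_of_one {x : ℝ} (h : f x = 1) : g x = 1 := by
  have hx : x ∉ I := fun hx => ((hf.mem_iff x).1 hx).2.ne h
  refine (hg.eq_zero_or_one hx).resolve_left fun h1 => ?_
  obtain ⟨z, hz⟩ := hf.nonempty
  have hxz : z < x := lt_of_not_ge fun h2 => by
    have := hf.mono h2
    linarith [((hf.mem_iff z).1 hz).2]
  have := hg.mono hxz.le
  linarith [((hg.mem_iff z).1 hz).1]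

omit hg

lemma genInv_apply {x : ℝ} (hx : x ∈ I) : genInv f (f x) = x := by
  refine (show IsLeast (Real.toEReal '' {z : ℝ | f x ≤ f z}) (x : EReal) from
    ⟨⟨x, le_refl (f x), rfl⟩, ?_⟩).isGLB.sInf_eq
  rintro _ ⟨z, hz, rfl⟩
  rw [EReal.coe_le_coe_iff]
  by_contra h
  exact absurd (hf.lt_of_lt (not_le.1 h) ((hf.mem_iff x).1 hx).1
    ((hf.mono (not_le.1 h).le).trans_lt ((hf.mem_iff x).1 hx).2)) (not_lt.2 hz)

end RegCdf

/-- An increasing map of an interval onto itself can be glued with the identity outside: a point off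
the interval stays on the same side of all images. Working with order isomorphisms of the whole line
gives continuity and inverses at once. -/
lemma exists_orderIso_extend {J : Set ℝ} (hJ : J.OrdConnected) {ψ : ℝ → ℝ} (hψ : StrictMonoOn ψ J)
    (hm : Set.MapsTo ψ J J) (hs : Set.SurjOn ψ J J) :
    ∃ e : ℝ ≃o ℝ, (∀ x ∈ J, e x = ψ x) ∧ ∀ x ∉ J, e x = x := by
  classical
  let e : ℝ → ℝ := fun x => if x ∈ J then ψ x else x
  have he1 : ∀ x ∈ J, e x = ψ x := fun x hx => if_pos hx
  have he2 : ∀ x ∉ J, e x = x := fun x hx => if_neg hx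
  have hmono : StrictMono e := by
    intro x y hxy
    by_cases hx : x ∈ J <;> by_cases hy : y ∈ J
    · rw [he1 x hx, he1 y hy]; exact hψ hx hy hxy
    · rw [he1 x hx, he2 y hy]
      by_contra h
      exact hy (hJ.out hx (hm hx) ⟨hxy.le, not_lt.1 h⟩)
    · rw [he2 x hx, he1 y hy]
      by_contra h
      exact hx (hJ.out (hm hy) hy ⟨not_lt.1 h, hxy.le⟩)
    · rw [he2 x hx, he2 y hy]; exact hxy
  have hsurj : Function.Surjective e := by
    intro y
    by_cases hy : y ∈ J
    · obtain ⟨x, hx, rfl⟩ := hs hy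
      exact ⟨x, he1 x hx⟩
    · exact ⟨y, he2 y hy⟩
  exact ⟨hmono.orderIsoOfSurjective e hsurj, he1, he2⟩

lemma cdfAt_coe (q : ℝ → ℝ) (x : ℝ) : cdfAt q (x : EReal) = q x := by
  rw [cdfAt, if_neg (EReal.coe_ne_bot x), if_neg (EReal.coe_ne_top x), EReal.toReal_coe]

/-- Every real satisfies `0 ≤ p x`, so the generalized inverse at `0` is `⊥`, where a cdf is
evaluated as `0`. Thus `H_d` takes the expected value at the left endpoint even though no real
quantile exists there. -/
lemma cdfAt_genInv_zero {p q : ℝ → ℝ} (hp : ∀ x, 0 ≤ p x) : cdfAt q (genInv p 0) = 0 := by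
  have : genInv p 0 = ⊥ := by
    rw [genInv, show {x : ℝ | 0 ≤ p x} = Set.univ from Set.eq_univ_of_forall hp, Set.image_univ,
      sInf_eq_bot]
    intro b hb
    obtain ⟨x, -, hx⟩ := EReal.lt_iff_exists_real_btwn.1 hb
    exact ⟨x, ⟨x, rfl⟩, hx⟩
  rw [this, cdfAt, if_pos rfl]

lemma cdfAt_genInv_one {I : Set ℝ} {p q : ℝ → ℝ} (hp : RegCdf I p) (hq : RegCdf I q) :
    cdfAt q (genInv p 1) = 1 := by
  by_cases h : ∃ x, p x = 1
  · obtain ⟨x, hx⟩ := h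
    obtain ⟨z, hz⟩ := hp.nonempty
    have hne : {x : ℝ | 1 ≤ p x}.Nonempty := ⟨x, hx.ge⟩
    have hbd : BddBelow {x : ℝ | 1 ≤ p x} := ⟨z, fun w hw => le_of_not_gt fun h2 => by
      have := hp.mono h2.le
      have h3 : 1 ≤ p w := hw
      linarith [((hp.mem_iff z).1 hz).2]⟩
    have hmem := (isClosed_le continuous_const hp.cont).csInf_mem hne hbd
    have e : genInv p 1 = ((sInf {x : ℝ | 1 ≤ p x} : ℝ) : EReal) :=
      (show IsLeast (Real.toEReal '' {z : ℝ | 1 ≤ p z}) _ from ⟨⟨_, hmem, rfl⟩, by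
        rintro _ ⟨w, hw, rfl⟩; exact_mod_cast csInf_le hbd hw⟩).isGLB.sInf_eq
    rw [e, cdfAt_coe]
    exact hp.one_of_one hq (le_antisymm (hp.le_one _) hmem)
  · have : {x : ℝ | 1 ≤ p x} = ∅ := by
      ext x
      simp only [Set.mem_ofPred_eq, Set.mem_empty_iff_false, iff_false]
      exact fun h1 => h ⟨x, le_antisymm (hp.le_one x) h1⟩
    rw [genInv, this, Set.image_empty, sInf_empty, cdfAt, if_neg (by simp), if_pos rfl]

/-- The quantile-quantile transform `q ∘ p⁻¹`, as an order isomorphism. -/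
lemma RegCdf.exists_transform {I : Set ℝ} {p q : ℝ → ℝ} (hp : RegCdf I p) (hq : RegCdf I q) :
    ∃ e : ℝ ≃o ℝ, e 0 = 0 ∧ e 1 = 1 ∧ (∀ x, e (p x) = q x) ∧ (∀ u ∉ Set.Ioo (0 : ℝ) 1, e u = u) ∧
      ∀ u ∈ Set.Icc (0 : ℝ) 1, cdfAt q (genInv p u) = e u := by
  have key : ∀ x ∈ I, cdfAt q (genInv p (p x)) = q x := fun x hx => by
    rw [hp.genInv_apply hx, cdfAt_coe]
  obtain ⟨e, he1, he2⟩ := exists_orderIso_extend (J := Set.Ioo 0 1)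
    (ψ := fun u => cdfAt q (genInv p u)) Set.ordConnected_Ioo (by
      rintro u ⟨hu0, hu1⟩ v ⟨hv0, hv1⟩ huv
      obtain ⟨x, hx, rfl⟩ := hp.exists_eq hu0 hu1
      obtain ⟨y, hy, rfl⟩ := hp.exists_eq hv0 hv1
      simp only [key x hx, key y hy]
      exact hq.strict hx hy (hp.mono.reflect_lt huv)) (by
      rintro u ⟨hu0, hu1⟩
      obtain ⟨x, hx, rfl⟩ := hp.exists_eq hu0 hu1
      simp only [key x hx]
      exact (hq.mem_iff x).1 hx) (by
      rintro v ⟨hv0, hv1⟩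
      obtain ⟨x, hx, rfl⟩ := hq.exists_eq hv0 hv1
      exact ⟨p x, (hp.mem_iff x).1 hx, key x hx⟩)
  have e0 : e 0 = 0 := he2 0 (by simp)
  have e1 : e 1 = 1 := he2 1 (by simp)
  refine ⟨e, e0, e1, fun x => ?_, he2, fun u hu => ?_⟩
  · by_cases hx : x ∈ I
    · rw [he1 _ ((hp.mem_iff x).1 hx), key x hx]
    · rcases hp.eq_zero_or_one hx with h | h
      · rw [h, e0, hp.zero_of_zero hq h]
      · rw [h, e1, hp.one_of_one hq h]
  · rcases hu.1.eq_or_lt with h | h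
    · rw [← h, e0, cdfAt_genInv_zero hp.nonneg]
    · rcases hu.2.eq_or_lt with h' | h'
      · rw [h', e1, cdfAt_genInv_one hp hq]
      · exact (he1 u ⟨h, h'⟩).symm

/-- The point is that the interior of the support is exactly `{0 < F < 1}`. Around an interior
point, strict increase on both sides keeps `F` off `0` and `1`. Conversely, if `0 < F x < 1`,
continuity leaves mass on either side of a neighbourhood of `x`, so the support has points on both
sides and order-connectedness fills the gap. -/
lemma regCdf_of_support (μ : Measure ℝ) [IsProbabilityMeasure μ] (hS : μ.support.OrdConnected)
    (hc : Continuous fun x => μ.real (Set.Iic x))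
    (hs : StrictMonoOn (fun x => μ.real (Set.Iic x)) μ.support) :
    RegCdf (interior μ.support) fun x => μ.real (Set.Iic x) := by
  have hmono : Monotone fun x => μ.real (Set.Iic x) := (subCdf_real_Iic μ).mono
  have hcdf : (fun x => μ.real (Set.Iic x)) = cdf μ := by ext x; rw [cdf_eq_real]
  have hbot : Tendsto (fun x => μ.real (Set.Iic x)) atBot (𝓝 0) := hcdf ▸ tendsto_cdf_atBot μ
  have htop : Tendsto (fun x => μ.real (Set.Iic x)) atTop (𝓝 1) := hcdf ▸ tendsto_cdf_atTop μ
  refine ⟨hc, hmono, hs.mono interior_subset, fun x => ⟨fun hx => ?_, fun ⟨h0, h1⟩ => ?_⟩,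
    hbot, htop⟩
  · obtain ⟨ε, hε, hb⟩ := Metric.mem_nhds_iff.1 (mem_interior_iff_mem_nhds.1 hx)
    have hx' := interior_subset hx
    have h1 : x - ε / 2 ∈ μ.support := hb (by simpa [abs_of_pos hε] using hε)
    have h2 : x + ε / 2 ∈ μ.support := hb (by simpa [abs_of_pos hε] using hε)
    exact ⟨lt_of_le_of_lt measureReal_nonneg (hs h1 hx' (by linarith)),
      lt_of_lt_of_le (hs hx' h2 (by linarith)) measureReal_le_one⟩
  · have e0 : ∀ᶠ z in 𝓝[<] x, 0 < μ.real (Set.Iic z) :=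
      (hc.continuousWithinAt (s := Set.Iio x)).eventually (lt_mem_nhds h0)
    have e1 : ∀ᶠ z in 𝓝[>] x, μ.real (Set.Iic z) < 1 :=
      (hc.continuousWithinAt (s := Set.Ioi x)).eventually (gt_mem_nhds h1)
    obtain ⟨z, hz, hzx⟩ := (e0.and self_mem_nhdsWithin).exists
    obtain ⟨w, hw, hwx⟩ := (e1.and self_mem_nhdsWithin).exists
    obtain ⟨s, hs1, hs2⟩ := Measure.nonempty_inter_support_of_pos (μ := μ) (s := Set.Iic z)
      (by rw [measureReal_def] at hz; exact (ENNReal.toReal_pos_iff.1 hz).1)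
    obtain ⟨t, ht1, ht2⟩ := Measure.nonempty_inter_support_of_pos (μ := μ) (s := Set.Ioi w) (by
      have : 0 < μ.real (Set.Ioi w) := by
        rw [← Set.compl_Iic, probReal_compl_eq_one_sub measurableSet_Iic]; linarith
      rw [measureReal_def] at this; exact (ENNReal.toReal_pos_iff.1 this).1)
    refine mem_interior.2 ⟨Set.Ioo z w, ?_, isOpen_Ioo, hzx, hwx⟩
    exact fun v hv => hS.out hs2 ht2 ⟨(Set.mem_Iic.1 hs1).trans hv.1.le, hv.2.le.trans (Set.mem_Ioi.1 ht1).le⟩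

namespace FuzzyDiD

variable {M : FuzzyDiD.{u}}

lemma DataRestrictions.regCdf (h : M.DataRestrictions) {d g t : Fin 2} (hr : 0 < M.rate d g t) :
    RegCdf (interior M.suppY) (M.F d g t) := by
  obtain ⟨h1, h2, h3⟩ := h.2 d g t hr
  have := isProbabilityMeasure_cellLaw hr
  have e : M.F d g t = fun x => (M.cellLaw d g t).real (Set.Iic x) := funext (M.F_eq d g t)
  have e1 : (M.cellLaw d g t).support = M.suppY := h1
  rw [e] at h2 h3 ⊢
  rw [← e1] at h3 ⊢
  exact regCdf_of_support _ (e1 ▸ h.1) h2 h3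

/-- The order isomorphism extending `H_d` (and `H_d⁻¹`) from the unit interval. -/
lemma DataRestrictions.exists_H (h : M.DataRestrictions) {d : Fin 2} (h0 : 0 < M.rate d 0 0)
    (h1 : 0 < M.rate d 1 0) :
    ∃ e : ℝ ≃o ℝ, e 0 = 0 ∧ e 1 = 1 ∧ (∀ x, e (M.F d 0 0 x) = M.F d 1 0 x) ∧
      (∀ u ∉ Set.Ioo (0 : ℝ) 1, e u = u) ∧
      (∀ u ∈ Set.Icc (0 : ℝ) 1, M.H d u = e u) ∧ ∀ q, M.Hinv d q = e.symm (M01 q) := by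
  obtain ⟨e, e0, e1, he, hout, hH⟩ := (h.regCdf h0).exists_transform (h.regCdf h1)
  refine ⟨e, e0, e1, he, hout, hH, fun q => ?_⟩
  have s0 : e.symm 0 = 0 := by rw [OrderIso.symm_apply_eq, e0]
  have s1 : e.symm 1 = 1 := by rw [OrderIso.symm_apply_eq, e1]
  rw [Hinv]
  split_ifs with hq hq'
  · rw [M01_of_nonpos hq.le, s0]
  · rw [M01_of_one_le hq'.le, s1]
  · rw [not_lt] at hq hq'
    rw [M01_of_mem hq hq']
    refine (show IsLeast {x : ℝ | x ∈ Set.Icc 0 1 ∧ q ≤ M.H d x} (e.symm q) from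
      ⟨⟨⟨?_, ?_⟩, ?_⟩, ?_⟩).csInf_eq
    · rw [← s0]; exact e.symm.monotone hq
    · rw [← s1]; exact e.symm.monotone hq'
    · rw [H, hH _ ⟨by rw [← s0]; exact e.symm.monotone hq, by rw [← s1]; exact e.symm.monotone hq'⟩]
      simp
    · rintro x ⟨hx, hqx⟩
      rw [H, hH _ hx] at hqx
      exact (e.symm_apply_le).2 hqx

end FuzzyDiD

/-- Lower sets of the line are totally ordered, so `B` is comparable with every `A x`, and the order
of `p x` and `η₀ B` decides on which side of `η₁ B` the value `q x` lies. Since `q` takes all values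
in `(0, 1)`, a gap between `η₁ B` and `e (η₀ B)` would contain some `q x`, a contradiction. The set
`B` need not be one of the `A x`, which is what a comparison of two periods requires. -/
lemma real_eq_transform_of_isLowerSet {η₀ η₁ : Measure ℝ} [IsProbabilityMeasure η₀]
    [IsProbabilityMeasure η₁] {A : ℝ → Set ℝ} (hA : ∀ x, IsLowerSet (A x)) {I : Set ℝ}
    {p q : ℝ → ℝ} (hq : RegCdf I q) (hp' : ∀ x, p x = η₀.real (A x))
    (hq' : ∀ x, q x = η₁.real (A x)) {e : ℝ ≃o ℝ} (e0 : e 0 = 0) (e1 : e 1 = 1)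
    (he : ∀ x, e (p x) = q x) {B : Set ℝ} (hB : IsLowerSet B) : η₁.real B = e (η₀.real B) := by
  have h1 : ∀ x, p x < η₀.real B → q x ≤ η₁.real B := by
    intro x hx
    rcases (hA x).total hB with h | h
    · rw [hq']; exact measureReal_mono h
    · rw [hp'] at hx
      exact absurd (measureReal_mono h) (not_le.2 hx)
  have h2 : ∀ x, η₀.real B < p x → η₁.real B ≤ q x := by
    intro x hx
    rcases (hA x).total hB with h | h
    · rw [hp'] at hx
      exact absurd (measureReal_mono h) (not_le.2 hx)
    · rw [hq']; exact measureReal_mono h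
  refine le_antisymm (le_of_not_gt fun h => ?_) (le_of_not_gt fun h => ?_)
  · obtain ⟨v, hv1, hv2⟩ := exists_between h
    obtain ⟨x, hx, hxv⟩ := hq.exists_eq (u := v)
      ((e0 ▸ e.monotone measureReal_nonneg : 0 ≤ e (η₀.real B)).trans_lt hv1)
      (hv2.trans_le measureReal_le_one)
    refine absurd (h2 x ?_) (not_le.2 (hxv ▸ hv2))
    rw [← e.lt_iff_lt, he, hxv]; exact hv1
  · obtain ⟨v, hv1, hv2⟩ := exists_between h
    obtain ⟨x, hx, hxv⟩ := hq.exists_eq (u := v) (measureReal_nonneg.trans_lt hv1)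
      (hv2.trans_le (e1 ▸ e.monotone measureReal_le_one : e (η₀.real B) ≤ 1))
    refine absurd (h1 x ?_) (not_le.2 (hxv ▸ hv1))
    rw [← e.lt_iff_lt, he, hxv]; exact hv2

/-- As `K` runs over the unit interval, `l f + (1 - l) K` fills a segment. Truncating the solution
`t` of `l f + (1 - l) t = θ` selects the point of the segment nearest to `θ`, and this point lies
between `θ` and any other point of the segment. The sign of `1 - l` only changes the orientation. -/
lemma clamp_between {l f K θ : ℝ} (hl : l ≠ 1) (h0 : 0 ≤ K) (h1 : K ≤ 1) :
    (l * f + (1 - l) * K ≤ θ →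
      l * f + (1 - l) * K ≤ l * f + (1 - l) * M01 ((l * f - θ) / (l - 1)) ∧
      l * f + (1 - l) * M01 ((l * f - θ) / (l - 1)) ≤ θ) ∧
    (θ ≤ l * f + (1 - l) * K →
      θ ≤ l * f + (1 - l) * M01 ((l * f - θ) / (l - 1)) ∧
      l * f + (1 - l) * M01 ((l * f - θ) / (l - 1)) ≤ l * f + (1 - l) * K) := by
  set t := (l * f - θ) / (l - 1) with ht
  have hl' : l - 1 ≠ 0 := sub_ne_zero.2 hl
  have hθ : θ = l * f + (1 - l) * t := by rw [ht]; field_simp; ring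
  rw [hθ]
  have up : K ≤ t → K ≤ M01 t ∧ M01 t ≤ t := fun h => ⟨le_M01 h1 h, M01_le (h0.trans h) le_rfl⟩
  have dn : t ≤ K → t ≤ M01 t ∧ M01 t ≤ K := fun h => ⟨le_M01 (h.trans h1) le_rfl, M01_le h0 h⟩
  rcases lt_or_gt_of_ne hl with h | h
  · constructor
    · intro h2
      have h3 : K ≤ t := by nlinarith
      have := up h3
      constructor <;> nlinarith
    · intro h2
      have h3 : t ≤ K := by nlinarith
      have := dn h3
      constructor <;> nlinarith
  · constructor
    · intro h2
      have h3 : t ≤ K := by nlinarith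
      have := dn h3
      constructor <;> nlinarith
    · intro h2
      have h3 : K ≤ t := by nlinarith
      have := up h3
      constructor <;> nlinarith

/-- Scalar form of the bounds: `Φ` is the value of the cdf of the stayers in the control group, `C` that of
the cdf of the switchers in the treatment group. -/
lemma cic_scalar {e : ℝ ≃o ℝ} (e0 : e 0 = 0) (e1 : e 1 = 1) {l l' f g K C : ℝ} (hl : l ≠ 1)
    (hl' : l' ≠ 1) (hl0 : 0 ≤ l') (hg : 0 ≤ g) (hg' : g ≤ 1) (hK0 : 0 ≤ K) (hK1 : K ≤ 1)
    (hC0 : 0 ≤ C) (hC1 : C ≤ 1) (hΦ0 : 0 ≤ l * f + (1 - l) * K) (hΦ1 : l * f + (1 - l) * K ≤ 1)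
    (hC : l' * g - e (l * f + (1 - l) * K) = (l' - 1) * C) {Φl Φh : ℝ}
    (hΦl : Φl = l * f + (1 - l) * M01 ((l * f - e.symm (M01 (l' * g))) / (l - 1)))
    (hΦh : Φh = l * f + (1 - l) * M01 ((l * f - e.symm (M01 (l' * g + (1 - l')))) / (l - 1))) :
    (0 ≤ Φl ∧ Φl ≤ 1 ∧ 0 ≤ (l' * g - e Φl) / (l' - 1) ∧ (l' * g - e Φl) / (l' - 1) ≤ C) ∧
    (0 ≤ Φh ∧ Φh ≤ 1 ∧ C ≤ (l' * g - e Φh) / (l' - 1) ∧ (l' * g - e Φh) / (l' - 1) ≤ 1) := by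
  have low := clamp_between (l := l) (f := f) (θ := e.symm (M01 (l' * g))) hl hK0 hK1
  have high := clamp_between (l := l) (f := f) (θ := e.symm (M01 (l' * g + (1 - l')))) hl hK0 hK1
  rw [← hΦl] at low
  rw [← hΦh] at high
  set Φ := l * f + (1 - l) * K
  have heΦ0 : 0 ≤ e Φ := e0 ▸ e.monotone hΦ0
  have heΦ1 : e Φ ≤ 1 := e1 ▸ e.monotone hΦ1
  have hg0 : 0 ≤ l' * g := mul_nonneg hl0 hg
  have hg1 : l' * g + (1 - l') ≤ 1 := by nlinarith
  have hs0 : ∀ q, 0 ≤ e.symm (M01 q) := fun q => by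
    rw [e.le_symm_apply, e0]; exact M01_nonneg q
  have hs1 : ∀ q, e.symm (M01 q) ≤ 1 := fun q => by
    rw [e.symm_apply_le, e1]; exact M01_le_one q
  rw [e.le_symm_apply, e.le_symm_apply, e.symm_apply_le, e.symm_apply_le] at low high
  -- The constraint `0 ≤ C ≤ 1` places `e Φ` between `l' g` and `l' g + (1 - l')`, in an order that
  -- depends on the sign of `l' - 1`. This selects the direction of clamping for each bound.
  rcases lt_or_gt_of_ne hl' with h | h
  · have hneg : l' - 1 < 0 := by linarith
    have a1 := low.2 (M01_le heΦ0 (by nlinarith))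
    have a2 := high.1 (le_M01 heΦ1 (by nlinarith))
    have c1 := e.monotone a1.2
    have c2 := e.monotone a2.1
    have d1 := (le_M01 (by nlinarith : l' * g ≤ 1) le_rfl).trans a1.1
    have d2 := a2.2.trans (M01_le (by nlinarith : 0 ≤ l' * g + (1 - l')) le_rfl)
    refine ⟨⟨(hs0 _).trans (e.symm_apply_le.2 a1.1), a1.2.trans hΦ1, ?_, ?_⟩,
      hΦ0.trans a2.1, (e.le_symm_apply.2 a2.2).trans (hs1 _), ?_, ?_⟩
    · exact div_nonneg_of_nonpos (by linarith) hneg.le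
    · rw [div_le_iff_of_neg hneg]; linarith
    · rw [le_div_iff_of_neg hneg]; linarith
    · rw [div_le_iff_of_neg hneg]; linarith
  · have hpos : 0 < l' - 1 := by linarith
    have a1 := low.1 (le_M01 heΦ1 (by nlinarith))
    have a2 := high.2 (M01_le heΦ0 (by nlinarith))
    have c1 := e.monotone a1.1
    have c2 := e.monotone a2.2
    have d1 := a1.2.trans (M01_le hg0 le_rfl)
    have d2 := (le_M01 hg1 le_rfl).trans a2.1
    refine ⟨⟨hΦ0.trans a1.1, (e.le_symm_apply.2 a1.2).trans (hs1 _), ?_, ?_⟩,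
      (hs0 _).trans (e.symm_apply_le.2 a2.1), a2.2.trans hΦ1, ?_, ?_⟩
    · exact div_nonneg (by linarith) hpos.le
    · rw [div_le_iff₀ hpos]; linarith
    · rw [le_div_iff₀ hpos]; linarith
    · rw [div_le_iff₀ hpos]; linarith

namespace FuzzyDiD

variable {M : FuzzyDiD.{u}}

lemma Participation.real_inter_Dpot (hPart : M.Participation) (d g t : Fin 2) :
    M.P.real ({ω | M.G ω = g ∧ M.Dpot 0 ω = d} ∩ M.T ⁻¹' {t})
      = M.P.real (M.cell g t) * M.rate d g 0 := by
  rw [hPart.rate_eq, ← hPart.real_Dpot g t 0 d, real_mul_cond_real _ (M.measurableSet_cell g t)]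
  congr 1
  ext ω
  simp only [cell, Set.mem_inter_iff, Set.mem_ofPred_eq, Set.mem_preimage, Set.mem_singleton_iff]
  tauto

/-- Participation fixes the share of units with `D(0) = d`, and independence fixes the law of `U`
among them. The right-hand side therefore does not involve `t`: this is time invariance in usable
form. -/
lemma real_stay_of_indep (hPart : M.Participation) {d g : Fin 2} (hr : 0 < M.rate d g 0)
    {U : M.Ω → ℝ} (hU : Measurable U)
    (hind : IndepFun U M.T (cond M.P {ω | M.G ω = g ∧ M.Dpot 0 ω = d})) (t : Fin 2) {A : Set ℝ}
    (hA : MeasurableSet A) :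
    (cond M.P (M.cell g t)).real {ω | M.Dpot 0 ω = d ∧ U ω ∈ A}
      = M.rate d g 0 * ((cond M.P {ω | M.G ω = g ∧ M.Dpot 0 ω = d}).map U).real A := by
  set E := {ω | M.G ω = g ∧ M.Dpot 0 ω = d} with hE
  have hEm : MeasurableSet E :=
    (M.measurable_G (measurableSet_singleton g)).inter (measurableSet_Dpot 0 d)
  have hEpos : 0 < M.P.real E := by
    refine lt_of_lt_of_le ?_ (measureReal_mono (Set.inter_subset_left (t := M.T ⁻¹' {t})))
    rw [hPart.real_inter_Dpot]
    exact mul_pos (M.cell_real_pos g t) hr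
  have h1 := congrArg ENNReal.toReal
    (hind.measure_inter_preimage_eq_mul A {t} hA (measurableSet_singleton t))
  rw [ENNReal.toReal_mul] at h1
  simp only [← measureReal_def] at h1
  have e1 := real_mul_cond_real M.P hEm (U ⁻¹' A ∩ M.T ⁻¹' {t})
  have e2 := real_mul_cond_real M.P hEm (M.T ⁻¹' {t})
  rw [hPart.real_inter_Dpot] at e2
  rw [map_measureReal_apply hU hA, cond_real_apply _ (M.measurableSet_cell g t),
    inv_mul_eq_iff_eq_mul₀ (M.cell_real_pos g t).ne']
  have e3 : M.cell g t ∩ {ω | M.Dpot 0 ω = d ∧ U ω ∈ A} = E ∩ (U ⁻¹' A ∩ M.T ⁻¹' {t}) := by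
    ext ω
    simp only [hE, cell, Set.mem_inter_iff, Set.mem_ofPred_eq, Set.mem_preimage,
      Set.mem_singleton_iff]
    tauto
  rw [e3, ← e1, h1]
  linear_combination ((cond M.P E).real (U ⁻¹' A)) * e2

/-- Under time invariance of the unobservables, the distributions of `Y(d)` given `D(0) = d` at
period 1 in the two groups are related by the quantile-quantile transform at period 0. -/
lemma MonotoneInvariant.stay_eq (hM : M.MonotoneInvariant) (hPart : M.Participation)
    (hD : M.DataRestrictions) {d : Fin 2} (h0 : 0 < M.rate d 0 0) (h1 : 0 < M.rate d 1 0)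
    {e : ℝ ≃o ℝ} (e0 : e 0 = 0) (e1 : e 1 = 1) (he : ∀ x, e (M.F d 0 0 x) = M.F d 1 0 x) (y : ℝ) :
    M.stay d 1 (Set.Iic y) = M.rate d 1 0 * e (M.stay d 0 (Set.Iic y) / M.rate d 0 0) := by
  obtain ⟨U, h, hU, hh, hY, hind⟩ := hM
  -- In period `t` the event `Y(d) ≤ x` is `U_d ∈ A t x`, a lower set since `h_d(·, t)` is
  -- increasing. Lower sets of the two periods can be compared even if `h_d(·, 0)` and `h_d(·, 1)`
  -- have different ranges.
  let A : Fin 2 → ℝ → Set ℝ := fun t x => {u | h d u t ≤ x}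
  have hAl : ∀ t x, IsLowerSet (A t x) := fun t x a b hba ha =>
    ((hh d t).monotone hba).trans ha
  have hAm : ∀ t x, MeasurableSet (A t x) := fun t x => (hAl t x).ordConnected.measurableSet
  let η : Fin 2 → Measure ℝ := fun g => (cond M.P {ω | M.G ω = g ∧ M.Dpot 0 ω = d}).map (U d)
  have key : ∀ g, 0 < M.rate d g 0 → ∀ t x,
      (cond M.P (M.cell g t)).real {ω | M.Dpot 0 ω = d ∧ M.Y d ω ∈ Set.Iic x}
        = M.rate d g 0 * (η g).real (A t x) := by
    intro g hg t x
    rw [← real_stay_of_indep hPart hg (hU d) (hind d g d) t (hAm t x)]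
    refine measureReal_congr ?_
    filter_upwards [cond_absolutelyContinuous.ae_le (hY d),
      ae_cond_of_forall_mem (M.measurableSet_cell g t) (p := fun ω => M.T ω = t) fun ω hω => hω.2]
      with ω h1 h2
    have : (M.Y d ω ∈ Set.Iic x) = (U d ω ∈ A t x) := by
      rw [h1, h2]; rfl
    change (M.Dpot 0 ω = d ∧ M.Y d ω ∈ Set.Iic x) = (M.Dpot 0 ω = d ∧ U d ω ∈ A t x)
    rw [this]
  have hprob : ∀ g, 0 < M.rate d g 0 → IsProbabilityMeasure (η g) := by
    intro g hg
    have : IsProbabilityMeasure (cond M.P {ω | M.G ω = g ∧ M.Dpot 0 ω = d}) := by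
      refine cond_isProbabilityMeasure fun h0 => ?_
      have h2 := hPart.real_inter_Dpot d g 0
      rw [measureReal_def, measure_mono_null Set.inter_subset_left h0] at h2
      exact (mul_pos (M.cell_real_pos g 0) hg).ne h2
    exact Measure.isProbabilityMeasure_map (hU d).aemeasurable
  have hF : ∀ g, 0 < M.rate d g 0 → ∀ x, M.F d g 0 x = (η g).real (A 0 x) := by
    intro g hg x
    have h2 := key g hg 0 x
    rw [← M.rate_mul_cellLaw d g 0 measurableSet_Iic, ← F_eq] at h2
    exact mul_left_cancel₀ hg.ne' h2
  have := hprob 0 h0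
  have := hprob 1 h1
  have h3 := real_eq_transform_of_isLowerSet (η₀ := η 0) (η₁ := η 1) (hAl 0) (hD.regCdf h1)
    (hF 0 h0) (hF 1 h1) e0 e1 he (hAl 1 y)
  rw [stay, stay, key 0 h0 1 y, key 1 h1 1 y, mul_div_cancel_left₀ _ h0.ne', h3]

/-- Pointwise bounds on the cdf of `Y(d)` among switchers. -/
lemma cop_bounds (hPart : M.Participation) (hFS : M.FirstStage)
    (hRate : ∀ t, 0 < M.rate 1 0 t ∧ M.rate 1 0 t < 1)
    (hChange : M.rate 1 0 1 ≠ M.rate 1 0 0) (hM : M.MonotoneInvariant)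
    (hD : M.DataRestrictions) (d : Fin 2) (y : ℝ) :
    (0 ≤ M.Cop d (M.Tlow d) y ∧ M.Cop d (M.Tlow d) y ≤ M.switcherCdf d y) ∧
      M.switcherCdf d y ≤ M.Cop d (M.Thigh d) y ∧ M.Cop d (M.Thigh d) y ≤ 1 := by
  have := hPart.isProbabilityMeasure_switLaw hFS d
  have hS := hPart.switLaw_eq hFS d (measurableSet_Iic (a := y))
  rw [← F_eq, ← switcherCdf_eq] at hS
  have hS0 : 0 ≤ M.switcherCdf d y := by rw [switcherCdf_eq]; exact measureReal_nonneg
  have hS1 : M.switcherCdf d y ≤ 1 := by rw [switcherCdf_eq]; exact measureReal_le_one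
  have hne := hFS.rate_ne d
  -- If nobody in the treatment group has `D(0) = d`, every unit of that group with `D = d` in
  -- period 1 is a switcher, and the bounds collapse to the true cdf.
  rcases (M.rate_nonneg d 1 0).eq_or_lt with h1 | h1
  · have hst : M.stay d 1 (Set.Iic y) = 0 := by
      refine le_antisymm ?_ measureReal_nonneg
      rw [h1, ← hPart.stay_univ]
      exact measureReal_mono fun ω h => ⟨h.1, trivial⟩
    have hC : ∀ T, M.Cop d T y = M.switcherCdf d y := by
      intro T
      rw [Cop, ← h1, zero_mul, div_eq_iff (by rw [sub_zero]; rw [← h1] at hne; exact hne)]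
      rw [hst, ← h1] at hS
      linarith
    rw [hC, hC]
    exact ⟨⟨hS0, le_rfl⟩, le_rfl, hS1⟩
  have hpos : ∀ t, 0 < M.rate d 0 t := by
    intro t
    have := hRate t
    have := M.rate_zero 0 t
    rcases Fin.exists_fin_two.1 ⟨d, rfl⟩ with h | h <;> subst h <;> linarith
  have hne0 : M.rate d 0 1 ≠ M.rate d 0 0 := by
    have h1 := M.rate_zero 0 1
    have h2 := M.rate_zero 0 0
    rcases Fin.exists_fin_two.1 ⟨d, rfl⟩ with h | h <;> subst h
    · intro h; exact hChange (by linarith)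
    · exact hChange
  have h0 := hpos 0
  obtain ⟨e, e0, e1, he, -, hH, hHi⟩ := hD.exists_H h0 h1
  set K := M.swit d 0 (Set.Iic y) / M.swit d 0 Set.univ with hK
  obtain ⟨hKpos, hK'⟩ := hPart.rate_mul_sub_stay hne0 (measurableSet_Iic (a := y))
  rw [← F_eq, ← hK] at hK'
  have hK0 : 0 ≤ K := div_nonneg (swit_nonneg _ _ _) hKpos.le
  have hK1 : K ≤ 1 := (div_le_one hKpos).2 (swit_mono (Set.subset_univ _))
  -- From here on the target depends on the data and on the single unknown `K`, through `Φ` and `e`.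
  rw [hM.stay_eq hPart hD h0 h1 e0 e1 he] at hS
  set Φ := M.stay d 0 (Set.Iic y) / M.rate d 0 0 with hΦ
  set l := M.lam 0 d with hl
  set l' := M.lam 1 d with hl'
  set f := M.F d 0 1 y with hf
  set g := M.F d 1 1 y with hg
  set C := M.switcherCdf d y with hC
  have hl1 : l ≠ 1 := fun h => hne0 ((div_eq_one_iff_eq h0.ne').1 h)
  have hl1' : l' ≠ 1 := fun h => hne ((div_eq_one_iff_eq h1.ne').1 h)
  have r0 : M.rate d 0 1 = l * M.rate d 0 0 := by rw [hl, lam, div_mul_cancel₀ _ h0.ne']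
  have r1 : M.rate d 1 1 = l' * M.rate d 1 0 := by rw [hl', lam, div_mul_cancel₀ _ h1.ne']
  have hΦeq : Φ = l * f + (1 - l) * K := by
    rw [r0] at hK'
    rw [hΦ, div_eq_iff h0.ne']
    linarith
  have hCeq : l' * g - e Φ = (l' - 1) * C := by
    rw [r1] at hS
    have : M.rate d 1 0 * (l' * g - e Φ) = M.rate d 1 0 * ((l' - 1) * C) := by linarith
    exact mul_left_cancel₀ h1.ne' this
  have hΦ0 : 0 ≤ Φ := div_nonneg measureReal_nonneg h0.le
  have hΦ1 : Φ ≤ 1 := by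
    rw [hΦ, div_le_one h0, ← hPart.stay_univ]
    exact measureReal_mono fun ω h => ⟨h.1, trivial⟩
  rw [hΦeq] at hΦ0 hΦ1 hCeq
  obtain ⟨⟨p0, p1, p2, p3⟩, p4, p5, p6, p7⟩ := cic_scalar e0 e1 hl1 hl1'
    (div_nonneg (M.rate_nonneg _ _ _) h1.le) (g := g) measureReal_nonneg measureReal_le_one hK0 hK1
    hS0 hS1 hΦ0 hΦ1 hCeq rfl rfl
  -- evaluation of the bound through the composed cdf
  have hcop : ∀ (T : ℝ → ℝ), 0 ≤ l * f + (1 - l) * T y → l * f + (1 - l) * T y ≤ 1 →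
      M.Cop d T y = (l' * g - e (l * f + (1 - l) * T y)) / (l' - 1) := by
    intro T ht0 ht1
    rw [Cop, Gop, ← hl, ← hf, hH _ ⟨ht0, ht1⟩, r1, ← hg,
      ← mul_div_mul_left (l' * g - e (l * f + (1 - l) * T y)) (l' - 1) h1.ne']
    congr 1 <;> ring
  rw [← hHi] at p0 p1 p2 p3 p4 p5 p6 p7
  change 0 ≤ l * f + (1 - l) * M.Tlow d y at p0
  change 0 ≤ l * f + (1 - l) * M.Thigh d y at p4
  rw [hcop _ p0 p1, hcop _ p4 p5]
  exact ⟨⟨p2, p3⟩, p6, p7⟩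

end FuzzyDiD

/-! ### Bounds on cdfs, means and quantiles among switchers -/

lemma SubCdf.cdfOnInterval {F : ℝ → ℝ} (h : SubCdf F) (a b : EReal) :
    SubCdf (cdfOnInterval a b F) where
  mono x y hxy := by
    have hxy' : (x : EReal) ≤ y := EReal.coe_le_coe_iff.2 hxy
    unfold _root_.cdfOnInterval
    split_ifs with h1 h2 h3 h4 h5 h6 h7
    · exact le_rfl
    · exact zero_le_one
    · exact h.nonneg y
    · exact absurd (hxy'.trans_lt h5) h1
    · exact le_rfl
    · exact absurd (h4.trans hxy') h6
    · exact absurd (hxy'.trans_lt h7) h1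
    · exact h.le_one x
    · exact h.mono hxy
  nonneg y := by
    unfold _root_.cdfOnInterval
    split_ifs
    · exact le_rfl
    · exact zero_le_one
    · exact h.nonneg y
  le_one y := by
    unfold _root_.cdfOnInterval
    split_ifs
    · exact zero_le_one
    · exact le_rfl
    · exact h.le_one y

lemma SubCdf.iInf_eq_zero_of_le {F G : ℝ → ℝ} (h : SubCdf F) (hG : Tendsto G atBot (𝓝 0))
    (hle : ∀ᶠ y in atBot, F y ≤ G y) : ⨅ y, F y = 0 := by
  refine le_antisymm (ge_of_tendsto hG ?_) h.iInf_nonneg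
  filter_upwards [hle] with y hy
  exact (ciInf_le h.bddBelow y).trans hy

lemma SubCdf.iSup_eq_one_of_le {F G : ℝ → ℝ} (h : SubCdf F) (hG : Tendsto G atTop (𝓝 1))
    (hle : ∀ᶠ y in atTop, G y ≤ F y) : ⨆ y, F y = 1 := by
  refine le_antisymm h.iSup_le_one (le_of_tendsto hG ?_)
  filter_upwards [hle] with y hy
  exact hy.trans (le_ciSup h.bddAbove y)

lemma tendsto_real_Iic_atTop (μ : Measure ℝ) [IsProbabilityMeasure μ] :
    Tendsto (fun y => μ.real (Set.Iic y)) atTop (𝓝 1) := by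
  have hcdf : (fun x => μ.real (Set.Iic x)) = cdf μ := by ext x; rw [cdf_eq_real]
  exact hcdf ▸ tendsto_cdf_atTop μ

lemma tendsto_real_Iic_atBot (μ : Measure ℝ) [IsProbabilityMeasure μ] :
    Tendsto (fun y => μ.real (Set.Iic y)) atBot (𝓝 0) := by
  have hcdf : (fun x => μ.real (Set.Iic x)) = cdf μ := by ext x; rw [cdf_eq_real]
  exact hcdf ▸ tendsto_cdf_atBot μ

lemma genInv_anti {F G : ℝ → ℝ} (h : ∀ y, F y ≤ G y) (q : ℝ) : genInv G q ≤ genInv F q :=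
  sInf_le_sInf (Set.image_mono fun y (hy : q ≤ F y) => hy.trans (h y))

lemma cdfAt_mem {F : ℝ → ℝ} (h : ∀ y, 0 ≤ F y ∧ F y ≤ 1) (x : EReal) :
    0 ≤ cdfAt F x ∧ cdfAt F x ≤ 1 := by
  unfold cdfAt
  split_ifs
  · exact ⟨le_rfl, zero_le_one⟩
  · exact ⟨zero_le_one, le_rfl⟩
  · exact h _

namespace FuzzyDiD

variable {M : FuzzyDiD.{u}}

variable (M) in
/-- The standing assumptions of the theorem. -/
structure Standing : Prop where
  part : M.Participation
  first : M.FirstStage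
  rate_mem : ∀ t, 0 < M.rate 1 0 t ∧ M.rate 1 0 t < 1
  change : M.rate 1 0 1 ≠ M.rate 1 0 0

lemma Standing.isProb (hS : M.Standing) (d : Fin 2) : IsProbabilityMeasure (M.switLaw d) :=
  hS.part.isProbabilityMeasure_switLaw hS.first d

lemma Standing.cop (hS : M.Standing) (hM : M.MonotoneInvariant) (hD : M.DataRestrictions)
    (d : Fin 2) (y : ℝ) :
    (0 ≤ M.Cop d (M.Tlow d) y ∧ M.Cop d (M.Tlow d) y ≤ M.switcherCdf d y) ∧
      M.switcherCdf d y ≤ M.Cop d (M.Thigh d) y ∧ M.Cop d (M.Thigh d) y ≤ 1 :=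
  cop_bounds hS.part hS.first hS.rate_mem hS.change hM hD d y

lemma switcherCdf_mono (d : Fin 2) : Monotone (M.switcherCdf d) := fun _ _ hxy =>
  measureReal_mono fun _ hω => le_trans hω hxy

lemma switcherCdf_le_one (d : Fin 2) (y : ℝ) : M.switcherCdf d y ≤ 1 := measureReal_le_one

lemma switcherCdf_nonneg (d : Fin 2) (y : ℝ) : 0 ≤ M.switcherCdf d y := measureReal_nonneg

section Bounds

variable (hS : M.Standing) (hM : M.MonotoneInvariant) (hD : M.DataRestrictions)
include hS hM hD

/-- The CIC bounds on the cdf among switchers. -/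
theorem cic_bounds (d : Fin 2) (y : ℝ) :
    M.cicLow d y ≤ M.switcherCdf d y ∧ M.switcherCdf d y ≤ M.cicHigh d y := by
  constructor
  · refine csSup_le ⟨_, y, le_refl y, rfl⟩ ?_
    rintro _ ⟨x, hx, rfl⟩
    exact (hS.cop hM hD d x).1.2.trans (switcherCdf_mono d hx)
  · refine le_csInf ⟨_, y, le_refl y, rfl⟩ ?_
    rintro _ ⟨x, hx, rfl⟩
    exact (switcherCdf_mono d hx).trans (hS.cop hM hD d x).2.1

lemma subCdf_cicLow (d : Fin 2) : SubCdf (M.cicLow d) := by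
  have hb : ∀ s, BddAbove (M.Cop d (M.Tlow d) '' s) := fun s => ⟨1, by
    rintro _ ⟨x, hx, rfl⟩
    exact (hS.cop hM hD d x).1.2.trans (switcherCdf_le_one d x)⟩
  exact ⟨fun x y hxy => csSup_le_csSup (hb _) ⟨_, x, le_refl x, rfl⟩
      (Set.image_mono (Set.Iic_subset_Iic.2 hxy)),
    fun y => (hS.cop hM hD d y).1.1.trans (le_csSup (hb _) ⟨y, le_refl y, rfl⟩),
    fun y => (cic_bounds hS hM hD d y).1.trans (switcherCdf_le_one d y)⟩

lemma subCdf_cicHigh (d : Fin 2) : SubCdf (M.cicHigh d) := by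
  have hb : ∀ s, BddBelow (M.Cop d (M.Thigh d) '' s) := fun s => ⟨0, by
    rintro _ ⟨x, hx, rfl⟩
    exact (switcherCdf_nonneg d x).trans (hS.cop hM hD d x).2.1⟩
  exact ⟨fun x y hxy => csInf_le_csInf (hb _) ⟨_, y, le_refl y, rfl⟩
      (Set.image_mono (Set.Ici_subset_Ici.2 hxy)),
    fun y => (switcherCdf_nonneg d y).trans (cic_bounds hS hM hD d y).2,
    fun y => (csInf_le (hb _) ⟨y, le_refl y, rfl⟩).trans (hS.cop hM hD d y).2.2⟩

lemma cop_le_cicLow (d : Fin 2) (y : ℝ) : M.Cop d (M.Tlow d) y ≤ M.cicLow d y :=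
  le_csSup ⟨1, by
    rintro _ ⟨x, hx, rfl⟩
    exact (hS.cop hM hD d x).1.2.trans (switcherCdf_le_one d x)⟩ ⟨y, le_refl y, rfl⟩

lemma cicHigh_le_cop (d : Fin 2) (y : ℝ) : M.cicHigh d y ≤ M.Cop d (M.Thigh d) y :=
  csInf_le ⟨0, by
    rintro _ ⟨x, hx, rfl⟩
    exact (switcherCdf_nonneg d x).trans (hS.cop hM hD d x).2.1⟩ ⟨y, le_refl y, rfl⟩

lemma subCdf_cicLowOn (d : Fin 2) : SubCdf (M.cicLowOn d) :=
  (subCdf_cicLow hS hM hD d).cdfOnInterval M.yLow M.yHigh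

lemma subCdf_cicHighOn (d : Fin 2) : SubCdf (M.cicHighOn d) :=
  (subCdf_cicHigh hS hM hD d).cdfOnInterval M.yLow M.yHigh

omit hS hM hD in
lemma switcherCdf_eq_zero (hB : M.OutcomesInBounds) {d : Fin 2} {y : ℝ}
    (hy : (y : EReal) < M.yLow) : M.switcherCdf d y = 0 := by
  rw [switcherCdf, condCdf, measureReal_def, measure_eq_zero_iff_ae_notMem.2, ENNReal.toReal_zero]
  filter_upwards [ae_cond_of_ae (hB d) M.switchers] with ω hω h
  exact absurd (hω.1.trans (EReal.coe_le_coe_iff.2 h)) (not_le.2 hy)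

omit hM hD in
lemma switcherCdf_eq_one (hB : M.OutcomesInBounds) {d : Fin 2} {y : ℝ}
    (hy : M.yHigh ≤ (y : EReal)) : M.switcherCdf d y = 1 := by
  have := hS.part.isProbabilityMeasure_cond_switchers hS.first
  refine real_eq_one_of_ae ?_
  filter_upwards [ae_cond_of_ae (hB d) M.switchers] with ω hω
  exact EReal.coe_le_coe_iff.1 (hω.2.trans hy)

/-- The CIC bounds on the cdf among switchers, on the support of the outcome. -/
lemma cicOn_bounds (hB : M.OutcomesInBounds) (d : Fin 2) (y : ℝ) :
    M.cicLowOn d y ≤ M.switcherCdf d y ∧ M.switcherCdf d y ≤ M.cicHighOn d y := by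
  rw [cicLowOn, cicHighOn, cdfOnInterval, cdfOnInterval]
  split_ifs with h1 h2
  · rw [switcherCdf_eq_zero hB h1]; exact ⟨le_rfl, le_rfl⟩
  · rw [switcherCdf_eq_one hS hB h2]; exact ⟨le_rfl, le_rfl⟩
  · exact cic_bounds hS hM hD d y

omit hM hD in
lemma tendsto_switcherCdf (d : Fin 2) :
    Tendsto (M.switcherCdf d) atBot (𝓝 0) ∧ Tendsto (M.switcherCdf d) atTop (𝓝 1) := by
  have := hS.isProb d
  have e : M.switcherCdf d = fun y => (M.switLaw d).real (Set.Iic y) := funext (M.switcherCdf_eq d)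
  rw [e]
  exact ⟨tendsto_real_Iic_atBot _, tendsto_real_Iic_atTop _⟩

lemma iInf_cicLowOn (hB : M.OutcomesInBounds) (d : Fin 2) : ⨅ y, M.cicLowOn d y = 0 :=
  (subCdf_cicLowOn hS hM hD d).iInf_eq_zero_of_le (tendsto_switcherCdf hS d).1
    (Eventually.of_forall fun y => (cicOn_bounds hS hM hD hB d y).1)

lemma iSup_cicHighOn (hB : M.OutcomesInBounds) (d : Fin 2) : ⨆ y, M.cicHighOn d y = 1 :=
  (subCdf_cicHighOn hS hM hD d).iSup_eq_one_of_le (tendsto_switcherCdf hS d).2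
    (Eventually.of_forall fun y => (cicOn_bounds hS hM hD hB d y).2)

omit hS hM hD in
lemma H_mem (d : Fin 2) (u : ℝ) : 0 ≤ M.H d u ∧ M.H d u ≤ 1 :=
  cdfAt_mem (fun _ => ⟨measureReal_nonneg, measureReal_le_one⟩) _

omit hS hM hD in
variable (M) in
lemma eventually_yLow_le : ∀ᶠ y : ℝ in atTop, M.yLow ≤ y := by
  obtain ⟨s, hs⟩ := M.suppY_nonempty
  filter_upwards [eventually_ge_atTop s] with y hy
  exact (sInf_le (Set.mem_image_of_mem _ hs)).trans (EReal.coe_le_coe_iff.2 hy)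

omit hS hM hD in
variable (M) in
lemma eventually_lt_yHigh : ∀ᶠ y : ℝ in atBot, (y : EReal) < M.yHigh := by
  obtain ⟨s, hs⟩ := M.suppY_nonempty
  filter_upwards [eventually_lt_atBot s] with y hy
  exact (EReal.coe_lt_coe_iff.2 hy).trans_le (le_sSup (Set.mem_image_of_mem _ hs))

omit hM hD in
lemma rate_one_pos : 0 < M.rate 1 1 1 := (M.rate_nonneg 1 1 0).trans_lt hS.first.1

/-- For `d = 1` treatment becomes more frequent, so the denominator of `C_1` is positive; `H_1 ≤ 1`
then bounds `C_1` below by a function of `F_{111}` that tends to `1`. For `d = 0` the denominator is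
negative and mass may be missing at the top. -/
lemma iSup_cicLowOn_one : ⨆ y, M.cicLowOn 1 y = 1 := by
  have hpos : 0 < M.rate 1 1 1 - M.rate 1 1 0 := sub_pos.2 hS.first.1
  have := isProbabilityMeasure_cellLaw (rate_one_pos hS)
  refine (subCdf_cicLowOn hS hM hD 1).iSup_eq_one_of_le
    (G := fun y => (M.rate 1 1 1 * M.F 1 1 1 y - M.rate 1 1 0) / (M.rate 1 1 1 - M.rate 1 1 0))
    ?_ ?_
  · have h1 : Tendsto (M.F 1 1 1) atTop (𝓝 1) := by
      rw [funext (M.F_eq 1 1 1)]; exact tendsto_real_Iic_atTop _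
    have h2 := ((h1.const_mul (M.rate 1 1 1)).sub_const (M.rate 1 1 0)).div_const
      (M.rate 1 1 1 - M.rate 1 1 0)
    rwa [mul_one, div_self hpos.ne'] at h2
  · filter_upwards [M.eventually_yLow_le] with y hy
    rw [cicLowOn, cdfOnInterval, if_neg (not_lt.2 hy)]
    have hF : M.F 1 1 1 y ≤ 1 := measureReal_le_one
    split_ifs
    · rw [div_le_one hpos]
      nlinarith [rate_one_pos hS]
    · refine le_trans ?_ (cop_le_cicLow hS hM hD 1 y)
      rw [Cop]
      have := M.H_mem 1 (M.Gop 1 (M.Tlow 1) y)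
      have := M.rate_nonneg 1 1 0
      exact div_le_div_of_nonneg_right (by nlinarith) hpos.le

lemma iInf_cicHighOn_one : ⨅ y, M.cicHighOn 1 y = 0 := by
  have hpos : 0 < M.rate 1 1 1 - M.rate 1 1 0 := sub_pos.2 hS.first.1
  have := isProbabilityMeasure_cellLaw (rate_one_pos hS)
  refine (subCdf_cicHighOn hS hM hD 1).iInf_eq_zero_of_le
    (G := fun y => (M.rate 1 1 1 * M.F 1 1 1 y) / (M.rate 1 1 1 - M.rate 1 1 0))
    ?_ ?_
  · have h1 : Tendsto (M.F 1 1 1) atBot (𝓝 0) := by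
      rw [funext (M.F_eq 1 1 1)]; exact tendsto_real_Iic_atBot _
    have h2 := (h1.const_mul (M.rate 1 1 1)).div_const (M.rate 1 1 1 - M.rate 1 1 0)
    rwa [mul_zero, zero_div] at h2
  · filter_upwards [M.eventually_lt_yHigh] with y hy
    rw [cicHighOn, cdfOnInterval, if_neg (not_le.2 hy)]
    have hF : 0 ≤ M.F 1 1 1 y := measureReal_nonneg
    split_ifs
    · exact div_nonneg (mul_nonneg (M.rate_nonneg _ _ _) hF) hpos.le
    · refine (cicHigh_le_cop hS hM hD 1 y).trans ?_
      rw [Cop]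
      have := M.H_mem 1 (M.Gop 1 (M.Thigh 1) y)
      have := M.rate_nonneg 1 1 0
      exact div_le_div_of_nonneg_right (by nlinarith) hpos.le

omit hM hD in
/-- Integrability among switchers from tail integrals. -/
lemma integrable_iff_tails (d : Fin 2) (c : ℝ) :
    Integrable (M.Y d) (cond M.P M.switchers) ↔
      upT c (M.switcherCdf d) < ⊤ ∧ loT c (M.switcherCdf d) < ⊤ := by
  have := hS.isProb d
  rw [funext (M.switcherCdf_eq d), ← integrable_id_iff_upT_loT, switLaw,
    integrable_map_measure (by fun_prop) (M.measurable_Y d).aemeasurable]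
  rfl

omit hS hM hD in
lemma condE_eq (d : Fin 2) : M.condE M.switchers (M.Y d) = ∫ y, y ∂(M.switLaw d) := by
  rw [switLaw, integral_map (M.measurable_Y d).aemeasurable (by fun_prop)]
  rfl

omit hS hM hD in
lemma late_eq (h1 : Integrable (M.Y 1) (cond M.P M.switchers))
    (h0 : Integrable (M.Y 0) (cond M.P M.switchers)) :
    (M.late : EReal)
      = ((∫ y, y ∂(M.switLaw 1) : ℝ) : EReal) - ((∫ y, y ∂(M.switLaw 0) : ℝ) : EReal) := by
  rw [← EReal.coe_sub, ← condE_eq, ← condE_eq, late, condE, integral_sub h1 h0]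
  rfl

/-- The CIC bounds on the effect among switchers. -/
theorem cic_late (hB : M.OutcomesInBounds) (hE : M.MomentsExist) :
    Integrable (M.Y 1) (cond M.P M.switchers) ∧
    (M.wCicLow ≠ ⊥ → M.wCicHigh ≠ ⊤ → Integrable (M.Y 0) (cond M.P M.switchers)) ∧
    (Integrable (M.Y 0) (cond M.P M.switchers) →
      M.wCicLow ≤ (M.late : EReal) ∧ (M.late : EReal) ≤ M.wCicHigh) := by
  have sL := subCdf_cicLowOn hS hM hD
  have sH := subCdf_cicHighOn hS hM hD
  have hle := cicOn_bounds hS hM hD hB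
  have I1 : Integrable (M.Y 1) (cond M.P M.switchers) := by
    -- For `d = 1` neither bound loses mass, so the moment condition makes the relevant tail
    -- integral of each finite.
    rw [integrable_iff_tails hS 1 0]
    exact ⟨(upT_anti fun y => (hle 1 y).1).trans_lt
        ((sL 1).upT_lt_top 0 (hE 1).2 (iSup_cicLowOn_one hS hM hD)),
      (loT_mono fun y => (hle 1 y).2).trans_lt
        ((sH 1).loT_lt_top 0 (hE 1).1 (iInf_cicHighOn_one hS hM hD))⟩
  refine ⟨I1, fun hl hh => ?_, fun I0 => ?_⟩
  -- For `d = 0` a tail of a bound may be infinite, but it would show in the bounds on `Δ`: an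
  -- infinite upper tail of the lower cdf forces `wCicLow = ⊥`. An infinite lower tail of the upper
  -- cdf forces `wCicHigh = ⊤`, because the mean subtracted from is finite.
  · rw [integrable_iff_tails hS 0 0]
    refine ⟨(upT_anti fun y => (hle 0 y).1).trans_lt (lt_top_iff_ne_top.2 fun h => hl ?_),
      (loT_mono fun y => (hle 0 y).2).trans_lt (lt_top_iff_ne_top.2 fun h => hh ?_)⟩
    · have h2 := ((sL 0).loT_lt_top 0 (hE 0).2 (iInf_cicLowOn hS hM hD hB 0)).ne
      rw [wCicLow, (sL 0).extMean_eq 0 (hE 0).2, h, ← EReal.coe_ennreal_toReal h2]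
      simp
    · have h2 := ((sL 1).loT_lt_top 0 (hE 1).2 (iInf_cicLowOn hS hM hD hB 1)).ne
      have h3 := ((sL 1).upT_lt_top 0 (hE 1).2 (iSup_cicLowOn_one hS hM hD)).ne
      rw [wCicHigh, (sH 0).extMean_eq 0 (hE 0).1, h, (sL 1).extMean_eq 0 (hE 1).2,
        ← EReal.coe_ennreal_toReal h2, ← EReal.coe_ennreal_toReal h3, ← EReal.coe_add,
        ← EReal.coe_sub]
      have e : ((0 : ℝ) : EReal) + (upT 0 (M.cicHighOn 0) : EReal) - ((⊤ : ENNReal) : EReal) = ⊥ := by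
        simp
      rw [e]
      exact EReal.coe_sub_bot _
  · rw [late_eq I1 I0]
    have := hS.isProb
    have J : ∀ d, Integrable (M.Y d) (cond M.P M.switchers) →
        Integrable (fun y : ℝ => y) (M.switLaw d) := by
      intro d h
      rw [switLaw, integrable_map_measure (by fun_prop) (M.measurable_Y d).aemeasurable]
      exact h
    have hle' : ∀ d y, M.cicLowOn d y ≤ (M.switLaw d).real (Set.Iic y) ∧
        (M.switLaw d).real (Set.Iic y) ≤ M.cicHighOn d y := by
      intro d y
      rw [← switcherCdf_eq]; exact hle d y
    exact ⟨EReal.sub_le_sub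
        (extMean_le_integral _ (sH 1) (J 1 I1) (hE 1).1 fun y => (hle' 1 y).2)
        (integral_le_extMean _ (sL 0) (J 0 I0) (hE 0).2 fun y => (hle' 0 y).1),
      EReal.sub_le_sub
        (integral_le_extMean _ (sL 1) (J 1 I1) (hE 1).2 fun y => (hle' 1 y).1)
        (extMean_le_integral _ (sH 0) (J 0 I0) (hE 0).1 fun y => (hle' 0 y).2)⟩

/-- Bounds on the quantiles among switchers. -/
lemma genInv_bounds (hB : M.OutcomesInBounds) (d : Fin 2) {q : ℝ} (hq : q ∈ Set.Ioo (0 : ℝ) 1) :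
    max (genInv (M.cicHigh d) q) M.yLow ≤ genInv (M.switcherCdf d) q ∧
      genInv (M.switcherCdf d) q ≤ min (genInv (M.cicLow d) q) M.yHigh := by
  refine ⟨max_le (genInv_anti (fun y => (cic_bounds hS hM hD d y).2) q) ?_,
    le_min (genInv_anti (fun y => (cic_bounds hS hM hD d y).1) q) ?_⟩
  · refine le_sInf ?_
    rintro _ ⟨x, hx, rfl⟩
    by_contra h
    have h1 : q ≤ M.switcherCdf d x := hx
    rw [switcherCdf_eq_zero hB (not_le.1 h)] at h1
    exact absurd hq.1 (not_lt.2 h1)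
  · refine EReal.le_of_forall_lt_iff_le.1 fun z hz => sInf_le ⟨z, ?_, rfl⟩
    change q ≤ M.switcherCdf d z
    rw [switcherCdf_eq_one hS hB hz.le]
    exact hq.2.le

/-- The CIC bounds on the quantile treatment effects among switchers. -/
theorem cic_lqte (hB : M.OutcomesInBounds) {q : ℝ} (hq : q ∈ Set.Ioo (0 : ℝ) 1) :
    M.tauLow q ≤ M.lqte q ∧ M.lqte q ≤ M.tauHigh q :=
  ⟨EReal.sub_le_sub (genInv_bounds hS hM hD hB 1 hq).1 (genInv_bounds hS hM hD hB 0 hq).2,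
    EReal.sub_le_sub (genInv_bounds hS hM hD hB 1 hq).2 (genInv_bounds hS hM hD hB 0 hq).1⟩

end Bounds

end FuzzyDiD

/-! ### Increment constraints and feasible cdfs -/

lemma continuous_M01 : Continuous M01 := by unfold M01; fun_prop

/-- A continuous function that is nondecreasing on `I`, and constant below and above `I`, is
nondecreasing. -/
lemma RegCdf.monotone_of_monotoneOn {I : Set ℝ} {f T : ℝ → ℝ} (hf : RegCdf I f) (hT : Continuous T)
    (hm : MonotoneOn T I) (h0 : ∀ x y, f x = 0 → f y = 0 → T x = T y)
    (h1 : ∀ x y, f x = 1 → f y = 1 → T x = T y) : Monotone T := by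
  have case0 : ∀ x, f x = 0 → ∀ y ∈ I, T x ≤ T y := by
    intro x hx y hy
    have hxy : x < y := lt_of_not_ge fun h => by
      have := hf.mono h
      linarith [((hf.mem_iff y).1 hy).1]
    have hcl : IsClosed {z | z ≤ y ∧ f z = 0} :=
      (isClosed_le continuous_id continuous_const).inter (isClosed_eq hf.cont continuous_const)
    have hbd : BddAbove {z | z ≤ y ∧ f z = 0} := ⟨y, fun z hz => hz.1⟩
    obtain ⟨hm1, hm2⟩ := hcl.csSup_mem ⟨x, hxy.le, hx⟩ hbd
    -- The last zero of `f` before `y`. Just to the right of `m` one is in `I`, where `T` is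
    -- nondecreasing; continuity at `m` and constancy of `T` on the zeros of `f` carry the
    -- inequality to `x`.
    set m := sSup {z | z ≤ y ∧ f z = 0}
    have hmy : m < y := lt_of_le_of_ne hm1 fun h => by
      rw [h] at hm2; exact ((hf.mem_iff y).1 hy).1.ne' hm2
    rw [h0 x m hx hm2]
    refine le_of_tendsto (hT.continuousWithinAt (s := Set.Ioi m) (x := m)) ?_
    filter_upwards [Ioo_mem_nhdsGT hmy] with z hz
    refine hm ((hf.mem_iff z).2 ⟨lt_of_le_of_ne (hf.nonneg z) fun h => ?_, ?_⟩) hy hz.2.le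
    · exact absurd (le_csSup hbd ⟨hz.2.le, h.symm⟩) (not_le.2 hz.1)
    · exact (hf.mono hz.2.le).trans_lt ((hf.mem_iff y).1 hy).2
  have case1 : ∀ x ∈ I, ∀ y, f y = 1 → T x ≤ T y := by
    intro x hx y hy
    have hxy : x < y := lt_of_not_ge fun h => by
      have := hf.mono h
      linarith [((hf.mem_iff x).1 hx).2]
    have hcl : IsClosed {z | x ≤ z ∧ f z = 1} :=
      (isClosed_le continuous_const continuous_id).inter (isClosed_eq hf.cont continuous_const)
    have hbd : BddBelow {z | x ≤ z ∧ f z = 1} := ⟨x, fun z hz => hz.1⟩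
    obtain ⟨hm1, hm2⟩ := hcl.csInf_mem ⟨y, hxy.le, hy⟩ hbd
    set m := sInf {z | x ≤ z ∧ f z = 1}
    have hmx : x < m := lt_of_le_of_ne hm1 fun h => by
      rw [← h] at hm2; exact ((hf.mem_iff x).1 hx).2.ne hm2
    rw [h1 y m hy hm2]
    refine ge_of_tendsto (hT.continuousWithinAt (s := Set.Iio m) (x := m)) ?_
    filter_upwards [Ioo_mem_nhdsLT hmx] with z hz
    refine hm hx ((hf.mem_iff z).2 ⟨?_, lt_of_le_of_ne (hf.le_one z) fun h => ?_⟩) hz.1.le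
    · exact ((hf.mem_iff x).1 hx).1.trans_le (hf.mono hz.1.le)
    · exact absurd (csInf_le hbd ⟨hz.1.le, h⟩) (not_le.2 hz.2)
  intro x y hxy
  by_cases hx : x ∈ I
  · by_cases hy : y ∈ I
    · exact hm hx hy hxy
    · rcases hf.eq_zero_or_one hy with h | h
      · exact absurd (hf.mono hxy) (not_le.2 (h ▸ ((hf.mem_iff x).1 hx).1))
      · exact case1 x hx y h
  · rcases hf.eq_zero_or_one hx with h | h
    · by_cases hy : y ∈ I
      · exact case0 x h y hy
      · rcases hf.eq_zero_or_one hy with h' | h'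
        · exact (h0 x y h h').le
        · obtain ⟨z, hz⟩ := hf.nonempty
          exact (case0 x h z hz).trans (case1 z hz y h')
    · exact (h1 x y h (le_antisymm (hf.le_one y) (h ▸ hf.mono hxy))).le

/-- `(Φ - l f) / (1 - l)`. -/
def unmix (l : ℝ) (f Φ : ℝ → ℝ) (y : ℝ) : ℝ := (Φ y - l * f y) / (1 - l)

/-- Monotonicity of the implied switcher cdf is a constraint on the increments of `Φ`: they are at
least those of `l f` if `l < 1`, and at most those of `l f` if `l > 1`. In this form it survives
maxima and minima. -/
lemma unmix_mono_of_lt {l : ℝ} (hl : l < 1) {f Φ : ℝ → ℝ} :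
    Monotone (unmix l f Φ) ↔ ∀ x y, x ≤ y → l * (f y - f x) ≤ Φ y - Φ x := by
  have h : 0 < 1 - l := sub_pos.2 hl
  refine forall₂_congr fun x y => forall_congr' fun _ => ?_
  rw [unmix, unmix, div_le_div_iff_of_pos_right h]
  constructor <;> intro h <;> linarith

lemma unmix_mono_of_gt {l : ℝ} (hl : 1 < l) {f Φ : ℝ → ℝ} :
    Monotone (unmix l f Φ) ↔ ∀ x y, x ≤ y → Φ y - Φ x ≤ l * (f y - f x) := by
  have h : 1 - l < 0 := sub_neg.2 hl
  refine forall₂_congr fun x y => forall_congr' fun _ => ?_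
  rw [unmix, unmix, div_le_div_right_of_neg h]
  constructor <;> intro h <;> linarith

/-- An increment of a maximum is at least the increment of the function that attains it at the left
end, and at most that of the function that attains it at the right end. Each sign of `1 - l` needs
one of these. -/
lemma unmix_mono_max {l : ℝ} (hl : l ≠ 1) {f Φ Ψ : ℝ → ℝ} (h1 : Monotone (unmix l f Φ))
    (h2 : Monotone (unmix l f Ψ)) : Monotone (unmix l f fun y => max (Φ y) (Ψ y)) := by
  rcases lt_or_gt_of_ne hl with hl | hl
  · rw [unmix_mono_of_lt hl] at h1 h2 ⊢
    intro x y hxy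
    have a := h1 x y hxy
    have b := h2 x y hxy
    rcases max_cases (Φ x) (Ψ x) with h | h <;> rw [h.1]
    · linarith [le_max_left (Φ y) (Ψ y)]
    · linarith [le_max_right (Φ y) (Ψ y)]
  · rw [unmix_mono_of_gt hl] at h1 h2 ⊢
    intro x y hxy
    have a := h1 x y hxy
    have b := h2 x y hxy
    rcases max_cases (Φ y) (Ψ y) with h | h <;> rw [h.1]
    · linarith [le_max_left (Φ x) (Ψ x)]
    · linarith [le_max_right (Φ x) (Ψ x)]

lemma unmix_mono_min {l : ℝ} (hl : l ≠ 1) {f Φ Ψ : ℝ → ℝ} (h1 : Monotone (unmix l f Φ))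
    (h2 : Monotone (unmix l f Ψ)) : Monotone (unmix l f fun y => min (Φ y) (Ψ y)) := by
  rcases lt_or_gt_of_ne hl with hl | hl
  · rw [unmix_mono_of_lt hl] at h1 h2 ⊢
    intro x y hxy
    have a := h1 x y hxy
    have b := h2 x y hxy
    rcases min_cases (Φ y) (Ψ y) with h | h <;> rw [h.1]
    · linarith [min_le_left (Φ x) (Ψ x)]
    · linarith [min_le_right (Φ x) (Ψ x)]
  · rw [unmix_mono_of_gt hl] at h1 h2 ⊢
    intro x y hxy
    have a := h1 x y hxy
    have b := h2 x y hxy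
    rcases min_cases (Φ x) (Ψ x) with h | h <;> rw [h.1]
    · linarith [min_le_left (Φ y) (Ψ y)]
    · linarith [min_le_right (Φ y) (Ψ y)]

/-- The monotonicity constraints on the cdf `Φ` of the stayers of the control group: the implied
cdfs of the switchers in both groups are nondecreasing. -/
structure Slopes (f g : ℝ → ℝ) (e : ℝ ≃o ℝ) (l l' : ℝ) (Φ : ℝ → ℝ) : Prop where
  K : Monotone (unmix l f Φ)
  C : Monotone (unmix l' g fun y => e (Φ y))

/-- The constraint on `C` bears on `e ∘ Φ`, and an increasing `e` commutes with maxima. This lattice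
property is the tool for repairing the bounds without losing the constraints. -/
lemma Slopes.max {f g : ℝ → ℝ} {e : ℝ ≃o ℝ} {l l' : ℝ} (hl : l ≠ 1) (hl' : l' ≠ 1) {Φ Ψ : ℝ → ℝ}
    (h1 : Slopes f g e l l' Φ) (h2 : Slopes f g e l l' Ψ) :
    Slopes f g e l l' fun y => max (Φ y) (Ψ y) :=
  ⟨unmix_mono_max hl h1.K h2.K, by
    simp_rw [e.monotone.map_max]; exact unmix_mono_max hl' h1.C h2.C⟩

lemma Slopes.min {f g : ℝ → ℝ} {e : ℝ ≃o ℝ} {l l' : ℝ} (hl : l ≠ 1) (hl' : l' ≠ 1) {Φ Ψ : ℝ → ℝ}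
    (h1 : Slopes f g e l l' Φ) (h2 : Slopes f g e l l' Ψ) :
    Slopes f g e l l' fun y => min (Φ y) (Ψ y) :=
  ⟨unmix_mono_min hl h1.K h2.K, by
    simp_rw [e.monotone.map_min]; exact unmix_mono_min hl' h1.C h2.C⟩

/-- A cdf `Φ` for the stayers of the control group that is compatible with the data. -/
structure Feasible (I : Set ℝ) (f g : ℝ → ℝ) (e : ℝ ≃o ℝ) (l l' : ℝ) (Φ : ℝ → ℝ) : Prop where
  reg : RegCdf I Φ
  slopes : Slopes f g e l l' Φ

lemma RegCdf.of_comparison {I : Set ℝ} {f Φ : ℝ → ℝ} (hf : RegCdf I f) (hc : Continuous Φ)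
    (hs : StrictMonoOn Φ I) (h0 : ∀ y, f y = 0 → Φ y = 0) (h1 : ∀ y, f y = 1 → Φ y = 1)
    (hb : Tendsto Φ atBot (𝓝 0)) (ht : Tendsto Φ atTop (𝓝 1)) : RegCdf I Φ := by
  have hm : Monotone Φ := hf.monotone_of_monotoneOn hc hs.monotoneOn
    (fun x y hx hy => by rw [h0 x hx, h0 y hy]) (fun x y hx hy => by rw [h1 x hx, h1 y hy])
  refine ⟨hc, hm, hs, fun x => ⟨fun hx => ?_, fun h => ?_⟩, hb, ht⟩
  · obtain ⟨ε, hε, hball⟩ := Metric.isOpen_iff.1 hf.isOpen x hx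
    have m1 : x - ε / 2 ∈ I := hball (by simpa [abs_of_pos hε] using hε)
    have m2 : x + ε / 2 ∈ I := hball (by simpa [abs_of_pos hε] using hε)
    exact ⟨(hm.le_of_tendsto hb _).trans_lt (hs m1 hx (by linarith)),
      (hs hx m2 (by linarith)).trans_le (hm.ge_of_tendsto ht _)⟩
  · by_contra hx
    rcases hf.eq_zero_or_one hx with h2 | h2
    · exact h.1.ne' (h0 x h2)
    · exact h.2.ne (h1 x h2)

/-- The data entering the CIC bounds, and minorants of the cdfs and of the quantile-quantile
transform used to perturb the bounds. -/
structure CicData (I : Set ℝ) (f g : ℝ → ℝ) (e : ℝ ≃o ℝ) (l l' : ℝ) : Prop where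
  hf : RegCdf I f
  hg : RegCdf I g
  e0 : e 0 = 0
  e1 : e 1 = 1
  l_pos : 0 < l
  l_ne : l ≠ 1
  l'_nonneg : 0 ≤ l'
  l'_ne : l' ≠ 1
  exE : ∃ E : ℝ → ℝ, Continuous E ∧ StrictMonoOn E I ∧
    ∀ x y, x ≤ y → 0 ≤ E y - E x ∧ E y - E x ≤ f y - f x ∧ E y - E x ≤ g y - g x
  exZ : ∃ Z : ℝ ≃o ℝ, Z 0 = 0 ∧ ∀ u v, u ≤ v → Z v - Z u ≤ v - u ∧ Z v - Z u ≤ e v - e u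

/-- Scalar form of `T̲_d`. -/
def tLow (e : ℝ ≃o ℝ) (l l' a b : ℝ) : ℝ := M01 ((l * a - e.symm (M01 (l' * b))) / (l - 1))

/-- Scalar form of `T̅_d`. -/
def tHigh (e : ℝ ≃o ℝ) (l l' a b : ℝ) : ℝ :=
  M01 ((l * a - e.symm (M01 (l' * b + (1 - l')))) / (l - 1))

/-- Scalar form of `G_d(T̲_d)`. -/
def phiLow (e : ℝ ≃o ℝ) (l l' a b : ℝ) : ℝ := l * a + (1 - l) * tLow e l l' a b

/-- Scalar form of `G_d(T̅_d)`. -/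
def phiHigh (e : ℝ ≃o ℝ) (l l' a b : ℝ) : ℝ := l * a + (1 - l) * tHigh e l l' a b

/-- The function `C_d(T̲_d)`. -/
def cLow (f g : ℝ → ℝ) (e : ℝ ≃o ℝ) (l l' : ℝ) : ℝ → ℝ :=
  unmix l' g fun y => e (phiLow e l l' (f y) (g y))

/-- The function `C_d(T̅_d)`. -/
def cHigh (f g : ℝ → ℝ) (e : ℝ ≃o ℝ) (l l' : ℝ) : ℝ → ℝ :=
  unmix l' g fun y => e (phiHigh e l l' (f y) (g y))

/-- The slope constraints hold for the bounds. -/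
structure IncData (f g : ℝ → ℝ) (e : ℝ ≃o ℝ) (l l' : ℝ) : Prop where
  low : Slopes f g e l l' fun y => phiLow e l l' (f y) (g y)
  high : Slopes f g e l l' fun y => phiHigh e l l' (f y) (g y)

lemma continuous_phiLow (e : ℝ ≃o ℝ) (l l' : ℝ) :
    Continuous fun p : ℝ × ℝ => phiLow e l l' p.1 p.2 := by
  have h1 := e.symm.continuous
  have h2 := continuous_M01
  unfold phiLow tLow
  fun_prop

lemma continuous_phiHigh (e : ℝ ≃o ℝ) (l l' : ℝ) :
    Continuous fun p : ℝ × ℝ => phiHigh e l l' p.1 p.2 := by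
  have h1 := e.symm.continuous
  have h2 := continuous_M01
  unfold phiHigh tHigh
  fun_prop

/-- For `l > 1`, clamping `e⁻¹(M01 (l' b))` to the segment from `l a + 1 - l` to `l a`. All the
arguments are visibly nondecreasing in `a` and `b`. -/
lemma phiLow_eq_of_gt {e : ℝ ≃o ℝ} {l l' a b : ℝ} (hl : 1 < l) :
    phiLow e l l' a b = max (l * a + (1 - l)) (min (l * a) (e.symm (M01 (l' * b)))) := by
  have h : 0 < l - 1 := sub_pos.2 hl
  rw [phiLow, tLow]
  set θ := e.symm (M01 (l' * b))
  rcases le_total (l * a) θ with h1 | h1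
  · rw [M01_of_nonpos (div_nonpos_of_nonpos_of_nonneg (by linarith) h.le), min_eq_left h1,
      max_eq_right (by linarith)]
    ring
  · rw [min_eq_right h1]
    rcases le_total (l * a + (1 - l)) θ with h2 | h2
    · rw [max_eq_right h2, M01_of_mem (div_nonneg (by linarith) h.le)
        ((div_le_one h).2 (by linarith))]
      field_simp
      ring
    · rw [max_eq_left h2, M01_of_one_le ((one_le_div h).2 (by linarith))]
      ring

/-! ### Feasible sequences converging to the bounds -/

/-- A sequence of feasible cdfs approximating the lower bound. -/
def LowSeq (I : Set ℝ) (f g : ℝ → ℝ) (e : ℝ ≃o ℝ) (l l' : ℝ) : Prop :=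
  ∃ Φ : ℕ → ℝ → ℝ, (∀ k, Feasible I f g e l l' (Φ k)) ∧
    (∀ y ∈ I, Tendsto (fun k => unmix l' g (fun y => e (Φ k y)) y) atTop (𝓝 (cLow f g e l l' y))) ∧
    (∀ x ∈ I, ∀ x₀ ∈ I, x < x₀ → 0 < cLow f g e l l' x₀ →
      ∀ᶠ k in atTop, unmix l' g (fun y => e (Φ k y)) x ≤ cLow f g e l l' x₀) ∧
    (l < 1 → l' < 1 →
      (∀ c ∈ I, ∀ᶠ k in atTop, ∀ y ≤ c,
        unmix l' g (fun y => e (Φ k y)) y = cLow f g e l l' y) ∧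
      ∀ k, ∃ c ∈ I, ∀ y, c ≤ y → cHigh f g e l l' y ≤ unmix l' g (fun y => e (Φ k y)) y)

/-- A sequence of feasible cdfs approximating the upper bound. -/
def HighSeq (I : Set ℝ) (f g : ℝ → ℝ) (e : ℝ ≃o ℝ) (l l' : ℝ) : Prop :=
  ∃ Φ : ℕ → ℝ → ℝ, (∀ k, Feasible I f g e l l' (Φ k)) ∧
    (∀ y ∈ I, Tendsto (fun k => unmix l' g (fun y => e (Φ k y)) y) atTop (𝓝 (cHigh f g e l l' y))) ∧
    (∀ x ∈ I, ∀ x₀ ∈ I, x₀ < x → cHigh f g e l l' x₀ < 1 →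
      ∀ᶠ k in atTop, cHigh f g e l l' x₀ ≤ unmix l' g (fun y => e (Φ k y)) x) ∧
    (l < 1 → l' < 1 →
      (∀ c ∈ I, ∀ᶠ k in atTop, ∀ y, c ≤ y →
        unmix l' g (fun y => e (Φ k y)) y = cHigh f g e l l' y) ∧
      ∀ k, ∃ c ∈ I, ∀ y ≤ c, unmix l' g (fun y => e (Φ k y)) y ≤ cLow f g e l l' y)

namespace CicData

variable {I : Set ℝ} {f g : ℝ → ℝ} {e : ℝ ≃o ℝ} {l l' : ℝ} (h : CicData I f g e l l')
include h

lemma symm0 : e.symm 0 = 0 := by rw [OrderIso.symm_apply_eq, h.e0]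
lemma symm1 : e.symm 1 = 1 := by rw [OrderIso.symm_apply_eq, h.e1]

lemma symm_nonneg (q : ℝ) : 0 ≤ e.symm (M01 q) := by
  rw [e.le_symm_apply, h.e0]; exact M01_nonneg q

lemma symm_le_one (q : ℝ) : e.symm (M01 q) ≤ 1 := by
  rw [e.symm_apply_le, h.e1]; exact M01_le_one q

lemma phiLow_zero : phiLow e l l' 0 0 = 0 := by
  rw [phiLow, tLow, mul_zero, mul_zero, M01_of_nonpos le_rfl, h.symm0, sub_self, zero_div,
    M01_of_nonpos le_rfl]
  ring

/-- The hypothesis matters: if both ratios are below `1`, the value at the top is the larger of `l`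
and `e⁻¹(M01 l')`, which is less than `1`, and the bound leaves mass beyond the support. -/
lemma phiLow_one (hl : 1 < l ∨ 1 < l') : phiLow e l l' 1 1 = 1 := by
  rw [phiLow, tLow, mul_one, mul_one, M01_of_one_le]
  · ring
  · rcases hl with hl | hl
    · rw [one_le_div (by linarith)]
      linarith [h.symm_le_one l']
    · rw [M01_of_one_le hl.le, h.symm1, div_self (sub_ne_zero.2 h.l_ne)]

lemma phiHigh_one : phiHigh e l l' 1 1 = 1 := by
  rw [phiHigh, tHigh, mul_one, mul_one, M01_of_one_le (by linarith : 1 ≤ l' + (1 - l')), h.symm1,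
    div_self (sub_ne_zero.2 h.l_ne), M01_of_one_le le_rfl]
  ring

lemma continuous_low : Continuous fun y => phiLow e l l' (f y) (g y) :=
  (continuous_phiLow e l l').comp (h.hf.cont.prodMk h.hg.cont)

lemma continuous_high : Continuous fun y => phiHigh e l l' (f y) (g y) :=
  (continuous_phiHigh e l l').comp (h.hf.cont.prodMk h.hg.cont)

lemma tendsto_low_bot : Tendsto (fun y => phiLow e l l' (f y) (g y)) atBot (𝓝 0) := by
  have := ((continuous_phiLow e l l').tendsto (0, 0)).comp (h.hf.bot.prodMk_nhds h.hg.bot)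
  simp only [h.phiLow_zero] at this
  exact this

lemma tendsto_low_top (hl : 1 < l ∨ 1 < l') :
    Tendsto (fun y => phiLow e l l' (f y) (g y)) atTop (𝓝 1) := by
  have := ((continuous_phiLow e l l').tendsto (1, 1)).comp (h.hf.top.prodMk_nhds h.hg.top)
  simp only [h.phiLow_one hl] at this
  exact this

lemma tendsto_high_top : Tendsto (fun y => phiHigh e l l' (f y) (g y)) atTop (𝓝 1) := by
  have := ((continuous_phiHigh e l l').tendsto (1, 1)).comp (h.hf.top.prodMk_nhds h.hg.top)
  simp only [h.phiHigh_one] at this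
  exact this

lemma low_zero {y : ℝ} (hy : f y = 0) : phiLow e l l' (f y) (g y) = 0 := by
  rw [hy, h.hf.zero_of_zero h.hg hy, h.phiLow_zero]

lemma low_one (hl : 1 < l ∨ 1 < l') {y : ℝ} (hy : f y = 1) : phiLow e l l' (f y) (g y) = 1 := by
  rw [hy, h.hf.one_of_one h.hg hy, h.phiLow_one hl]

lemma high_one {y : ℝ} (hy : f y = 1) : phiHigh e l l' (f y) (g y) = 1 := by
  rw [hy, h.hf.one_of_one h.hg hy, h.phiHigh_one]

omit h in
lemma strictMonoOn_of_slope {I : Set ℝ} {f Φ : ℝ → ℝ} {l : ℝ} (hf : RegCdf I f) (h0 : 0 < l)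
    (hl : l < 1) (hK : Monotone (unmix l f Φ)) : StrictMonoOn Φ I := by
  rw [unmix_mono_of_lt hl] at hK
  intro x hx y hy hxy
  have := hK x y hxy.le
  nlinarith [hf.strict hx hy hxy]

omit h in
/-- If the limit is itself feasible, the constant sequence will do. -/
lemma lowSeq_const (hlim : ¬ (l < 1 ∧ l' < 1))
    (hΦ : Feasible I f g e l l' fun y => phiLow e l l' (f y) (g y)) : LowSeq I f g e l l' :=
  ⟨fun _ y => phiLow e l l' (f y) (g y), fun _ => hΦ, fun _ _ => tendsto_const_nhds,
    fun _ _ _ _ hx _ => Eventually.of_forall fun _ => hΦ.slopes.C hx.le,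
    fun h1 h2 => absurd ⟨h1, h2⟩ hlim⟩

/-- No perturbation is needed. With `l < 1` the increments of `Φ` are at least those of `l f`, so
`Φ` is strictly increasing, and `1 < l'` ensures that it reaches full mass. -/
lemma lowSeq_lt_gt (hI : IncData f g e l l') (hl : l < 1) (hl' : 1 < l') :
    LowSeq I f g e l l' :=
  lowSeq_const (fun h1 => absurd h1.2 (not_lt.2 hl'.le))
    ⟨h.hf.of_comparison h.continuous_low (strictMonoOn_of_slope h.hf h.l_pos hl hI.low.K)
      (fun _ => h.low_zero) (fun _ => h.low_one (Or.inr hl')) h.tendsto_low_bot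
      (h.tendsto_low_top (Or.inr hl')), hI.low⟩

/-- In the clamped form everything increases strictly, except `e⁻¹(M01 (l' g))` once it saturates at
`1`. Saturation is harmless while the clamped value is below `1`, and it cannot occur on `I` when
`l' ≤ 1`. -/
lemma low_lt_low (hl : 1 < l) (hl' : 0 < l') {x y : ℝ} (hx : x ∈ I) (hy : y ∈ I) (hxy : x < y)
    (h1 : phiLow e l l' (f x) (g x) < 1 ∨ l' ≤ 1) :
    phiLow e l l' (f x) (g x) < phiLow e l l' (f y) (g y) := by
  have hfxy := h.hf.strict hx hy hxy
  have hgxy := h.hg.strict hx hy hxy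
  have hgx := (h.hg.mem_iff x).1 hx
  have hgy := (h.hg.mem_iff y).1 hy
  rw [phiLow_eq_of_gt hl] at h1 ⊢
  rw [phiLow_eq_of_gt hl]
  refine max_lt_max (by nlinarith) ?_
  have hlf : l * f x < l * f y := mul_lt_mul_of_pos_left hfxy h.l_pos
  rcases le_or_gt 1 (l' * g x) with hg1 | hg1
  · have h2 : l' * g x < l' * g y := mul_lt_mul_of_pos_left hgxy hl'
    rw [M01_of_one_le hg1, M01_of_one_le (hg1.trans h2.le), h.symm1] at *
    refine lt_min ((min_le_left _ _).trans_lt hlf) ?_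
    rcases h1 with h1 | h1
    · exact (le_max_right _ _).trans_lt h1
    · nlinarith
  · refine lt_min ((min_le_left _ _).trans_lt hlf) ((min_le_right _ _).trans_lt ?_)
    refine e.symm.strictMono ?_
    rw [M01_of_mem (mul_nonneg hl'.le hgx.1.le) hg1.le]
    exact lt_min hg1 (lt_of_lt_of_le (mul_lt_mul_of_pos_left hgxy hl') (le_max_right _ _))

omit h in
lemma phiLow_mono_of_gt (hl : 1 < l) (hl' : 0 ≤ l') {a b a' b' : ℝ} (ha : a ≤ a') (hb : b ≤ b') :
    phiLow e l l' a b ≤ phiLow e l l' a' b' := by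
  rw [phiLow_eq_of_gt hl, phiLow_eq_of_gt hl]
  have h1 : l * a ≤ l * a' := mul_le_mul_of_nonneg_left ha (by linarith)
  have h2 := e.symm.monotone (M01_mono (mul_le_mul_of_nonneg_left hb hl'))
  exact max_le_max (by linarith) (min_le_min h1 h2)

lemma phiLow_nonneg {a b : ℝ} (ha : 0 ≤ a) : 0 ≤ phiLow e l l' a b := by
  have hla : 0 ≤ l * a := mul_nonneg h.l_pos.le ha
  rcases lt_or_gt_of_ne h.l_ne with hl | hl
  · exact add_nonneg hla (mul_nonneg (by linarith) (M01_nonneg _))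
  · rw [phiLow_eq_of_gt hl]
    exact (le_min hla (h.symm_nonneg _)).trans (le_max_right _ _)

lemma phiLow_le_one {a b : ℝ} (ha : a ≤ 1) : phiLow e l l' a b ≤ 1 := by
  have hla : l * a ≤ l := mul_le_of_le_one_right h.l_pos.le ha
  rcases lt_or_gt_of_ne h.l_ne with hl | hl
  · have : (1 - l) * tLow e l l' a b ≤ 1 - l := mul_le_of_le_one_right (by linarith) (M01_le_one _)
    rw [phiLow]
    linarith
  · rw [phiLow_eq_of_gt hl]
    exact max_le (by linarith) ((min_le_right _ _).trans (h.symm_le_one _))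

lemma phiHigh_le_one (hl : l < 1) {a b : ℝ} (ha : a ≤ 1) : phiHigh e l l' a b ≤ 1 := by
  have hla : l * a ≤ l := mul_le_of_le_one_right h.l_pos.le ha
  have : (1 - l) * tHigh e l l' a b ≤ 1 - l := mul_le_of_le_one_right (by linarith) (M01_le_one _)
  rw [phiHigh]
  linarith

omit h in
lemma tendsto_unmix {Φ : ℕ → ℝ → ℝ} {Ψ : ℝ → ℝ} {y : ℝ}
    (ht : Tendsto (fun k => Φ k y) atTop (𝓝 (Ψ y))) :
    Tendsto (fun k => unmix l' g (fun y => e (Φ k y)) y) atTop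
      (𝓝 (unmix l' g (fun y => e (Ψ y)) y)) :=
  ((((e.continuous.tendsto _).comp ht).sub_const _).div_const _)

/-- If `l' > 0` the limit is itself feasible. If `l' = 0` it is `max (l f + 1 - l) 0`, which
vanishes on part of `I`; taking the maximum with `f / (k + 1)` makes it strictly increasing, at
increments that are still at most those of `l f`. -/
lemma lowSeq_gt_lt (hI : IncData f g e l l') (hl : 1 < l) (hl' : l' < 1) :
    LowSeq I f g e l l' := by
  rcases h.l'_nonneg.eq_or_lt with hl0 | hl0
  · have hphi : ∀ y, phiLow e l l' (f y) (g y) = max (l * f y + (1 - l)) 0 := by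
      intro y
      rw [phiLow_eq_of_gt hl, ← hl0, zero_mul, M01_of_nonpos le_rfl, h.symm0,
        min_eq_right (mul_nonneg h.l_pos.le (h.hf.nonneg y))]
    have hε : ∀ k : ℕ, 0 < 1 / ((k : ℝ) + 1) ∧ 1 / ((k : ℝ) + 1) ≤ 1 := fun k =>
      ⟨Nat.one_div_pos_of_nat, by rw [div_le_one (by positivity)]; linarith [k.cast_nonneg (α := ℝ)]⟩
    have hconv : ∀ y, Tendsto (fun k : ℕ => max (phiLow e l l' (f y) (g y))
        (1 / ((k : ℝ) + 1) * f y)) atTop (𝓝 (phiLow e l l' (f y) (g y))) := by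
      intro y
      have h1 := (tendsto_one_div_add_atTop_nhds_zero_nat (𝕜 := ℝ)).mul_const (f y)
      have h2 := (tendsto_const_nhds (x := phiLow e l l' (f y) (g y))).max h1
      rwa [zero_mul, max_eq_left (h.phiLow_nonneg (h.hf.nonneg y))] at h2
    refine ⟨fun k y => max (phiLow e l l' (f y) (g y)) (1 / ((k : ℝ) + 1) * f y), fun k => ?_,
      fun y _ => tendsto_unmix (hconv y), fun x hx x₀ hx₀ hxx hpos => ?_,
      fun h1 => absurd h1 (not_lt.2 hl.le)⟩
    · obtain ⟨hε0, hε1⟩ := hε k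
      refine ⟨h.hf.of_comparison (h.continuous_low.max (continuous_const.mul h.hf.cont))
        (fun x hx y hy hxy => ?_) (fun y hy => ?_) (fun y hy => ?_) ?_ ?_, ?_⟩
      · have hfx := h.hf.strict hx hy hxy
        have hf0 := ((h.hf.mem_iff x).1 hx).1
        have h3 : 1 / ((k : ℝ) + 1) * f x < 1 / ((k : ℝ) + 1) * f y :=
          mul_lt_mul_of_pos_left hfx hε0
        have h4 : l * f x < l * f y := mul_lt_mul_of_pos_left hfx h.l_pos
        simp only [hphi]
        refine max_lt (max_lt ?_ ?_) (h3.trans_le (le_max_right _ _))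
        · exact lt_of_lt_of_le (by linarith) ((le_max_left _ _).trans (le_max_left _ _))
        · exact lt_of_lt_of_le (mul_pos hε0 (hf0.trans hfx)) (le_max_right _ _)
      · beta_reduce; rw [h.low_zero hy, hy, mul_zero, max_self]
      · beta_reduce; rw [h.low_one (Or.inl hl) hy, hy, mul_one, max_eq_left hε1]
      · have := h.tendsto_low_bot.max (h.hf.bot.const_mul (1 / ((k : ℝ) + 1)))
        rwa [mul_zero, max_self] at this
      · have := (h.tendsto_low_top (Or.inl hl)).max (h.hf.top.const_mul (1 / ((k : ℝ) + 1)))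
        rwa [mul_one, max_eq_left hε1] at this
      · refine hI.low.max h.l_ne h.l'_ne ⟨?_, ?_⟩
        · rw [unmix_mono_of_gt hl]
          intro x y hxy
          have := h.hf.mono hxy
          nlinarith
        · rw [← hl0]
          intro x y hxy
          simp only [unmix, zero_mul, sub_zero, div_one]
          exact e.monotone (mul_le_mul_of_nonneg_left (h.hf.mono hxy) hε0.le)
    -- Positivity of the bound at `x₀` is essential: where the bound is zero on `I`, the
    -- approximations are strictly positive. Above zero, the limit increases strictly from `x` to
    -- `x₀` and convergence suffices.
    · have h0 : 0 < phiLow e l l' (f x₀) (g x₀) := by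
        by_contra hc
        have := e.monotone (not_lt.1 hc)
        rw [h.e0] at this
        simp only [cLow, unmix, ← hl0, zero_mul, sub_zero, div_one] at hpos this
        exact absurd hpos (not_lt.2 this)
      have hlt : phiLow e l l' (f x) (g x) < phiLow e l l' (f x₀) (g x₀) := by
        rw [hphi] at h0
        rw [hphi, hphi]
        have hf := h.hf.strict hx hx₀ hxx
        refine max_lt (lt_of_lt_of_le ?_ (le_max_left _ _)) h0
        have : l * f x < l * f x₀ := mul_lt_mul_of_pos_left hf h.l_pos
        linarith
      filter_upwards [(hconv x).eventually (gt_mem_nhds hlt)] with k hk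
      have := e.monotone hk.le
      simpa only [cLow, unmix, ← hl0, zero_mul, sub_zero, div_one] using this
  · exact lowSeq_const (fun h1 => absurd h1.1 (not_lt.2 hl.le))
      ⟨h.hf.of_comparison h.continuous_low
        (fun x hx y hy hxy => h.low_lt_low hl hl0 hx hy hxy (Or.inr hl'.le))
        (fun _ => h.low_zero) (fun _ => h.low_one (Or.inl hl)) h.tendsto_low_bot
        (h.tendsto_low_top (Or.inl hl)), hI.low⟩

-- Prescribing the sum `R + e(R)` controls the increments of `R` and of `e(R)` at the same time,
-- since both are nonnegative.
omit h in
lemma exists_id_add (e : ℝ ≃o ℝ) : ∃ S : ℝ ≃o ℝ, ∀ u, S u = u + e u := by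
  have hm : StrictMono fun u => u + e u := strictMono_id.add e.strictMono
  have hc : Continuous fun u => u + e u := continuous_id.add e.continuous
  have hs : Function.Surjective fun u => u + e u :=
    hc.surjective (tendsto_id.atTop_add_atTop e.tendsto_atTop)
      (tendsto_id.atBot_add_atBot e.tendsto_atBot)
  exact ⟨hm.orderIsoOfSurjective _ hs, fun u => rfl⟩

/-- A minorant normalized to vanish at the top. -/
lemma exists_minorant : ∃ E : ℝ → ℝ, Continuous E ∧ StrictMonoOn E I ∧
    (∀ x y, x ≤ y → 0 ≤ E y - E x ∧ E y - E x ≤ f y - f x ∧ E y - E x ≤ g y - g x) ∧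
    (∀ y, -(1 - f y) ≤ E y ∧ E y ≤ 0) ∧ Tendsto E atTop (𝓝 0) := by
  obtain ⟨E, hc, hs, hE⟩ := h.exE
  have hm : Monotone E := fun x y hxy => sub_nonneg.1 (hE x y hxy).1
  have key : ∀ y z, E z ≤ E y + (1 - f y) := by
    intro y z
    rcases le_total z y with hzy | hzy
    · linarith [hm hzy, h.hf.le_one y]
    · linarith [(hE y z hzy).2.1, h.hf.le_one z]
  have hbd : BddAbove (Set.range E) := ⟨_, Set.forall_mem_range.2 (key 0)⟩
  refine ⟨fun y => E y - ⨆ z, E z, hc.sub continuous_const,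
    fun x hx y hy hxy => sub_lt_sub_right (hs hx hy hxy) _, fun x y hxy => ?_, fun y => ?_, ?_⟩
  · have := hE x y hxy
    refine ⟨?_, ?_, ?_⟩ <;> linarith
  · constructor
    · linarith [ciSup_le (key y)]
    · linarith [le_ciSup hbd y]
  · have := (tendsto_atTop_ciSup hm hbd).sub_const (⨆ z, E z)
    rwa [sub_self] at this

/-- Here `Φ` may reach `1` inside `I`. It is capped by `R k`, defined by `R k + e (R k) = 2 + E / (k
+ 1)`, with `E ≤ 0` a minorant of the increments of `f` and `g` that tends to `0` at the top. The
cap is strictly increasing on `I`, below `1` and converges to `1`. The increments of both `R k` and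
`e ∘ R k` are at most those of `E`, which is what both constraints ask when `l` and `l'` exceed `1`.
-/
lemma lowSeq_gt_gt (hI : IncData f g e l l') (hl : 1 < l) (hl' : 1 < l') :
    LowSeq I f g e l l' := by
  obtain ⟨S, hS⟩ := exists_id_add e
  obtain ⟨E, hEc, hEs, hE, hEb, hEt⟩ := h.exists_minorant
  have hε : ∀ k : ℕ, 0 < 1 / ((k : ℝ) + 1) ∧ 1 / ((k : ℝ) + 1) ≤ 1 := fun k =>
    ⟨Nat.one_div_pos_of_nat, by rw [div_le_one (by positivity)]; linarith [k.cast_nonneg (α := ℝ)]⟩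
  have hS1 : S.symm 2 = 1 := by rw [S.symm_apply_eq, hS, h.e1]; norm_num
  have hS0 : S 0 = 0 := by rw [hS, h.e0]; norm_num
  set R : ℕ → ℝ → ℝ := fun k y => S.symm (2 + 1 / ((k : ℝ) + 1) * E y) with hR
  have hSR : ∀ k y, R k y + e (R k y) = 2 + 1 / ((k : ℝ) + 1) * E y := fun k y => by
    rw [← hS]; exact S.apply_symm_apply _
  have hRc : ∀ k, Continuous (R k) := fun k =>
    S.symm.continuous.comp (continuous_const.add (continuous_const.mul hEc))
  have hR1 : ∀ k y, R k y ≤ 1 := fun k y => by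
    rw [← hS1]
    exact S.symm.monotone (by nlinarith [(hEb y).2, (hε k).1])
  have hRk : ∀ y, Tendsto (fun k => R k y) atTop (𝓝 1) := fun y => by
    have h1 := (tendsto_one_div_add_atTop_nhds_zero_nat (𝕜 := ℝ)).mul_const (E y)
    have h2 := (S.symm.continuous.tendsto _).comp (h1.const_add 2)
    rwa [zero_mul, add_zero, hS1] at h2
  have hconv : ∀ y, Tendsto (fun k : ℕ => min (phiLow e l l' (f y) (g y)) (R k y)) atTop
      (𝓝 (phiLow e l l' (f y) (g y))) := by
    intro y
    have := (tendsto_const_nhds (x := phiLow e l l' (f y) (g y))).min (hRk y)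
    rwa [min_eq_left (h.phiLow_le_one (h.hf.le_one y))] at this
  refine ⟨fun k y => min (phiLow e l l' (f y) (g y)) (R k y), fun k => ?_,
    fun y _ => tendsto_unmix (hconv y), fun x hx x₀ hx₀ hxx hpos => ?_,
    fun h1 => absurd h1 (not_lt.2 hl.le)⟩
  · obtain ⟨hε0, hε1⟩ := hε k
    refine ⟨h.hf.of_comparison (h.continuous_low.min (hRc k))
      (fun x hx y hy hxy => ?_) (fun y hy => ?_) (fun y hy => ?_) ?_ ?_, ?_⟩
    · have hRxy : R k x < R k y :=
        S.symm.strictMono (add_lt_add_right (mul_lt_mul_of_pos_left (hEs hx hy hxy) hε0) _)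
      rcases lt_or_ge (phiLow e l l' (f x) (g x)) 1 with h1 | h1
      · exact min_lt_min (h.low_lt_low hl (by linarith) hx hy hxy (Or.inl h1)) hRxy
      · have h2 : (1 : ℝ) ≤ phiLow e l l' (f y) (g y) := h1.trans
          (phiLow_mono_of_gt hl (by linarith) (h.hf.mono hxy.le) (h.hg.mono hxy.le))
        exact (min_le_right _ _).trans_lt (lt_min ((hRxy.trans_le (hR1 k y)).trans_le h2) hRxy)
    · have h3 : 0 ≤ R k y := by
        rw [S.le_symm_apply, hS0]
        have := (hEb y).1
        rw [hy] at this
        nlinarith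
      simp only [h.low_zero hy, min_eq_left h3]
    · have h3 : R k y = 1 := by
        have := hEb y
        rw [hy] at this
        have hEy : E y = 0 := by linarith
        simp only [hR, hEy, mul_zero, add_zero, hS1]
      simp only [h.low_one (Or.inl hl) hy, h3, min_self]
    · refine squeeze_zero (fun y => le_min (h.phiLow_nonneg (h.hf.nonneg y)) ?_)
        (fun y => min_le_left _ _) h.tendsto_low_bot
      rw [S.le_symm_apply, hS0]
      have := (hEb y).1
      nlinarith [h.hf.nonneg y]
    · have h3 : Tendsto (R k) atTop (𝓝 1) := by
        have := (S.symm.continuous.tendsto _).comp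
          ((hEt.const_mul (1 / ((k : ℝ) + 1))).const_add 2)
        rwa [mul_zero, add_zero, hS1] at this
      simpa only [min_self] using (h.tendsto_low_top (Or.inl hl)).min h3
    · have hinc : ∀ x y, x ≤ y → 0 ≤ R k y - R k x ∧ 0 ≤ e (R k y) - e (R k x) := by
        intro x y hxy
        have hm : R k x ≤ R k y := S.symm.monotone (by nlinarith [(hE x y hxy).1])
        exact ⟨sub_nonneg.2 hm, sub_nonneg.2 (e.monotone hm)⟩
      refine hI.low.min h.l_ne h.l'_ne ⟨?_, ?_⟩
      · rw [unmix_mono_of_gt hl]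
        intro x y hxy
        obtain ⟨a1, a2, a3⟩ := hE x y hxy
        obtain ⟨b1, b2⟩ := hinc x y hxy
        have c1 : 1 / ((k : ℝ) + 1) * (E y - E x) ≤ E y - E x := mul_le_of_le_one_left a1 hε1
        have c2 : f y - f x ≤ l * (f y - f x) := le_mul_of_one_le_left (a1.trans a2) hl.le
        linarith [hSR k x, hSR k y]
      · rw [unmix_mono_of_gt hl']
        intro x y hxy
        obtain ⟨a1, a2, a3⟩ := hE x y hxy
        obtain ⟨b1, b2⟩ := hinc x y hxy
        have c1 : 1 / ((k : ℝ) + 1) * (E y - E x) ≤ E y - E x := mul_le_of_le_one_left a1 hε1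
        have c2 : g y - g x ≤ l' * (g y - g x) := le_mul_of_one_le_left (a1.trans a3) hl'.le
        linarith [hSR k x, hSR k y]
  -- Below `1` the cap is eventually inactive at `x`, and monotonicity of the limit concludes. If
  -- the limit equals `1` at `x`, it does so at `x₀` too, and strict increase of `g` leaves room for
  -- convergence.
  · rcases lt_or_ge (phiLow e l l' (f x) (g x)) 1 with h1 | h1
    · filter_upwards [(hRk x).eventually (lt_mem_nhds h1)] with k hk
      have : min (phiLow e l l' (f x) (g x)) (R k x) = phiLow e l l' (f x) (g x) :=
        min_eq_left hk.le
      simp only [unmix, this]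
      exact hI.low.C hxx.le
    · have h2 := h1.trans (phiLow_mono_of_gt (e := e) hl (by linarith : 0 ≤ l') (h.hf.mono hxx.le)
        (h.hg.mono hxx.le))
      have e1 := le_antisymm (h.phiLow_le_one (h.hf.le_one x)) h1
      have e2 := le_antisymm (h.phiLow_le_one (h.hf.le_one x₀)) h2
      have hlt : cLow f g e l l' x < cLow f g e l l' x₀ := by
        simp only [cLow, unmix, e1, e2]
        rw [div_lt_div_right_of_neg (by linarith)]
        have := mul_lt_mul_of_pos_left (h.hg.strict hx hx₀ hxx) (by linarith : 0 < l')
        linarith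
      filter_upwards [(tendsto_unmix (g := g) (e := e) (l' := l')
        (Φ := fun k y => min (phiLow e l l' (f y) (g y)) (R k y))
        (Ψ := fun y => phiLow e l l' (f y) (g y)) (hconv x)).eventually
        (gt_mem_nhds hlt)] with k hk using hk.le

/-- Here `Φ` stops short of `1` at the top, and the missing mass must be sent towards the upper end.
Both constraints bound increments below, so steep functions are allowed: follow the lower bound,
then a steep `R k`, then the upper bound, that is `max Φ_low (min Φ_high (R k))`. The ramp is read
through `Z`, whose increments minorize those of the identity and of `e`, so steepness of `Z ∘ R k`
passes to `R k` and `e ∘ R k`. -/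
lemma lowSeq_lt_lt (hI : IncData f g e l l') (hl : l < 1) (hl' : l' < 1) :
    LowSeq I f g e l l' := by
  obtain ⟨Z, hZ0, hZ⟩ := h.exZ
  have hζ0 : 0 < Z 1 := by rw [← hZ0]; exact Z.strictMono one_pos
  -- The term `2 Z 1`, rather than `Z 1`, makes the ramp exceed `1` before the end of `I`, so that
  -- the approximation dominates the upper bound there. As `Z 1 ≤ 1`, the ramp is still nonpositive
  -- at the bottom. Below any fixed point of `I` the sum `f + g` stays away from `2`, and the
  -- growing slope makes the ramp nonpositive there for large `k`.
  set R : ℕ → ℝ → ℝ := fun k y => Z.symm (2 * Z 1 - ((k : ℝ) + 1) * (2 - f y - g y)) with hR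
  have hζ1 : Z 1 ≤ 1 := by have := (hZ 0 1 zero_le_one).1; rw [hZ0] at this; linarith
  have hk1 : ∀ k : ℕ, (1 : ℝ) ≤ (k : ℝ) + 1 := fun k => by linarith [k.cast_nonneg (α := ℝ)]
  have hRc : ∀ k, Continuous (R k) := fun k =>
    Z.symm.continuous.comp (continuous_const.sub (continuous_const.mul
      ((continuous_const.sub h.hf.cont).sub h.hg.cont)))
  have hZR : ∀ k y, Z (R k y) = 2 * Z 1 - ((k : ℝ) + 1) * (2 - f y - g y) := fun k y =>
    Z.apply_symm_apply _
  have hbot : ∀ k : ℕ, Z.symm (2 * Z 1 - ((k : ℝ) + 1) * (2 - 0 - 0)) ≤ 0 := fun k => by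
    rw [Z.symm_apply_le, hZ0]; nlinarith [hk1 k]
  have htop : ∀ k : ℕ, 1 ≤ Z.symm (2 * Z 1 - ((k : ℝ) + 1) * (2 - 1 - 1)) := fun k => by
    rw [Z.le_symm_apply]; linarith
  have heq : ∀ k y, R k y ≤ 0 → max (phiLow e l l' (f y) (g y))
      (min (phiHigh e l l' (f y) (g y)) (R k y)) = phiLow e l l' (f y) (g y) := fun k y hy =>
    max_eq_left (((min_le_right _ _).trans hy).trans (h.phiLow_nonneg (h.hf.nonneg y)))
  have hev : ∀ c ∈ I, ∀ᶠ k in atTop, ∀ y ≤ c, R k y ≤ 0 := by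
    intro c hc
    have hδ : 0 < 2 - f c - g c := by
      linarith [((h.hf.mem_iff c).1 hc).2, ((h.hg.mem_iff c).1 hc).2]
    obtain ⟨n, hn⟩ := exists_nat_gt (2 / (2 - f c - g c))
    filter_upwards [eventually_ge_atTop n] with k hk y hy
    rw [Z.symm_apply_le, hZ0]
    rw [div_lt_iff₀ hδ] at hn
    have h1 : (n : ℝ) ≤ (k : ℝ) + 1 := by
      have : (n : ℝ) ≤ k := by exact_mod_cast hk
      linarith
    have h2 : 2 - f c - g c ≤ 2 - f y - g y := by linarith [h.hf.mono hy, h.hg.mono hy]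
    have h3 : (n : ℝ) * (2 - f c - g c) ≤ ((k : ℝ) + 1) * (2 - f y - g y) :=
      mul_le_mul h1 h2 hδ.le (by linarith [hk1 k])
    linarith
  have heqC : ∀ c ∈ I, ∀ᶠ k in atTop, ∀ y ≤ c, unmix l' g (fun y => e (max
      (phiLow e l l' (f y) (g y)) (min (phiHigh e l l' (f y) (g y)) (R k y)))) y
        = cLow f g e l l' y := by
    intro c hc
    filter_upwards [hev c hc] with k hk y hy
    simp only [cLow, unmix, heq k y (hk y hy)]
  refine ⟨fun k y => max (phiLow e l l' (f y) (g y)) (min (phiHigh e l l' (f y) (g y)) (R k y)),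
    fun k => ?_, fun y hy => ?_, fun x hx x₀ hx₀ hxx hpos => ?_, fun _ _ => ⟨heqC, fun k => ?_⟩⟩
  · have hslopes : Slopes f g e l l' fun y => max (phiLow e l l' (f y) (g y))
        (min (phiHigh e l l' (f y) (g y)) (R k y)) := by
      refine hI.low.max h.l_ne h.l'_ne (hI.high.min h.l_ne h.l'_ne ?_)
      have hinc : ∀ x y, x ≤ y → R k x ≤ R k y ∧ f y - f x ≤ Z (R k y) - Z (R k x) ∧
          g y - g x ≤ Z (R k y) - Z (R k x) := by
        intro x y hxy
        have a := h.hf.mono hxy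
        have b := h.hg.mono hxy
        have h1 := hk1 k
        refine ⟨Z.symm.monotone (by nlinarith), ?_, ?_⟩ <;>
        · rw [hZR, hZR]; nlinarith
      constructor
      · rw [unmix_mono_of_lt hl]
        intro x y hxy
        obtain ⟨a, b, -⟩ := hinc x y hxy
        have := mul_le_of_le_one_left (sub_nonneg.2 (h.hf.mono hxy)) hl.le
        linarith [(hZ _ _ a).1]
      · rw [unmix_mono_of_lt hl']
        intro x y hxy
        obtain ⟨a, -, b⟩ := hinc x y hxy
        have := mul_le_of_le_one_left (sub_nonneg.2 (h.hg.mono hxy)) hl'.le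
        linarith [(hZ _ _ a).2]
    have hl1 : phiLow e l l' 1 1 ≤ 1 := h.phiLow_le_one le_rfl
    refine ⟨h.hf.of_comparison (h.continuous_low.max (h.continuous_high.min (hRc k)))
      (strictMonoOn_of_slope h.hf h.l_pos hl hslopes.K) (fun y hy => ?_) (fun y hy => ?_) ?_ ?_,
      hslopes⟩
    · have : R k y ≤ 0 := by
        have := hbot k
        simpa only [hR, hy, h.hf.zero_of_zero h.hg hy] using this
      exact (heq k y this).trans (h.low_zero hy)
    · have : 1 ≤ R k y := by
        have := htop k
        simpa only [hR, hy, h.hf.one_of_one h.hg hy] using this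
      beta_reduce
      rw [h.high_one hy, min_eq_left this]
      exact max_eq_right (h.phiLow_le_one (h.hf.le_one y))
    · have hh := ((continuous_phiHigh e l l').tendsto (0, 0)).comp
        (h.hf.bot.prodMk_nhds h.hg.bot)
      have hr : Tendsto (R k) atBot (𝓝 (Z.symm (2 * Z 1 - ((k : ℝ) + 1) * (2 - 0 - 0)))) :=
        (Z.symm.continuous.tendsto _).comp (tendsto_const_nhds.sub
          (tendsto_const_nhds.mul ((tendsto_const_nhds.sub h.hf.bot).sub h.hg.bot)))
      have := h.tendsto_low_bot.max (hh.min hr)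
      rwa [max_eq_left ((min_le_right _ _).trans (hbot k))] at this
    · have hlo := ((continuous_phiLow e l l').tendsto (1, 1)).comp
        (h.hf.top.prodMk_nhds h.hg.top)
      have hr : Tendsto (R k) atTop (𝓝 (Z.symm (2 * Z 1 - ((k : ℝ) + 1) * (2 - 1 - 1)))) :=
        (Z.symm.continuous.tendsto _).comp (tendsto_const_nhds.sub
          (tendsto_const_nhds.mul ((tendsto_const_nhds.sub h.hf.top).sub h.hg.top)))
      have := hlo.max (h.tendsto_high_top.min hr)
      rwa [min_eq_left (htop k), max_eq_right hl1] at this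
  · refine tendsto_const_nhds.congr' ?_
    filter_upwards [heqC y hy] with k hk using (hk y le_rfl).symm
  · filter_upwards [heqC x hx] with k hk
    rw [hk x le_rfl]
    exact hI.low.C hxx.le
  -- Chosen so that `f, g ≥ 1 - η` gives `(k + 1) (2 - f - g) ≤ Z 1`, that is `R k ≥ 1`.
  · set η := Z 1 / (2 * ((k : ℝ) + 1)) with hη
    have hk0 : (0 : ℝ) < (k : ℝ) + 1 := by linarith [hk1 k]
    have hη0 : 0 < η := by positivity
    have hη1 : η < 1 := by
      rw [hη, div_lt_one (by positivity)]
      linarith [hk1 k]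
    obtain ⟨c1, hc1, e1⟩ := h.hf.exists_eq (u := 1 - η) (by linarith) (by linarith)
    obtain ⟨c2, hc2, e2⟩ := h.hg.exists_eq (u := 1 - η) (by linarith) (by linarith)
    refine ⟨max c1 c2, by rcases max_choice c1 c2 with hc | hc <;> rwa [hc], fun y hy => ?_⟩
    have hR1 : 1 ≤ R k y := by
      rw [Z.le_symm_apply]
      have a := h.hf.mono ((le_max_left _ _).trans hy)
      have b := h.hg.mono ((le_max_right _ _).trans hy)
      rw [e1] at a
      rw [e2] at b
      have : ((k : ℝ) + 1) * (2 - f y - g y) ≤ ((k : ℝ) + 1) * (2 * η) :=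
        mul_le_mul_of_nonneg_left (by linarith) hk0.le
      have h5 : ((k : ℝ) + 1) * (2 * η) = Z 1 := by rw [hη]; field_simp
      linarith
    have h6 : min (phiHigh e l l' (f y) (g y)) (R k y) = phiHigh e l l' (f y) (g y) :=
      min_eq_left ((h.phiHigh_le_one hl (h.hf.le_one y)).trans hR1)
    simp only [cHigh, unmix, h6]
    exact div_le_div_of_nonneg_right (sub_le_sub_right (e.monotone (le_max_right _ _)) _)
      (by linarith)

/-- A ratio below `1` bounds increments from below and tolerates steep pieces; a ratio above `1`
bounds them from above and tolerates flat ones. Each sign pattern thus has its own admissible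
repair. The comparison at nearby points in `LowSeq` serves, after reflection, the quantiles of the
upper bound; its last clause serves the means when mass is missing. -/
theorem lowSeq (hI : IncData f g e l l') : LowSeq I f g e l l' := by
  rcases lt_or_gt_of_ne h.l_ne with hl | hl <;> rcases lt_or_gt_of_ne h.l'_ne with hl' | hl'
  · exact h.lowSeq_lt_lt hI hl hl'
  · exact h.lowSeq_lt_gt hI hl hl'
  · exact h.lowSeq_gt_lt hI hl hl'
  · exact h.lowSeq_gt_gt hI hl hl'

end CicData

/-! ### Reflection -/

/-- The cdf of the opposite variable, for a continuous cdf. -/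
def reflect (f : ℝ → ℝ) (y : ℝ) : ℝ := 1 - f (-y)

lemma reflect_reflect (f : ℝ → ℝ) : reflect (reflect f) = f := by
  ext y; simp [reflect]

/-- `u ↦ 1 - e (1 - u)`. -/
def reflectIso (e : ℝ ≃o ℝ) : ℝ ≃o ℝ where
  toFun u := 1 - e (1 - u)
  invFun u := 1 - e.symm (1 - u)
  left_inv u := by simp
  right_inv u := by simp
  map_rel_iff' := by
    intro a b
    change 1 - e (1 - a) ≤ 1 - e (1 - b) ↔ a ≤ b
    rw [sub_le_sub_iff_left, e.le_iff_le, sub_le_sub_iff_left]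

lemma reflectIso_apply (e : ℝ ≃o ℝ) (u : ℝ) : reflectIso e u = 1 - e (1 - u) := rfl

lemma reflectIso_symm_apply (e : ℝ ≃o ℝ) (u : ℝ) :
    (reflectIso e).symm u = 1 - e.symm (1 - u) := rfl

lemma unmix_reflect {l : ℝ} (hl : l ≠ 1) (f Φ : ℝ → ℝ) (y : ℝ) :
    unmix l (reflect f) (reflect Φ) y = 1 - unmix l f Φ (-y) := by
  have : 1 - l ≠ 0 := sub_ne_zero.2 hl.symm
  rw [unmix, unmix, reflect, reflect]
  field_simp
  ring

lemma unmix_reflectIso {l : ℝ} (hl : l ≠ 1) (e : ℝ ≃o ℝ) (f Φ : ℝ → ℝ) (y : ℝ) :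
    unmix l (reflect f) (fun y => reflectIso e (reflect Φ y)) y
      = 1 - unmix l f (fun y => e (Φ y)) (-y) := by
  rw [← unmix_reflect hl]
  simp [unmix, reflect, reflectIso_apply]

lemma M01_one_sub (x : ℝ) : M01 (1 - x) = 1 - M01 x := by
  unfold M01
  rcases le_total x 0 with h | h
  · rw [max_eq_left h, max_eq_right (by linarith), min_eq_left (by linarith), min_eq_right (by simp)]
    simp
  · rcases le_total x 1 with h1 | h1
    · rw [max_eq_right h, min_eq_right h1, max_eq_right (by linarith), min_eq_right (by linarith)]
    · rw [max_eq_right h, min_eq_left h1, max_eq_left (by linarith), min_eq_right (by simp)]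
      simp

lemma tLow_reflect {e : ℝ ≃o ℝ} {l l' : ℝ} (hl : l ≠ 1) (a b : ℝ) :
    tLow (reflectIso e) l l' (1 - a) (1 - b) = 1 - tHigh e l l' a b := by
  have h0 : l - 1 ≠ 0 := sub_ne_zero.2 hl
  rw [tLow, tHigh, ← M01_one_sub, reflectIso_symm_apply, ← M01_one_sub]
  have : 1 - l' * (1 - b) = l' * b + (1 - l') := by ring
  rw [this]
  congr 1
  field_simp
  ring

lemma phiLow_reflect {e : ℝ ≃o ℝ} {l l' : ℝ} (hl : l ≠ 1) (a b : ℝ) :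
    phiLow (reflectIso e) l l' (1 - a) (1 - b) = 1 - phiHigh e l l' a b := by
  rw [phiLow, tLow_reflect hl, phiHigh]
  ring

lemma tHigh_reflect {e : ℝ ≃o ℝ} {l l' : ℝ} (hl : l ≠ 1) (a b : ℝ) :
    tHigh (reflectIso e) l l' (1 - a) (1 - b) = 1 - tLow e l l' a b := by
  have h0 : l - 1 ≠ 0 := sub_ne_zero.2 hl
  rw [tLow, tHigh, ← M01_one_sub, reflectIso_symm_apply, ← M01_one_sub]
  have : 1 - (l' * (1 - b) + (1 - l')) = l' * b := by ring
  rw [this]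
  congr 1
  field_simp
  ring

lemma phiHigh_reflect {e : ℝ ≃o ℝ} {l l' : ℝ} (hl : l ≠ 1) (a b : ℝ) :
    phiHigh (reflectIso e) l l' (1 - a) (1 - b) = 1 - phiLow e l l' a b := by
  rw [phiHigh, tHigh_reflect hl, phiLow]
  ring

lemma RegCdf.reflect {I : Set ℝ} {f : ℝ → ℝ} (hf : RegCdf I f) :
    RegCdf {y | -y ∈ I} (reflect f) := by
  refine ⟨continuous_const.sub (hf.cont.comp continuous_neg),
    fun x y hxy => sub_le_sub_left (hf.mono (neg_le_neg hxy)) _,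
    fun x hx y hy hxy => sub_lt_sub_left (hf.strict hy hx (neg_lt_neg hxy)) _, fun x => ?_, ?_, ?_⟩
  · have := hf.mem_iff (-x)
    simp only [_root_.reflect, Set.mem_ofPred_eq, this, sub_pos, sub_lt_self_iff]
    exact and_comm
  · have := (hf.top.comp tendsto_neg_atBot_atTop).const_sub 1
    rwa [sub_self] at this
  · have := (hf.bot.comp tendsto_neg_atTop_atBot).const_sub 1
    rwa [sub_zero] at this

lemma Slopes.reflect {f g : ℝ → ℝ} {e : ℝ ≃o ℝ} {l l' : ℝ} (hl : l ≠ 1) (hl' : l' ≠ 1) {Φ : ℝ → ℝ}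
    (h : Slopes f g e l l' Φ) :
    Slopes (reflect f) (reflect g) (reflectIso e) l l' (reflect Φ) := by
  constructor
  · intro x y hxy
    rw [unmix_reflect hl, unmix_reflect hl]
    exact sub_le_sub_left (h.K (neg_le_neg hxy)) _
  · intro x y hxy
    rw [unmix_reflectIso hl', unmix_reflectIso hl']
    exact sub_le_sub_left (h.C (neg_le_neg hxy)) _

lemma reflectIso_reflectIso (e : ℝ ≃o ℝ) : reflectIso (reflectIso e) = e := by
  ext u; simp [reflectIso_apply]

lemma Feasible.of_reflect {I : Set ℝ} {f g : ℝ → ℝ} {e : ℝ ≃o ℝ} {l l' : ℝ} (hl : l ≠ 1)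
    (hl' : l' ≠ 1) {Φ : ℝ → ℝ}
    (h : Feasible {y | -y ∈ I} (reflect f) (reflect g) (reflectIso e) l l' Φ) :
    Feasible I f g e l l' (reflect Φ) := by
  have h1 := h.reg.reflect
  have h2 := h.slopes.reflect hl hl'
  simp only [reflect_reflect, reflectIso_reflectIso] at h2
  simp only [Set.mem_ofPred_eq, neg_neg, Set.ofPred_mem_eq] at h1
  exact ⟨h1, h2⟩

namespace CicData

variable {I : Set ℝ} {f g : ℝ → ℝ} {e : ℝ ≃o ℝ} {l l' : ℝ} (h : CicData I f g e l l')
include h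

lemma reflect : CicData {y | -y ∈ I} (_root_.reflect f) (_root_.reflect g) (reflectIso e) l l' := by
  obtain ⟨E, hc, hs, hE⟩ := h.exE
  obtain ⟨Z, hZ0, hZ⟩ := h.exZ
  refine ⟨h.hf.reflect, h.hg.reflect, by simp [reflectIso_apply, h.e1],
    by simp [reflectIso_apply, h.e0], h.l_pos, h.l_ne, h.l'_nonneg, h.l'_ne,
    ⟨fun y => -E (-y), (hc.comp continuous_neg).neg,
      fun x hx y hy hxy => neg_lt_neg (hs hy hx (neg_lt_neg hxy)), fun x y hxy => ?_⟩,
    ⟨(reflectIso Z).trans (OrderIso.addRight (Z 1 - 1)), ?_, fun u v huv => ?_⟩⟩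
  · obtain ⟨a, b, c⟩ := hE (-y) (-x) (neg_le_neg hxy)
    simp only [_root_.reflect]
    refine ⟨?_, ?_, ?_⟩ <;> linarith
  · simp [reflectIso_apply]
  · obtain ⟨a, b⟩ := hZ (1 - v) (1 - u) (by linarith)
    simp only [OrderIso.trans_apply, reflectIso_apply, OrderIso.addRight_apply]
    constructor <;> linarith

lemma cLow_reflect (y : ℝ) :
    cLow (_root_.reflect f) (_root_.reflect g) (reflectIso e) l l' y = 1 - cHigh f g e l l' (-y) := by
  have := unmix_reflectIso h.l'_ne e g (fun y => phiHigh e l l' (f y) (g y)) y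
  rw [cHigh, ← this, cLow]
  simp only [unmix, _root_.reflect, phiLow_reflect h.l_ne]

lemma cHigh_reflect (y : ℝ) :
    cHigh (_root_.reflect f) (_root_.reflect g) (reflectIso e) l l' y = 1 - cLow f g e l l' (-y) := by
  have := unmix_reflectIso h.l'_ne e g (fun y => phiLow e l l' (f y) (g y)) y
  rw [cLow, ← this, cHigh]
  simp only [unmix, _root_.reflect, phiHigh_reflect h.l_ne]

/-- Under `y ↦ -y` and `u ↦ 1 - u` the two choices of `K` are exchanged (`phiLow_reflect`,
`phiHigh_reflect`) while the ratios stay the same, so the upper bound is the lower bound of the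
reflected data. -/
theorem highSeq (hI : IncData f g e l l') : HighSeq I f g e l l' := by
  have hI' : IncData (_root_.reflect f) (_root_.reflect g) (reflectIso e) l l' := by
    have h1 := hI.high.reflect h.l_ne h.l'_ne
    have h2 := hI.low.reflect h.l_ne h.l'_ne
    constructor
    · simp only [_root_.reflect, phiLow_reflect h.l_ne]; exact h1
    · simp only [_root_.reflect, phiHigh_reflect h.l_ne]; exact h2
  obtain ⟨Φ, hΦ, hconv, hthird, htail⟩ := h.reflect.lowSeq hI'
  have key : ∀ k y, unmix l' g (fun y => e (_root_.reflect (Φ k) y)) y = 1 -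
      unmix l' (_root_.reflect g) (fun y => reflectIso e (Φ k y)) (-y) := by
    intro k y
    have := unmix_reflectIso h.l'_ne e g (_root_.reflect (Φ k)) (-y)
    rw [reflect_reflect, neg_neg] at this
    rw [this]; ring
  have keyH : ∀ y, cHigh f g e l l' y = 1 -
      cLow (_root_.reflect f) (_root_.reflect g) (reflectIso e) l l' (-y) := by
    intro y; rw [h.cLow_reflect, neg_neg]; ring
  have keyL : ∀ y, cLow f g e l l' y = 1 -
      cHigh (_root_.reflect f) (_root_.reflect g) (reflectIso e) l l' (-y) := by
    intro y; rw [h.cHigh_reflect, neg_neg]; ring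
  have hmem : ∀ {y}, y ∈ I → -y ∈ {y | -y ∈ I} := fun {y} hy => by simpa using hy
  refine ⟨fun k => _root_.reflect (Φ k), fun k => (hΦ k).of_reflect h.l_ne h.l'_ne, fun y hy => ?_,
    fun x hx x₀ hx₀ hxx hlt => ?_, fun hl hl' => ⟨fun c hc => ?_, fun k => ?_⟩⟩
  · simp only [key, keyH]
    exact (hconv (-y) (hmem hy)).const_sub 1
  · rw [keyH] at hlt
    filter_upwards [hthird (-x) (hmem hx) (-x₀) (hmem hx₀) (neg_lt_neg hxx) (by linarith)] with k hk
    rw [key, keyH]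
    exact sub_le_sub_left hk _
  · filter_upwards [(htail hl hl').1 (-c) (hmem hc)] with k hk y hy
    rw [key, keyH, hk (-y) (neg_le_neg hy)]
  · obtain ⟨c, hc, h1⟩ := (htail hl hl').2 k
    refine ⟨-c, hc, fun y hy => ?_⟩
    rw [key, keyL]
    exact sub_le_sub_left (h1 (-y) (le_neg_of_le_neg hy)) _

end CicData

/-! ### Minorants built from derivatives -/

/-- A common minorant of the increments of two increasing functions: the integral of the smaller of
their derivatives. -/
lemma exists_increment_minorant {f g : ℝ → ℝ} (hf : Monotone f) (hg : Monotone g) :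
    ∃ E : ℝ → ℝ, Continuous E ∧
      (∀ x y, x ≤ y → 0 ≤ E y - E x ∧ E y - E x ≤ f y - f x ∧ E y - E x ≤ g y - g x) ∧
      ∀ x y, x < y → (∀ z ∈ Set.Ioo x y, 0 < deriv f z ∧ 0 < deriv g z) → E x < E y := by
  have hint : ∀ {h : ℝ → ℝ}, Monotone h → ∀ a b, IntervalIntegrable (deriv h) volume a b :=
    fun hh a b => (hh.monotoneOn _).intervalIntegrable_deriv
  have hm : ∀ a b, IntervalIntegrable (fun z => min (deriv f z) (deriv g z)) volume a b :=
    fun a b => ⟨(hint hf a b).1.inf (hint hg a b).1, (hint hf a b).2.inf (hint hg a b).2⟩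
  have hsub : ∀ x y, (∫ z in (0 : ℝ)..y, min (deriv f z) (deriv g z))
      - (∫ z in (0 : ℝ)..x, min (deriv f z) (deriv g z))
        = ∫ z in x..y, min (deriv f z) (deriv g z) := fun x y =>
    intervalIntegral.integral_interval_sub_left (hm 0 y) (hm 0 x)
  -- For a monotone function the integral of the derivative is at most the increment. This
  -- inequality is all that is needed, so absolute continuity plays no role.
  have hle : ∀ {h : ℝ → ℝ}, Monotone h → ∀ x y, x ≤ y → ∫ z in x..y, deriv h z ≤ h y - h x := by
    intro h hh x y hxy
    have := (hh.monotoneOn (Set.uIcc x y)).intervalIntegral_deriv_mem_uIcc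
    rw [Set.uIcc_of_le (sub_nonneg.2 (hh hxy))] at this
    exact this.2
  refine ⟨fun y => ∫ z in (0 : ℝ)..y, min (deriv f z) (deriv g z),
    intervalIntegral.continuous_primitive hm 0, fun x y hxy => ?_, fun x y hxy hpos => ?_⟩
  · simp only [hsub]
    exact ⟨intervalIntegral.integral_nonneg_of_forall hxy fun z =>
        le_min hf.deriv_nonneg hg.deriv_nonneg,
      (intervalIntegral.integral_mono hxy (hm x y) (hint hf x y) fun z => min_le_left _ _).trans
        (hle hf x y hxy),
      (intervalIntegral.integral_mono hxy (hm x y) (hint hg x y) fun z => min_le_right _ _).trans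
        (hle hg x y hxy)⟩
  · rw [← sub_pos, hsub]
    exact intervalIntegral.intervalIntegral_pos_of_pos_on (hm x y)
      (fun z hz => lt_min (hpos z hz).1 (hpos z hz).2) hxy

/-- Near `p x` the inverse function theorem writes `e` as `q ∘ p⁻¹`, so its derivative there is
`q'(x) / p'(x)`. -/
lemma RegCdf.deriv_transform_pos {I : Set ℝ} {p q : ℝ → ℝ} {e : ℝ → ℝ} (hp : RegCdf I p)
    (he : ∀ x, e (p x) = q x) (hpC : ContDiffOn ℝ 1 p I) (hp' : ∀ y ∈ I, 0 < deriv p y)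
    (hq' : ∀ y ∈ I, 0 < deriv q y) {u : ℝ} (hu : u ∈ Set.Ioo (0 : ℝ) 1) : 0 < deriv e u := by
  obtain ⟨x, hx, rfl⟩ := hp.exists_eq hu.1 hu.2
  have hps : HasStrictDerivAt p (deriv p x) x :=
    (hpC.contDiffAt (hp.isOpen.mem_nhds hx)).hasStrictDerivAt one_ne_zero
  have hne := (hp' x hx).ne'
  have hF := hps.hasStrictFDerivAt_equiv hne
  have hq : HasDerivAt q (deriv q x) x := (differentiableAt_of_deriv_ne_zero (hq' x hx).ne').hasDerivAt
  have hloc : hps.localInverse p (deriv p x) x hne (p x) = x := hF.localInverse_apply_image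
  have hq2 : HasDerivAt q (deriv q x) (hps.localInverse p (deriv p x) x hne (p x)) := by rwa [hloc]
  have hcomp := hq2.comp (p x) (hps.to_localInverse hne).hasDerivAt
  have heq : e =ᶠ[𝓝 (p x)] q ∘ hps.localInverse p (deriv p x) x hne := by
    filter_upwards [hF.eventually_right_inverse] with y hy
    rw [Function.comp_apply, ← he]
    exact congrArg e hy.symm
  rw [heq.deriv_eq, hcomp.deriv]
  exact mul_pos (hq' x hx) (inv_pos.2 (hp' x hx))

/-- On the unit interval, integrate the smaller of `1` and `e'`; outside it `e` is the identity, so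
unit slope may be kept. The part `u - M01 u` supplies that slope and makes the result onto the line.
-/
lemma exists_orderIso_minorant {e : ℝ ≃o ℝ} (e0 : e 0 = 0) (e1 : e 1 = 1)
    (heo : ∀ u ∉ Set.Ioo (0 : ℝ) 1, e u = u) (he' : ∀ u ∈ Set.Ioo (0 : ℝ) 1, 0 < deriv e u) :
    ∃ Z : ℝ ≃o ℝ, Z 0 = 0 ∧ ∀ u v, u ≤ v → Z v - Z u ≤ v - u ∧ Z v - Z u ≤ e v - e u := by
  obtain ⟨J, hJc, hJ, hJs⟩ := exists_increment_minorant (f := fun u : ℝ => u) monotone_id e.monotone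
  have hJs' : ∀ u v, 0 ≤ u → v ≤ 1 → u < v → J u < J v := fun u v hu hv huv =>
    hJs u v huv fun z hz => ⟨by simp, he' z ⟨hu.trans_lt hz.1, hz.2.trans_le hv⟩⟩
  have hM : ∀ u, 0 ≤ M01 u ∧ M01 u ≤ 1 := fun u => ⟨M01_nonneg u, M01_le_one u⟩
  have hr : ∀ u v, u ≤ v → u - M01 u ≤ v - M01 v := by
    intro u v huv
    have h0 := M01_nonneg v
    rcases le_total u 0 with a | a
    · rw [M01_of_nonpos a]
      rcases le_total v 0 with b | b
      · rw [M01_of_nonpos b]; linarith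
      · linarith [M01_le b (le_refl v)]
    · rcases le_total v 1 with b | b
      · rw [M01_of_mem a (huv.trans b), M01_of_mem (a.trans huv) b]; linarith
      · rw [M01_of_one_le b]
        rcases le_total u 1 with c | c
        · rw [M01_of_mem a c]; linarith
        · rw [M01_of_one_le c]; linarith
  have hev : ∀ u, e u = e (M01 u) + (u - M01 u) := by
    intro u
    rcases le_total u 0 with a | a
    · rw [M01_of_nonpos a, e0, heo u fun h => absurd h.1 (not_lt.2 a)]; ring
    · rcases le_total u 1 with b | b
      · rw [M01_of_mem a b]; ring
      · rw [M01_of_one_le b, e1, heo u fun h => absurd h.2 (not_lt.2 b)]; ring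
  set Z : ℝ → ℝ := fun u => J (M01 u) - J 0 + (u - M01 u) with hZ
  have hZs : StrictMono Z := by
    intro u v huv
    have h1 := hr u v huv.le
    rcases (M01_mono huv.le).eq_or_lt with h | h
    · simp only [hZ, h]; linarith
    · have := hJs' _ _ (hM u).1 (hM v).2 h
      simp only [hZ]; linarith
  have hZc : Continuous Z := by
    have := continuous_M01
    fun_prop
  have hb : ∀ u, u - 1 ≤ Z u ∧ Z u ≤ u := by
    intro u
    obtain ⟨a, b, -⟩ := hJ 0 (M01 u) (hM u).1
    have := hM u
    constructor <;> simp only [hZ] <;> linarith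
  have hsurj : Function.Surjective Z := hZc.surjective
    (tendsto_atTop_mono (fun u => (hb u).1) (tendsto_atTop_add_const_right _ _ tendsto_id))
    (tendsto_atBot_mono (fun u => (hb u).2) tendsto_id)
  refine ⟨hZs.orderIsoOfSurjective Z hsurj, ?_, fun u v huv => ?_⟩
  · change Z 0 = 0
    simp [hZ, M01_of_nonpos (le_refl (0 : ℝ))]
  · change Z v - Z u ≤ v - u ∧ Z v - Z u ≤ e v - e u
    obtain ⟨-, b, c⟩ := hJ _ _ (M01_mono huv)
    constructor
    · simp only [hZ]; linarith
    · rw [hev v, hev u]; simp only [hZ]; linarith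

/-! ### From the data to the scalar problem -/

namespace FuzzyDiD

variable {M : FuzzyDiD.{u}}

lemma Standing.rate_control (hS : M.Standing) (d t : Fin 2) : 0 < M.rate d 0 t := by
  fin_cases d
  · have := M.rate_zero 0 t
    have := (hS.rate_mem t).2
    simp only [Fin.zero_eta]; linarith
  · exact (hS.rate_mem t).1

lemma Standing.lam_control_ne (hS : M.Standing) (d : Fin 2) : M.rate d 0 1 ≠ M.rate d 0 0 := by
  have h0 := M.rate_zero 0 0
  have h1 := M.rate_zero 0 1
  have := hS.change
  fin_cases d
  · simp only [Fin.zero_eta]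
    intro h; exact this (by linarith)
  · exact this

variable (M) in
/-- `F_{Y_{d11}}`, replaced by `F_{Y_{d01}}` when the corresponding cell is empty. -/
def treatedF (d : Fin 2) : ℝ → ℝ := if 0 < M.rate d 1 1 then M.F d 1 1 else M.F d 0 1

lemma lam_mul_treatedF (d : Fin 2) (y : ℝ) : M.lam 1 d * M.treatedF d y = M.lam 1 d * M.F d 1 1 y := by
  unfold treatedF
  split_ifs with h
  · rfl
  · have : M.rate d 1 1 = 0 := le_antisymm (not_lt.1 h) (M.rate_nonneg d 1 1)
    simp [lam, this]

/-- The data entering the CIC bounds, when the cell `D = d, G = 1, T = 0` is not empty. -/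
lemma IncreasingBounds.exists_cicData (hI : M.IncreasingBounds) (hS : M.Standing)
    (hD : M.DataRestrictions) {d : Fin 2} (hd : 0 < M.rate d 1 0) :
    ∃ e : ℝ ≃o ℝ, CicData (interior M.suppY) (M.F d 0 1) (M.treatedF d) e (M.lam 0 d) (M.lam 1 d) ∧
      (∀ x, e (M.F d 0 0 x) = M.F d 1 0 x) ∧ (∀ u ∈ Set.Icc (0 : ℝ) 1, M.H d u = e u) ∧
      ∀ q, M.Hinv d q = e.symm (M01 q) := by
  have r00 := hS.rate_control d 0
  have r01 := hS.rate_control d 1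
  obtain ⟨e, e0, e1, he, heo, hH, hHinv⟩ := hD.exists_H r00 hd
  have hf := hD.regCdf r01
  have hp := hD.regCdf r00
  have hg : RegCdf (interior M.suppY) (M.treatedF d) := by
    unfold treatedF
    split_ifs with h
    · exact hD.regCdf h
    · exact hf
  have hg' : ∀ y ∈ interior M.suppY, 0 < deriv (M.treatedF d) y := by
    unfold treatedF
    split_ifs with h
    · exact (hI.1 d 1 1 h).2
    · exact (hI.1 d 0 1 r01).2
  refine ⟨e, ⟨hf, hg, e0, e1, div_pos r01 r00, ?_, div_nonneg (M.rate_nonneg _ _ _) hd.le, ?_, ?_,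
    exists_orderIso_minorant e0 e1 heo fun u hu => hp.deriv_transform_pos he (hI.1 d 0 0 r00).1
      (hI.1 d 0 0 r00).2 (hI.1 d 1 0 hd).2 hu⟩, he, hH, hHinv⟩
  · rw [lam, Ne, div_eq_one_iff_eq r00.ne']; exact hS.lam_control_ne d
  · rw [lam, Ne, div_eq_one_iff_eq hd.ne']; exact hS.first.rate_ne d
  · obtain ⟨E, hEc, hE, hEs⟩ := exists_increment_minorant hf.mono hg.mono
    exact ⟨E, hEc, fun x hx y hy hxy => hEs x y hxy fun z hz =>
      have hz' : z ∈ interior M.suppY := hf.ordConnected.out hx hy ⟨hz.1.le, hz.2.le⟩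
      ⟨(hI.1 d 0 1 r01).2 z hz', hg' z hz'⟩, hE⟩

section Identification

variable {d : Fin 2} {e : ℝ ≃o ℝ}

lemma Tlow_eq (hHinv : ∀ q, M.Hinv d q = e.symm (M01 q)) (y : ℝ) :
    M.Tlow d y = tLow e (M.lam 0 d) (M.lam 1 d) (M.F d 0 1 y) (M.treatedF d y) := by
  rw [Tlow, tLow, hHinv, lam_mul_treatedF]

lemma Thigh_eq (hHinv : ∀ q, M.Hinv d q = e.symm (M01 q)) (y : ℝ) :
    M.Thigh d y = tHigh e (M.lam 0 d) (M.lam 1 d) (M.F d 0 1 y) (M.treatedF d y) := by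
  rw [Thigh, tHigh, hHinv, lam_mul_treatedF]

lemma Gop_Tlow_eq (hHinv : ∀ q, M.Hinv d q = e.symm (M01 q)) (y : ℝ) :
    M.Gop d (M.Tlow d) y
    = phiLow e (M.lam 0 d) (M.lam 1 d) (M.F d 0 1 y) (M.treatedF d y) := by
  rw [Gop, Tlow_eq hHinv, phiLow]

lemma Gop_Thigh_eq (hHinv : ∀ q, M.Hinv d q = e.symm (M01 q)) (y : ℝ) :
    M.Gop d (M.Thigh d) y
    = phiHigh e (M.lam 0 d) (M.lam 1 d) (M.F d 0 1 y) (M.treatedF d y) := by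
  rw [Gop, Thigh_eq hHinv, phiHigh]

lemma cop_eq_unmix (hd : 0 < M.rate d 1 0) {T : ℝ → ℝ} (hT : ∀ y, M.H d (M.Gop d T y) = e (M.Gop d T y)) (y : ℝ) :
    M.Cop d T y = unmix (M.lam 1 d) (M.treatedF d) (fun y => e (M.Gop d T y)) y := by
  rw [Cop, unmix, lam_mul_treatedF, hT, lam]
  rw [← neg_div_neg_eq]
  have h2 : -(M.rate d 1 1 - M.rate d 1 0) = M.rate d 1 0 * (1 - M.rate d 1 1 / M.rate d 1 0) := by
    field_simp; ring
  have h3 : -(M.rate d 1 1 * M.F d 1 1 y - M.rate d 1 0 * e (M.Gop d T y)) =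
      M.rate d 1 0 * (e (M.Gop d T y) - M.rate d 1 1 / M.rate d 1 0 * M.F d 1 1 y) := by
    field_simp; ring
  rw [h2, h3, mul_div_mul_left _ _ hd.ne']

end Identification

/-- The CIC bounds in terms of scalar functions of the cdfs. -/
theorem IncreasingBounds.exists_incData (hI : M.IncreasingBounds) (hS : M.Standing)
    (hD : M.DataRestrictions) {d : Fin 2} (hd : 0 < M.rate d 1 0) :
    ∃ e : ℝ ≃o ℝ, CicData (interior M.suppY) (M.F d 0 1) (M.treatedF d) e (M.lam 0 d) (M.lam 1 d) ∧
      IncData (M.F d 0 1) (M.treatedF d) e (M.lam 0 d) (M.lam 1 d) ∧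
      (∀ x, e (M.F d 0 0 x) = M.F d 1 0 x) ∧
      M.cicLow d = cLow (M.F d 0 1) (M.treatedF d) e (M.lam 0 d) (M.lam 1 d) ∧
      M.cicHigh d = cHigh (M.F d 0 1) (M.treatedF d) e (M.lam 0 d) (M.lam 1 d) := by
  obtain ⟨e, h, he, hH, hHinv⟩ := hI.exists_cicData hS hD hd
  have hm := hI.2 d hd
  have hl : 1 - M.lam 0 d ≠ 0 := sub_ne_zero.2 h.l_ne.symm
  have hf0 := fun y => h.hf.nonneg y
  have hf1 := fun y => h.hf.le_one y
  have CL : ∀ y, M.Cop d (M.Tlow d) y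
      = cLow (M.F d 0 1) (M.treatedF d) e (M.lam 0 d) (M.lam 1 d) y := by
    intro y
    rw [cop_eq_unmix hd fun y => hH _ ?_, cLow]
    · simp only [Gop_Tlow_eq hHinv]
    · rw [Gop_Tlow_eq hHinv]
      exact ⟨h.phiLow_nonneg (hf0 y), h.phiLow_le_one (hf1 y)⟩
  have CH : ∀ y, M.Cop d (M.Thigh d) y
      = cHigh (M.F d 0 1) (M.treatedF d) e (M.lam 0 d) (M.lam 1 d) y := by
    intro y
    rw [cop_eq_unmix hd fun y => hH _ ?_, cHigh]
    · simp only [Gop_Thigh_eq hHinv]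
    · rw [Gop_Thigh_eq hHinv]
      have h1 := phiLow_reflect (e := e) (l' := M.lam 1 d) h.l_ne (M.F d 0 1 y) (M.treatedF d y)
      have h2 := h.reflect.phiLow_nonneg (a := 1 - M.F d 0 1 y) (b := 1 - M.treatedF d y)
        (sub_nonneg.2 (hf1 y))
      have h3 := h.reflect.phiLow_le_one (a := 1 - M.F d 0 1 y) (b := 1 - M.treatedF d y)
        (by linarith [hf0 y])
      constructor <;> linarith
  -- The functions at hand depend on `y` only through the two regular cdfs, so they are constant
  -- where `F_{d01}` is `0` and where it is `1`. This extends monotonicity from the support to the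
  -- whole line.
  have e0 : ∀ {T : ℝ → ℝ} {φ : ℝ → ℝ → ℝ}, (∀ y, T y = φ (M.F d 0 1 y) (M.treatedF d y)) →
      ∀ x y, M.F d 0 1 x = 0 → M.F d 0 1 y = 0 → T x = T y := fun hT x y hx hy => by
    rw [hT, hT, hx, hy, h.hf.zero_of_zero h.hg hx, h.hf.zero_of_zero h.hg hy]
  have e1 : ∀ {T : ℝ → ℝ} {φ : ℝ → ℝ → ℝ}, (∀ y, T y = φ (M.F d 0 1 y) (M.treatedF d y)) →
      ∀ x y, M.F d 0 1 x = 1 → M.F d 0 1 y = 1 → T x = T y := fun hT x y hx hy => by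
    rw [hT, hT, hx, hy, h.hf.one_of_one h.hg hx, h.hf.one_of_one h.hg hy]
  have mono : ∀ {T : ℝ → ℝ} {φ : ℝ → ℝ → ℝ}, (∀ y, T y = φ (M.F d 0 1 y) (M.treatedF d y)) →
      (Continuous fun p : ℝ × ℝ => φ p.1 p.2) → MonotoneOn T M.suppY → Monotone T := by
    intro T φ hT hφ hTm
    refine h.hf.monotone_of_monotoneOn ?_ (hTm.mono interior_subset) (e0 hT) (e1 hT)
    rw [show T = fun y => φ (M.F d 0 1 y) (M.treatedF d y) from funext hT]
    exact hφ.comp (h.hf.cont.prodMk h.hg.cont)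
  have cphi : ∀ {φ : ℝ → ℝ → ℝ}, (Continuous fun p : ℝ × ℝ => φ p.1 p.2) →
      Continuous fun p : ℝ × ℝ => (e (φ p.1 p.2) - M.lam 1 d * p.2) / (1 - M.lam 1 d) :=
    fun hφ => ((e.continuous.comp hφ).sub (continuous_const.mul continuous_snd)).div_const _
  have hCL := mono CL (φ := fun a b =>
    (e (phiLow e (M.lam 0 d) (M.lam 1 d) a b) - M.lam 1 d * b) / (1 - M.lam 1 d))
    (cphi (continuous_phiLow _ _ _)) hm.2.2.2.2.1
  have hCH := mono CH (φ := fun a b =>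
    (e (phiHigh e (M.lam 0 d) (M.lam 1 d) a b) - M.lam 1 d * b) / (1 - M.lam 1 d))
    (cphi (continuous_phiHigh _ _ _)) hm.2.2.2.2.2
  have hTL := mono (Tlow_eq hHinv) (φ := tLow e (M.lam 0 d) (M.lam 1 d)) (by
    have h1 := e.symm.continuous
    have h2 := continuous_M01
    unfold tLow
    fun_prop) hm.1
  have hTH := mono (Thigh_eq hHinv) (φ := tHigh e (M.lam 0 d) (M.lam 1 d)) (by
    have h1 := e.symm.continuous
    have h2 := continuous_M01
    unfold tHigh
    fun_prop) hm.2.1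
  refine ⟨e, h, ⟨⟨?_, ?_⟩, ⟨?_, ?_⟩⟩, he, ?_, ?_⟩
  -- Unmixing `G_d(T)` gives back `T`, so the constraint on `K` is monotonicity of `T̲_d`, while
  -- that on `C` is monotonicity of `C_d(T̲_d)`.
  · convert hTL using 1
    ext y
    rw [Tlow_eq hHinv, unmix, phiLow]
    field_simp
    ring
  · rwa [funext CL] at hCL
  · convert hTH using 1
    ext y
    rw [Thigh_eq hHinv, unmix, phiHigh]
    field_simp
    ring
  · rwa [funext CH] at hCH
  -- Once `C_d(T̲_d)` is nondecreasing on the line, its supremum over `y' ≤ y` is attained at `y`.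
  · ext y
    rw [← CL, cicLow]
    exact (hCL.map_isGreatest isGreatest_Iic).csSup_eq
  · ext y
    rw [← CH, cicHigh]
    exact (hCH.map_isLeast isLeast_Ici).csInf_eq

end FuzzyDiD

/-! ### Independence criteria and quantities determined by the observed law -/

lemma measure_ext_of_real {α : Type*} [MeasurableSpace α] {μ ν : Measure α} [IsFiniteMeasure μ]
    [IsFiniteMeasure ν] (h : ∀ A, MeasurableSet A → μ.real A = ν.real A) : μ = ν :=
  Measure.ext fun A hA => (measureReal_eq_measureReal_iff).1 (h A hA)

/-- Splitting an event according to a finite-valued variable. -/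
lemma real_eq_sum_inter {Ω α : Type*} [MeasurableSpace Ω] [Fintype α] [MeasurableSpace α]
    [MeasurableSingletonClass α] (P : Measure Ω) [IsFiniteMeasure P] {f : Ω → α}
    (hf : Measurable f) (S : Set Ω) : P.real S = ∑ a, P.real (S ∩ {ω | f ω = a}) := by
  have h1 := sum_measureReal_preimage_singleton (μ := P.restrict S) (f := f) Finset.univ
    fun a _ => hf (measurableSet_singleton a)
  rw [Finset.coe_univ, Set.preimage_univ, measureReal_restrict_apply_univ] at h1
  rw [← h1]
  refine Finset.sum_congr rfl fun a _ => ?_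
  rw [measureReal_restrict_apply (hf (measurableSet_singleton a)), Set.inter_comm]
  rfl

/-- If `U` has the same conditional law given each value of a discrete `T`, it is independent of
`T`. -/
lemma indepFun_cond_of_factor {Ω α : Type*} [MeasurableSpace Ω] [Fintype α] [MeasurableSpace α]
    [MeasurableSingletonClass α] (P : Measure Ω) [IsProbabilityMeasure P] {U : Ω → ℝ} {T : Ω → α}
    (hT : Measurable T) {A : Set Ω} (hA : MeasurableSet A) {ζ : Measure ℝ}
    (h : ∀ t B, MeasurableSet B →
      P.real (A ∩ {ω | T ω = t} ∩ U ⁻¹' B) = P.real (A ∩ {ω | T ω = t}) * ζ.real B) :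
    IndepFun U T (cond P A) := by
  by_cases h0 : P A = 0
  · rw [cond_eq_zero_of_meas_eq_zero h0]
    exact indepFun_iff_measure_inter_preimage_eq_mul.2 fun s t _ _ => by simp
  have := cond_isProbabilityMeasure h0
  have key : ∀ B C, MeasurableSet B →
      P.real (A ∩ (U ⁻¹' B ∩ T ⁻¹' C)) = P.real (A ∩ T ⁻¹' C) * ζ.real B := by
    intro B C hB
    rw [real_eq_sum_inter P hT, real_eq_sum_inter P hT (A ∩ T ⁻¹' C), Finset.sum_mul]
    refine Finset.sum_congr rfl fun t _ => ?_
    by_cases ht : t ∈ C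
    · have e1 : A ∩ (U ⁻¹' B ∩ T ⁻¹' C) ∩ {ω | T ω = t} = A ∩ {ω | T ω = t} ∩ U ⁻¹' B := by
        ext ω
        simp only [Set.mem_inter_iff, Set.mem_preimage, Set.mem_ofPred_eq]
        constructor
        · rintro ⟨⟨a, b, -⟩, c⟩; exact ⟨⟨a, c⟩, b⟩
        · rintro ⟨⟨a, c⟩, b⟩; exact ⟨⟨a, b, c ▸ ht⟩, c⟩
      have e2 : A ∩ T ⁻¹' C ∩ {ω | T ω = t} = A ∩ {ω | T ω = t} := by
        ext ω
        simp only [Set.mem_inter_iff, Set.mem_preimage, Set.mem_ofPred_eq]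
        constructor
        · rintro ⟨⟨a, -⟩, c⟩; exact ⟨a, c⟩
        · rintro ⟨a, c⟩; exact ⟨⟨a, c ▸ ht⟩, c⟩
      rw [e1, e2, h t B hB]
    · have e1 : A ∩ (U ⁻¹' B ∩ T ⁻¹' C) ∩ {ω | T ω = t} = ∅ :=
        Set.eq_empty_of_forall_notMem fun ω hω => ht (hω.2 ▸ hω.1.2.2)
      have e2 : A ∩ T ⁻¹' C ∩ {ω | T ω = t} = ∅ :=
        Set.eq_empty_of_forall_notMem fun ω hω => ht (hω.2 ▸ hω.1.2)
      rw [e1, e2]; simp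
  have hA0 : P.real A ≠ 0 := fun h => h0 ((measureReal_eq_zero_iff).1 h)
  refine indepFun_iff_measure_inter_preimage_eq_mul.2 fun B C hB _ => ?_
  rw [← ENNReal.toReal_eq_toReal_iff' (measure_ne_top _ _) (ENNReal.mul_ne_top (measure_ne_top _ _) (measure_ne_top _ _)),
    ENNReal.toReal_mul]
  change (cond P A).real _ = (cond P A).real _ * (cond P A).real _
  have k2 := key B Set.univ hB
  rw [Set.preimage_univ, Set.inter_univ, Set.inter_univ] at k2
  rw [cond_real_apply P hA, cond_real_apply P hA, cond_real_apply P hA, key B C hB, k2]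
  field_simp

namespace FuzzyDiD

universe v

section Congruence

variable {M : FuzzyDiD.{u}} {N : FuzzyDiD.{v}}

variable (M) in
/-- The observed variables. -/
def obs (ω : M.Ω) : Fin 2 × Fin 2 × Fin 2 × ℝ := (M.D ω, M.G ω, M.T ω, M.Yobs ω)

variable (M) in
lemma measurable_obs : Measurable M.obs :=
  M.measurable_D.prodMk (M.measurable_G.prodMk (M.measurable_T.prodMk M.measurable_Yobs))

variable (M) in
lemma obsLaw_real {S : Set (Fin 2 × Fin 2 × Fin 2 × ℝ)} (hS : MeasurableSet S) :
    M.obsLaw.real S = M.P.real (M.obs ⁻¹' S) := map_measureReal_apply M.measurable_obs hS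

lemma obsLaw_congr_real (h : N.obsLaw = M.obsLaw) {S : Set (Fin 2 × Fin 2 × Fin 2 × ℝ)}
    (hS : MeasurableSet S) : N.P.real (N.obs ⁻¹' S) = M.P.real (M.obs ⁻¹' S) := by
  rw [← obsLaw_real N hS, ← obsLaw_real M hS, h]

instance : IsProbabilityMeasure M.obsLaw :=
  Measure.isProbabilityMeasure_map M.measurable_obs.aemeasurable

variable (M) in
lemma map_Yobs : M.P.map M.Yobs = M.obsLaw.map fun x => x.2.2.2 :=
  (Measure.map_map (by fun_prop : Measurable fun x : Fin 2 × Fin 2 × Fin 2 × ℝ => x.2.2.2)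
    M.measurable_obs).symm

/-- The law of the observed variables is determined by the outcome distributions in the cells. -/
lemma obsLaw_eq_of_cells (h : ∀ d g t A, MeasurableSet A →
    N.P.real (N.dcell d g t ∩ N.Yobs ⁻¹' A) = M.P.real (M.dcell d g t ∩ M.Yobs ⁻¹' A)) :
    N.obsLaw = M.obsLaw := by
  refine measure_ext_of_real fun S hS => ?_
  rw [obsLaw_real N hS, obsLaw_real M hS,
    real_eq_sum_inter N.P (N.measurable_D.prodMk (N.measurable_G.prodMk N.measurable_T)),
    real_eq_sum_inter M.P (M.measurable_D.prodMk (M.measurable_G.prodMk M.measurable_T))]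
  refine Finset.sum_congr rfl ?_
  rintro ⟨d, g, t⟩ -
  have hm : MeasurableSet {y : ℝ | (d, g, t, y) ∈ S} :=
    hS.preimage (by fun_prop : Measurable fun y : ℝ => (d, g, t, y))
  have := h d g t _ hm
  convert this using 2
  · ext ω
    simp only [obs, dcell, Set.mem_inter_iff, Set.mem_preimage, Set.mem_ofPred_eq, Prod.mk.injEq]
    constructor
    · rintro ⟨a, rfl, rfl, rfl⟩; exact ⟨⟨rfl, rfl, rfl⟩, a⟩
    · rintro ⟨⟨rfl, rfl, rfl⟩, a⟩; exact ⟨a, rfl, rfl, rfl⟩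
  · ext ω
    simp only [obs, dcell, Set.mem_inter_iff, Set.mem_preimage, Set.mem_ofPred_eq, Prod.mk.injEq]
    constructor
    · rintro ⟨a, rfl, rfl, rfl⟩; exact ⟨⟨rfl, rfl, rfl⟩, a⟩
    · rintro ⟨⟨rfl, rfl, rfl⟩, a⟩; exact ⟨a, rfl, rfl, rfl⟩

variable (h : N.obsLaw = M.obsLaw)
include h

lemma real_dcell_inter_congr (d g t : Fin 2) {A : Set ℝ} (hA : MeasurableSet A) :
    N.P.real (N.dcell d g t ∩ N.Yobs ⁻¹' A) = M.P.real (M.dcell d g t ∩ M.Yobs ⁻¹' A) := by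
  have := obsLaw_congr_real h ((measurableSet_singleton d).prod
    ((measurableSet_singleton g).prod ((measurableSet_singleton t).prod hA)))
  convert this using 2
  all_goals
    ext ω
    simp only [obs, dcell, Set.mem_inter_iff, Set.mem_preimage, Set.mem_ofPred_eq, Set.mem_prod,
      Set.mem_singleton_iff, and_assoc]

lemma real_dcell_congr (d g t : Fin 2) : N.P.real (N.dcell d g t) = M.P.real (M.dcell d g t) := by
  simpa using real_dcell_inter_congr h d g t MeasurableSet.univ

lemma real_cell_congr (g t : Fin 2) : N.P.real (N.cell g t) = M.P.real (M.cell g t) := by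
  have := obsLaw_congr_real h (MeasurableSet.univ.prod
    ((measurableSet_singleton g).prod ((measurableSet_singleton t).prod MeasurableSet.univ)))
  convert this using 2
  all_goals
    ext ω
    simp [obs, cell]

lemma rate_congr (d g t : Fin 2) : N.rate d g t = M.rate d g t := by
  have h1 := N.real_dcell d g t
  rw [real_dcell_congr h, real_cell_congr h, M.real_dcell] at h1
  exact (mul_left_cancel₀ (M.cell_real_pos g t).ne' h1).symm

lemma cellLaw_congr (d g t : Fin 2) : N.cellLaw d g t = M.cellLaw d g t := by
  have i1 : IsFiniteMeasure (N.cellLaw d g t) := by unfold cellLaw; infer_instance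
  have i2 : IsFiniteMeasure (M.cellLaw d g t) := by unfold cellLaw; infer_instance
  refine measure_ext_of_real fun A hA => ?_
  rw [cellLaw, cellLaw, map_measureReal_apply N.measurable_Yobs hA,
    map_measureReal_apply M.measurable_Yobs hA, cond_real_apply _ (N.measurableSet_dcell d g t),
    cond_real_apply _ (M.measurableSet_dcell d g t), real_dcell_congr h,
    real_dcell_inter_congr h d g t hA]

lemma F_congr : N.F = M.F := by
  ext d g t y
  rw [F_eq, F_eq, cellLaw_congr h]

lemma rate_congr' : N.rate = M.rate := by
  ext d g t; exact rate_congr h d g t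

lemma suppY_congr : N.suppY = M.suppY := by
  rw [suppY, suppY, N.map_Yobs, M.map_Yobs, h]

lemma suppYcell_congr (d g t : Fin 2) : N.suppYcell d g t = M.suppYcell d g t :=
  congrArg Measure.support (cellLaw_congr h d g t)

lemma yLow_congr : N.yLow = M.yLow := by rw [yLow, yLow, suppY_congr h]

lemma yHigh_congr : N.yHigh = M.yHigh := by rw [yHigh, yHigh, suppY_congr h]

lemma lam_congr : N.lam = M.lam := by
  ext g d; rw [lam, lam, rate_congr' h]

lemma H_congr : N.H = M.H := by
  ext d x; rw [H, H, F_congr h]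

lemma Hinv_congr : N.Hinv = M.Hinv := by
  ext d q; rw [Hinv, Hinv, H_congr h]

lemma cicLow_congr : N.cicLow = M.cicLow := by
  have hG : N.Gop = M.Gop := by ext d T y; rw [Gop, Gop, lam_congr h, F_congr h]
  have hC : N.Cop = M.Cop := by
    ext d T y; rw [Cop, Cop, rate_congr' h, F_congr h, H_congr h, hG]
  have hT : N.Tlow = M.Tlow := by
    ext d y; rw [Tlow, Tlow, lam_congr h, F_congr h, Hinv_congr h]
  ext d y
  rw [cicLow, cicLow, hC, hT]

lemma cicHigh_congr : N.cicHigh = M.cicHigh := by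
  have hG : N.Gop = M.Gop := by ext d T y; rw [Gop, Gop, lam_congr h, F_congr h]
  have hC : N.Cop = M.Cop := by
    ext d T y; rw [Cop, Cop, rate_congr' h, F_congr h, H_congr h, hG]
  have hT : N.Thigh = M.Thigh := by
    ext d y; rw [Thigh, Thigh, lam_congr h, F_congr h, Hinv_congr h]
  ext d y
  rw [cicHigh, cicHigh, hC, hT]

lemma cicLowOn_congr : N.cicLowOn = M.cicLowOn := by
  ext d y; rw [cicLowOn, cicLowOn, yLow_congr h, yHigh_congr h, cicLow_congr h]

lemma cicHighOn_congr : N.cicHighOn = M.cicHighOn := by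
  ext d y; rw [cicHighOn, cicHighOn, yLow_congr h, yHigh_congr h, cicHigh_congr h]

lemma FirstStage.congr (hM : M.FirstStage) : N.FirstStage := by
  rw [FirstStage, rate_congr' h]; exact hM

lemma DataRestrictions.congr (hM : M.DataRestrictions) : N.DataRestrictions := by
  rw [DataRestrictions, rate_congr' h, suppY_congr h, F_congr h]
  refine ⟨hM.1, fun d g t hr => ?_⟩
  rw [suppYcell_congr h]
  exact hM.2 d g t hr

end Congruence

lemma Admissible.standing {M : FuzzyDiD.{u}} {N : FuzzyDiD.{0}} (hN : M.Admissible N)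
    (hS : M.Standing) : N.Standing := by
  refine ⟨hN.2.1, hN.2.2.1, fun t => ?_, ?_⟩
  · rw [rate_congr hN.1]; exact hS.rate_mem t
  · rw [rate_congr hN.1, rate_congr hN.1]; exact hS.change

end FuzzyDiD

/-! ### Processes built from prescribed stratum laws -/

namespace FuzzyDiD

universe v

/-- Stratum of units of the cell `(g, t)` with `D(0) = a` and `D(1) = b`. -/
def atom (M : FuzzyDiD.{u}) (g t a b : Fin 2) : Set M.Ω :=
  M.cell g t ∩ M.V ⁻¹' (M.thr g 0 a ∩ M.thr g 1 b)

/-- Probability of the stratum `D(0) = a`, `D(1) = b` in group `g`. -/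
def share (M : FuzzyDiD.{u}) (g a b : Fin 2) : ℝ := (M.propLaw g).real (M.thr g 0 a ∩ M.thr g 1 b)

lemma mem_atom (M : FuzzyDiD.{u}) (g t a b : Fin 2) (ω : M.Ω) :
    ω ∈ M.atom g t a b ↔ M.G ω = g ∧ M.T ω = t ∧ M.Dpot 0 ω = a ∧ M.Dpot 1 ω = b := by
  simp only [atom, cell, Set.mem_inter_iff, Set.mem_ofPred_eq, Set.mem_preimage, Dpot_eq_iff]
  constructor
  · rintro ⟨⟨rfl, rfl⟩, h1, h2⟩; exact ⟨rfl, rfl, h1, h2⟩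
  · rintro ⟨rfl, rfl, h1, h2⟩; exact ⟨⟨rfl, rfl⟩, h1, h2⟩

lemma fin2_sum (d : Fin 2) (f : Fin 2 → ℝ) : ∑ x, f x = f d + f (1 - d) := by
  fin_cases d
  · simp [Fin.sum_univ_two]
  · simp [Fin.sum_univ_two, add_comm]

lemma fin2_one_sub_ne (d : Fin 2) : 1 - d ≠ d := by revert d; decide

section Shares

variable {M : FuzzyDiD.{u}} (hP : M.Participation)
include hP

lemma Participation.real_atom (g t a b : Fin 2) :
    M.P.real (M.atom g t a b) = M.P.real (M.cell g t) * M.share g a b :=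
  hP.real_cell_inter g t ((M.measurableSet_thr g 0 a).inter (M.measurableSet_thr g 1 b))

lemma Participation.sum_share_right (g a : Fin 2) : ∑ b, M.share g a b = M.rate a g 0 := by
  rw [hP.rate_eq]
  have hm : Measurable fun x : ℝ => if M.v g 1 ≤ x then (1 : Fin 2) else 0 :=
    Measurable.ite measurableSet_Ici measurable_const measurable_const
  exact (real_eq_sum_inter (M.propLaw g) hm _).symm

lemma Participation.sum_share_left (g b : Fin 2) : ∑ a, M.share g a b = M.rate b g 1 := by
  rw [hP.rate_eq]
  have hm : Measurable fun x : ℝ => if M.v g 0 ≤ x then (1 : Fin 2) else 0 :=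
    Measurable.ite measurableSet_Ici measurable_const measurable_const
  rw [real_eq_sum_inter (M.propLaw g) hm]
  refine Finset.sum_congr rfl fun a _ => ?_
  rw [share, Set.inter_comm]
  rfl

/-- When `d` becomes more frequent, nestedness of the half-lines leaves no unit moving away from
`d`, and the two marginal sums determine the other shares. -/
lemma Participation.shares_of_lt {d g : Fin 2} (h : M.rate d g 0 < M.rate d g 1) :
    M.share g d d = M.rate d g 0 ∧ M.share g d (1 - d) = 0 ∧
      M.share g (1 - d) d = M.rate d g 1 - M.rate d g 0 := by
  have h1 := hP.sum_share_right g d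
  have h2 := hP.sum_share_left g d
  rw [fin2_sum d] at h1 h2
  have h3 : M.share g d (1 - d) = 0 := by
    have : M.thr g 0 d ∩ M.thr g 1 (1 - d) = ∅ := Set.eq_empty_of_forall_notMem fun x hx =>
      fin2_one_sub_ne d (hx.2.symm.trans (hP.thr_subset h hx.1))
    rw [share, this, measureReal_empty]
  exact ⟨by linarith, h3, by linarith⟩

lemma Participation.shares_of_gt {d g : Fin 2} (h : M.rate d g 1 < M.rate d g 0) :
    M.share g d d = M.rate d g 1 ∧ M.share g (1 - d) d = 0 ∧
      M.share g d (1 - d) = M.rate d g 0 - M.rate d g 1 := by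
  have h1 := hP.sum_share_right g d
  have h2 := hP.sum_share_left g d
  rw [fin2_sum d] at h1 h2
  have hs : M.thr g 1 d ⊆ M.thr g 0 d := by
    rcases M.thr_total g d with hs | hs
    · rw [hP.rate_eq, hP.rate_eq] at h
      exact absurd (measureReal_mono hs) (not_le.2 h)
    · exact hs
  have h3 : M.share g (1 - d) d = 0 := by
    have : M.thr g 0 (1 - d) ∩ M.thr g 1 d = ∅ := Set.eq_empty_of_forall_notMem fun x hx =>
      fin2_one_sub_ne d (hx.1.symm.trans (hs hx.2))
    rw [share, this, measureReal_empty]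
  exact ⟨by linarith, h3, by linarith⟩

end Shares

/-- Laws of the potential outcome `Y(d)` in the strata of `M` that are compatible with the data and
with the monotone, time invariant structure: `base` for the stayers in period `0`, `top` for the
stayers in period `1` when treatment `d` gets rarer, `κ` for the switchers in period `1`; `φ`
transforms the outcome in period `0` into that in period `1`. -/
structure Completion (M : FuzzyDiD.{u}) (d : Fin 2) where
  φ : ℝ ≃o ℝ
  base : Fin 2 → Measure ℝ
  top : Fin 2 → Measure ℝ
  κ : Fin 2 → Measure ℝ
  prob_base : ∀ g, IsProbabilityMeasure (base g)
  prob_top : ∀ g, IsProbabilityMeasure (top g)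
  prob_κ : ∀ g, IsProbabilityMeasure (κ g)
  base_eq : ∀ g, 0 < M.rate d g 0 → base g = M.cellLaw d g 0
  top_eq : ∀ g, 0 < M.rate d g 1 → top g = M.cellLaw d g 1
  base_supp : ∀ g, base g M.suppYᶜ = 0
  top_supp : ∀ g, top g M.suppYᶜ = 0
  κ_supp : ∀ g, κ g M.suppYᶜ = 0
  φ_mem : ∀ x, φ x ∈ M.suppY ↔ x ∈ M.suppY
  mix : ∀ g A, MeasurableSet A → M.rate d g 1 * (top g).real A
    + (M.rate d g 0 - M.rate d g 1) * (κ g).real A = M.rate d g 0 * ((base g).map φ).real A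

namespace Completion

attribute [instance] prob_base prob_top prob_κ

variable {M : FuzzyDiD.{u}}

/-- Law of `Y(d)` in the stratum of the cell `(g, t)` with `D(0) = a` and `D(1) = b`. -/
def law {d : Fin 2} (C : M.Completion d) (g t a b : Fin 2) : Measure ℝ :=
  if t = 0 then (if a = d then C.base g else (C.κ g).map C.φ.symm)
  else if a = d ∧ b = d then
    (if M.rate d g 1 < M.rate d g 0 then C.top g else (C.base g).map C.φ)
  else C.κ g

lemma measurable_φ {d : Fin 2} (C : M.Completion d) : Measurable C.φ := C.φ.monotone.measurable

lemma measurable_φ_symm {d : Fin 2} (C : M.Completion d) : Measurable C.φ.symm :=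
  C.φ.symm.monotone.measurable

instance {d : Fin 2} (C : M.Completion d) (g t a b : Fin 2) :
    IsProbabilityMeasure (C.law g t a b) := by
  have h1 : IsProbabilityMeasure ((C.base g).map C.φ) :=
    Measure.isProbabilityMeasure_map C.measurable_φ.aemeasurable
  have h2 : IsProbabilityMeasure ((C.κ g).map C.φ.symm) :=
    Measure.isProbabilityMeasure_map C.measurable_φ_symm.aemeasurable
  unfold law
  split_ifs <;> infer_instance

lemma measurableSet_suppY : MeasurableSet M.suppY := Measure.isClosed_support.measurableSet

lemma law_supp {d : Fin 2} (C : M.Completion d) (g t a b : Fin 2) :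
    (C.law g t a b).real M.suppYᶜ = 0 := by
  have h1 : (C.base g).map C.φ M.suppYᶜ = 0 := by
    rw [Measure.map_apply C.measurable_φ measurableSet_suppY.compl, ← C.base_supp g]
    congr 1
    ext x
    exact not_congr (C.φ_mem x)
  have h2 : (C.κ g).map C.φ.symm M.suppYᶜ = 0 := by
    rw [Measure.map_apply C.measurable_φ_symm measurableSet_suppY.compl, ← C.κ_supp g]
    congr 1
    ext x
    refine not_congr ?_
    rw [← C.φ_mem, C.φ.apply_symm_apply]
  rw [measureReal_def, ENNReal.toReal_eq_zero_iff]
  left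
  unfold law
  split_ifs
  · exact C.base_supp g
  · exact h2
  · exact C.top_supp g
  · exact h1
  · exact C.κ_supp g

variable (M) in
/-- Group, period and propensity. -/
def gtv (ω : M.Ω) : Fin 2 × Fin 2 × ℝ := (M.G ω, M.T ω, M.V ω)

variable (M) in
lemma measurable_gtv : Measurable (gtv M) :=
  M.measurable_G.prodMk (M.measurable_T.prodMk M.measurable_V)

variable (M) in
/-- Treatment status at period `t` as a function of group, period and propensity. -/
def status (t : Fin 2) (w : Fin 2 × Fin 2 × ℝ) : Fin 2 := if M.v w.1 t ≤ w.2.2 then 1 else 0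

variable (M) in
lemma measurable_status (t : Fin 2) : Measurable (status M t) := by
  refine Measurable.ite ?_ measurable_const measurable_const
  exact measurableSet_le ((measurable_of_finite fun g => M.v g t).comp measurable_fst)
    measurable_snd.snd

variable (C : ∀ d, M.Completion d)

/-- Joint law of independent draws from all the stratum laws. -/
def draws : Measure (Fin 2 × Fin 2 × Fin 2 × Fin 2 × Fin 2 → ℝ) :=
  Measure.pi fun j => (C j.1).law j.2.1 j.2.2.1 j.2.2.2.1 j.2.2.2.2

instance : IsProbabilityMeasure (draws C) := by unfold draws; infer_instance

instance : IsProbabilityMeasure (M.P.map (gtv M)) :=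
  Measure.isProbabilityMeasure_map (measurable_gtv M).aemeasurable

lemma prod_real (A : Set (Fin 2 × Fin 2 × ℝ))
    (B : Set (Fin 2 × Fin 2 × Fin 2 × Fin 2 × Fin 2 → ℝ)) :
    ((M.P.map (gtv M)).prod (draws C)).real (A ×ˢ B)
      = (M.P.map (gtv M)).real A * (draws C).real B := measureReal_prod_prod A B

/-- The data generating process with the group, period and propensity of `M` and with potential
outcomes drawn from the stratum laws. -/
def toModel : FuzzyDiD.{0} where
  Ω := (Fin 2 × Fin 2 × ℝ) × (Fin 2 × Fin 2 × Fin 2 × Fin 2 × Fin 2 → ℝ)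
  P := (M.P.map (gtv M)).prod (draws C)
  G ω := ω.1.1
  T ω := ω.1.2.1
  V ω := ω.1.2.2
  v := M.v
  Y d ω := ω.2 (d, ω.1.1, ω.1.2.1, status M 0 ω.1, status M 1 ω.1)
  measurable_G := by fun_prop
  measurable_T := by fun_prop
  measurable_V := by fun_prop
  measurable_Y d := by
    have h1 : Measurable fun p : (Fin 2 × Fin 2 × Fin 2 × Fin 2 × Fin 2) ×
        (Fin 2 × Fin 2 × Fin 2 × Fin 2 × Fin 2 → ℝ) => p.2 p.1 :=
      measurable_from_prod_countable_right fun j => measurable_pi_apply j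
    have h2 := measurable_status M 0
    have h3 := measurable_status M 1
    exact h1.comp (by fun_prop : Measurable fun ω : (Fin 2 × Fin 2 × ℝ) ×
      (Fin 2 × Fin 2 × Fin 2 × Fin 2 × Fin 2 → ℝ) =>
        ((d, ω.1.1, ω.1.2.1, status M 0 ω.1, status M 1 ω.1), ω.2))
  cell_pos g t := by
    have h1 : {ω : (Fin 2 × Fin 2 × ℝ) × (Fin 2 × Fin 2 × Fin 2 × Fin 2 × Fin 2 → ℝ) |
        ω.1.1 = g ∧ ω.1.2.1 = t} = {w | w.1 = g ∧ w.2.1 = t} ×ˢ Set.univ := by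
      ext ω; simp
    have hm : MeasurableSet {w : Fin 2 × Fin 2 × ℝ | w.1 = g ∧ w.2.1 = t} :=
      (measurable_fst (measurableSet_singleton g)).inter
        (measurable_snd.fst (measurableSet_singleton t))
    rw [h1, Measure.prod_prod, measure_univ, mul_one, Measure.map_apply (measurable_gtv M) hm]
    exact M.cell_pos g t

lemma toModel_real {A : Set (Fin 2 × Fin 2 × ℝ)} (hA : MeasurableSet A) :
    (toModel C).P.real {ω | ω.1 ∈ A} = M.P.real (gtv M ⁻¹' A) := by
  have h1 : {ω : (toModel C).Ω | ω.1 ∈ A} = A ×ˢ Set.univ := by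
    ext ω
    exact ⟨fun h => ⟨h, trivial⟩, fun h => h.1⟩
  rw [h1]
  refine (prod_real C A Set.univ).trans ?_
  rw [probReal_univ, mul_one, map_measureReal_apply (measurable_gtv M) hA]

lemma toModel_cell_inter (g t : Fin 2) {B : Set ℝ} (hB : MeasurableSet B) :
    (toModel C).P.real ((toModel C).cell g t ∩ (toModel C).V ⁻¹' B)
      = M.P.real (M.cell g t ∩ M.V ⁻¹' B) := by
  have hm : MeasurableSet {w : Fin 2 × Fin 2 × ℝ | (w.1 = g ∧ w.2.1 = t) ∧ w.2.2 ∈ B} :=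
    ((measurable_fst (measurableSet_singleton g)).inter
      (measurable_snd.fst (measurableSet_singleton t))).inter (measurable_snd.snd hB)
  exact toModel_real C hm

lemma toModel_cell (g t : Fin 2) :
    (toModel C).P.real ((toModel C).cell g t) = M.P.real (M.cell g t) := by
  simpa using toModel_cell_inter C g t MeasurableSet.univ

/-- On one stratum `Y(d)` reads one fixed coordinate of the draws, which is independent of group,
period and propensity. -/
lemma toModel_atom_inter (d g t a b : Fin 2) {B : Set ℝ} (hB : MeasurableSet B) :
    (toModel C).P.real ((toModel C).atom g t a b ∩ (toModel C).Y d ⁻¹' B)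
      = M.P.real (M.atom g t a b) * ((C d).law g t a b).real B := by
  set A : Set (Fin 2 × Fin 2 × ℝ) := {w | (w.1 = g ∧ w.2.1 = t) ∧
    w.2.2 ∈ M.thr g 0 a ∩ M.thr g 1 b} with hA
  have hm : MeasurableSet A :=
    ((measurable_fst (measurableSet_singleton g)).inter
      (measurable_snd.fst (measurableSet_singleton t))).inter (measurable_snd.snd
        ((M.measurableSet_thr g 0 a).inter (M.measurableSet_thr g 1 b)))
  have h1 : (toModel C).atom g t a b ∩ (toModel C).Y d ⁻¹' B
      = A ×ˢ (Function.eval (d, g, t, a, b) ⁻¹' B) := by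
    ext ω
    constructor
    · rintro ⟨⟨⟨h1, h2⟩, h3, h4⟩, h5⟩
      refine ⟨⟨⟨h1, h2⟩, h3, h4⟩, ?_⟩
      have e1 : ω.1.1 = g := h1
      have e2 : ω.1.2.1 = t := h2
      have e3 : status M 0 ω.1 = a := by rw [← e1] at h3; exact h3
      have e4 : status M 1 ω.1 = b := by rw [← e1] at h4; exact h4
      have h6 : ω.2 (d, ω.1.1, ω.1.2.1, status M 0 ω.1, status M 1 ω.1) ∈ B := h5
      rw [e1, e2, e3, e4] at h6
      exact h6
    · rintro ⟨⟨⟨h1, h2⟩, h3, h4⟩, h5⟩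
      refine ⟨⟨⟨h1, h2⟩, h3, h4⟩, ?_⟩
      have e3 : status M 0 ω.1 = a := by rw [← h1] at h3; exact h3
      have e4 : status M 1 ω.1 = b := by rw [← h1] at h4; exact h4
      change ω.2 (d, ω.1.1, ω.1.2.1, status M 0 ω.1, status M 1 ω.1) ∈ B
      rw [h1, h2, e3, e4]
      exact h5
  rw [h1]
  refine (prod_real C _ _).trans ?_
  rw [map_measureReal_apply (measurable_gtv M) hm]
  congr 1
  have := (measurePreserving_eval (fun j : Fin 2 × Fin 2 × Fin 2 × Fin 2 × Fin 2 =>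
    (C j.1).law j.2.1 j.2.2.1 j.2.2.2.1 j.2.2.2.2) (d, g, t, a, b)).measureReal_preimage
    hB.nullMeasurableSet
  exact this

lemma toModel_atom (g t a b : Fin 2) :
    (toModel C).P.real ((toModel C).atom g t a b) = M.P.real (M.atom g t a b) := by
  have := toModel_atom_inter C 0 g t a b MeasurableSet.univ
  rwa [Set.preimage_univ, Set.inter_univ, probReal_univ, mul_one] at this

variable (hP : M.Participation)
include hP

lemma toModel_participation : (toModel C).Participation := by
  intro g
  refine indepFun_cond_of_factor _ (toModel C).measurable_T
    ((toModel C).measurable_G (measurableSet_singleton g)) (ζ := M.propLaw g) fun t B hB => ?_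
  have h1 := toModel_cell_inter C g t hB
  rw [hP.real_cell_inter g t hB, ← toModel_cell C g t] at h1
  exact h1

/-- Distribution of `Y(d)` over `D(0) = a` in the cell `(g, t)`. -/
lemma toModel_Dpot_zero (d g t a : Fin 2) {B : Set ℝ} (hB : MeasurableSet B) :
    (toModel C).P.real ((toModel C).cell g t ∩ {ω | (toModel C).Dpot 0 ω = a} ∩ (toModel C).Y d ⁻¹' B)
      = M.P.real (M.cell g t) * ∑ b, M.share g a b * ((C d).law g t a b).real B := by
  rw [real_eq_sum_inter _ ((toModel C).measurable_Dpot 1), Finset.mul_sum]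
  refine Finset.sum_congr rfl fun b _ => ?_
  rw [← mul_assoc, ← hP.real_atom, ← toModel_atom_inter C d g t a b hB]
  congr 1
  ext ω
  simp only [Set.mem_inter_iff, mem_atom, cell, Set.mem_ofPred_eq]
  tauto

/-- Distribution of `Y(d)` over `D(1) = b` in the cell `(g, t)`. -/
lemma toModel_Dpot_one (d g t b : Fin 2) {B : Set ℝ} (hB : MeasurableSet B) :
    (toModel C).P.real ((toModel C).cell g t ∩ {ω | (toModel C).Dpot 1 ω = b} ∩ (toModel C).Y d ⁻¹' B)
      = M.P.real (M.cell g t) * ∑ a, M.share g a b * ((C d).law g t a b).real B := by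
  rw [real_eq_sum_inter _ ((toModel C).measurable_Dpot 0), Finset.mul_sum]
  refine Finset.sum_congr rfl fun a _ => ?_
  rw [← mul_assoc, ← hP.real_atom, ← toModel_atom_inter C d g t a b hB]
  congr 1
  ext ω
  simp only [Set.mem_inter_iff, mem_atom, cell, Set.mem_ofPred_eq]
  tauto

omit hP in
lemma dcell_inter_eq (N : FuzzyDiD.{v}) (d g t : Fin 2) (B : Set ℝ) :
    N.dcell d g t ∩ N.Yobs ⁻¹' B = N.cell g t ∩ {ω | N.Dpot t ω = d} ∩ N.Y d ⁻¹' B := by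
  ext ω
  simp only [dcell, cell, Set.mem_inter_iff, Set.mem_ofPred_eq, Set.mem_preimage, Yobs]
  constructor
  · rintro ⟨⟨hd, hg, ht⟩, h⟩
    rw [hd] at h
    rw [D, ht] at hd
    exact ⟨⟨⟨hg, ht⟩, hd⟩, h⟩
  · rintro ⟨⟨⟨hg, ht⟩, hd⟩, h⟩
    have hd' : N.D ω = d := by rw [D, ht]; exact hd
    exact ⟨⟨hd', hg, ht⟩, by rw [hd']; exact h⟩

/-- In period 0 the units with `D = d` have law `base`. In period 1, if `d` gets rarer they are the
stayers, with law `top`. If `d` gets more frequent they are stayers with law `φ`-image of `base`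
together with switchers of law `κ`, and `mix` says that the whole has law `top`. -/
lemma toModel_obsLaw (hr : ∀ d g, M.rate d g 1 ≠ M.rate d g 0) : (toModel C).obsLaw = M.obsLaw := by
  refine obsLaw_eq_of_cells fun d g t B hB => ?_
  have hM : M.P.real (M.dcell d g t ∩ M.Yobs ⁻¹' B)
      = M.P.real (M.cell g t) * (M.rate d g t * (M.cellLaw d g t).real B) := by
    rw [← mul_assoc, ← M.real_dcell, cellLaw, map_measureReal_apply M.measurable_Yobs hB,
      real_mul_cond_real _ (M.measurableSet_dcell d g t)]
  rw [hM, dcell_inter_eq]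
  rcases Fin.exists_fin_two.1 ⟨t, rfl⟩ with h0 | h1
  · subst h0
    rw [toModel_Dpot_zero C hP d g 0 d hB]
    simp only [law, if_true, ← Finset.sum_mul]
    rw [hP.sum_share_right]
    rcases (M.rate_nonneg d g 0).eq_or_lt with h | h
    · rw [← h]; ring
    · rw [(C d).base_eq g h]
  · subst h1
    rw [toModel_Dpot_one C hP d g 1 d hB, fin2_sum d]
    have htop : M.rate d g 1 * ((C d).top g).real B = M.rate d g 1 * (M.cellLaw d g 1).real B := by
      rcases (M.rate_nonneg d g 1).eq_or_lt with h | h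
      · rw [← h]; ring
      · rw [(C d).top_eq g h]
    have hmix := (C d).mix g B hB
    have hne := fin2_one_sub_ne d
    rcases lt_or_gt_of_ne (hr d g) with h | h
    · obtain ⟨h1, h2, h3⟩ := hP.shares_of_gt h
      rw [h1, h2, ← htop]
      simp [law, h]
    · obtain ⟨h1, h2, h3⟩ := hP.shares_of_lt h
      rw [h1, h3, ← htop]
      simp only [law, one_ne_zero, if_false, and_self, if_true, if_neg (not_lt.2 h.le), hne,
        false_and]
      congr 1
      linarith

/-- Take `U_d = Y(d)` in period 0 and `φ⁻¹(Y(d))` in period 1, so that `h_d` is the identity, then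
`φ`. Given `D(0) ≠ d`, `U_d` has law `κ` pulled back by `φ` in both periods. Given `D(0) = d` it has
law `base` in both: by construction if `d` gets more frequent, and by `mix` if `d` gets rarer, the
law in period 1 being then a mixture of `top` and `κ`. -/
lemma toModel_monotoneInvariant (hr : ∀ d g, M.rate d g 1 ≠ M.rate d g 0) :
    (toModel C).MonotoneInvariant := by
  have hpos : ∀ t : Fin 2, t = 0 ∨ t = 1 := fun t => Fin.exists_fin_two.1 ⟨t, rfl⟩
  refine ⟨fun d ω => if (toModel C).T ω = 0 then (toModel C).Y d ω else
      (C d).φ.symm ((toModel C).Y d ω),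
    fun d u t => if t = 0 then u else (C d).φ u, fun d => ?_, fun d t => ?_, fun d => ?_,
    fun d g a => ?_⟩
  · exact Measurable.ite ((toModel C).measurable_T (measurableSet_singleton 0))
      ((toModel C).measurable_Y d) ((C d).measurable_φ_symm.comp ((toModel C).measurable_Y d))
  · rcases hpos t with rfl | rfl
    · exact fun _ _ h => by simpa using h
    · simpa using (C d).φ.strictMono
  · refine Eventually.of_forall fun ω => ?_
    rcases hpos ((toModel C).T ω) with h | h <;> simp [h]
  · refine indepFun_cond_of_factor _ (toModel C).measurable_T
      (((toModel C).measurable_G (measurableSet_singleton g)).inter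
        ((toModel C).measurableSet_Dpot 0 a))
      (ζ := if a = d then (C d).base g else ((C d).κ g).map (C d).φ.symm) fun t B hB => ?_
    set B' : Set ℝ := if t = 0 then B else (C d).φ.symm ⁻¹' B with hB'
    have mB' : MeasurableSet B' := by
      rw [hB']; split_ifs
      · exact hB
      · exact (C d).measurable_φ_symm hB
    have e1 : ∀ S : Set ℝ, MeasurableSet S →
        (toModel C).P.real ({ω | (toModel C).G ω = g} ∩ {ω | (toModel C).Dpot 0 ω = a}
          ∩ {ω | (toModel C).T ω = t} ∩ (toModel C).Y d ⁻¹' S)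
        = M.P.real (M.cell g t) * ∑ b, M.share g a b * ((C d).law g t a b).real S := by
      intro S hS
      rw [← toModel_Dpot_zero C hP d g t a hS]
      congr 1
      ext ω
      simp only [Set.mem_inter_iff, cell, Set.mem_ofPred_eq]
      tauto
    have e2 : ({ω | (toModel C).G ω = g} ∩ {ω | (toModel C).Dpot 0 ω = a})
          ∩ {ω | (toModel C).T ω = t} ∩ (fun ω => if (toModel C).T ω = 0 then (toModel C).Y d ω else
            (C d).φ.symm ((toModel C).Y d ω)) ⁻¹' B
        = {ω | (toModel C).G ω = g} ∩ {ω | (toModel C).Dpot 0 ω = a}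
          ∩ {ω | (toModel C).T ω = t} ∩ (toModel C).Y d ⁻¹' B' := by
      ext ω
      simp only [Set.mem_inter_iff, Set.mem_ofPred_eq, Set.mem_preimage]
      refine and_congr_right fun h => ?_
      rw [h.2, hB']
      split_ifs <;> rfl
    have e3 := e1 Set.univ MeasurableSet.univ
    rw [Set.preimage_univ, Set.inter_univ] at e3
    simp only [probReal_univ, mul_one] at e3
    change (toModel C).P.real (({ω | (toModel C).G ω = g} ∩ {ω | (toModel C).Dpot 0 ω = a})
          ∩ {ω | (toModel C).T ω = t} ∩ (fun ω => if (toModel C).T ω = 0 then (toModel C).Y d ω else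
            (C d).φ.symm ((toModel C).Y d ω)) ⁻¹' B) = (toModel C).P.real
            (({ω | (toModel C).G ω = g} ∩ {ω | (toModel C).Dpot 0 ω = a})
          ∩ {ω | (toModel C).T ω = t}) * _
    rw [e2, e1 B' mB', e3, mul_assoc]
    congr 1
    rcases hpos t with rfl | rfl
    · simp only [law, if_true, hB', ← Finset.sum_mul]
    · by_cases had : a = d
      · subst had
        simp only [hB', one_ne_zero, if_false, if_true]
        have hbase : (((C a).base g).map (C a).φ).real ((C a).φ.symm ⁻¹' B)
            = ((C a).base g).real B := by
          rw [map_measureReal_apply (C a).measurable_φ ((C a).measurable_φ_symm hB)]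
          congr 1
          ext x
          simp
        have hmix := (C a).mix g _ ((C a).measurable_φ_symm hB)
        rw [hbase] at hmix
        rw [fin2_sum a, fin2_sum a]
        have hne := fin2_one_sub_ne a
        rcases lt_or_gt_of_ne (hr a g) with h | h
        · obtain ⟨h1, h2, h3⟩ := hP.shares_of_gt h
          rw [h1, h3]
          simp only [law, one_ne_zero, if_false, and_self, if_true, if_pos h, hne, and_false]
          linarith
        · obtain ⟨h1, h2, h3⟩ := hP.shares_of_lt h
          rw [h1, h2]
          simp only [law, one_ne_zero, if_false, and_self, if_true, if_neg (not_lt.2 h.le), hbase]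
          ring
      · simp only [law, one_ne_zero, if_false, hB', had, false_and, ← Finset.sum_mul]
        rw [map_measureReal_apply (C d).measurable_φ_symm hB]

lemma toModel_outcomesInBounds (hr : ∀ d g, M.rate d g 1 ≠ M.rate d g 0) :
    (toModel C).OutcomesInBounds := by
  intro d
  have h0 : (toModel C).P.real ((toModel C).Y d ⁻¹' M.suppYᶜ) = 0 := by
    rw [real_eq_sum_inter _ ((toModel C).measurable_G.prodMk ((toModel C).measurable_T.prodMk
      (((toModel C).measurable_Dpot 0).prodMk ((toModel C).measurable_Dpot 1))))]
    refine Finset.sum_eq_zero ?_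
    rintro ⟨g, t, a, b⟩ -
    have h1 := toModel_atom_inter C d g t a b (measurableSet_suppY (M := M)).compl
    rw [law_supp, mul_zero] at h1
    refine le_antisymm (h1 ▸ measureReal_mono fun ω hω => ?_) measureReal_nonneg
    have h2 := hω.2
    simp only [Set.mem_ofPred_eq, Prod.mk.injEq] at h2
    exact ⟨(mem_atom _ _ _ _ _ _).2 h2, hω.1⟩
  have h1 := (measureReal_eq_zero_iff).1 h0
  have hs := suppY_congr (toModel_obsLaw C hP hr)
  filter_upwards [measure_eq_zero_iff_ae_notMem.1 h1] with ω hω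
  have hω' : (toModel C).Y d ω ∈ M.suppY := not_not.1 hω
  rw [yLow, yHigh, hs]
  exact ⟨sInf_le (Set.mem_image_of_mem _ hω'), le_sSup (Set.mem_image_of_mem _ hω')⟩

end Completion

/-- A completion of the data is an admissible data generating process, in which the law of `Y(d)`
among switchers is the prescribed one. -/
theorem Standing.admissible_toModel {M : FuzzyDiD.{u}} (hS : M.Standing) (hD : M.DataRestrictions)
    (C : ∀ d, M.Completion d) :
    M.Admissible (Completion.toModel C) ∧
      ∀ d y, (Completion.toModel C).switcherCdf d y = ((C d).κ 1).real (Set.Iic y) := by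
  have hr : ∀ d g, M.rate d g 1 ≠ M.rate d g 0 := by
    intro d g
    rcases Fin.exists_fin_two.1 ⟨g, rfl⟩ with rfl | rfl
    · exact hS.lam_control_ne d
    · exact hS.first.rate_ne d
  have hobs := Completion.toModel_obsLaw C hS.part hr
  have hpart := Completion.toModel_participation C hS.part
  have hfirst := FirstStage.congr hobs hS.first
  refine ⟨⟨hobs, hpart, hfirst, Completion.toModel_monotoneInvariant C hS.part hr,
    DataRestrictions.congr hobs hD, Completion.toModel_outcomesInBounds C hS.part hr⟩,
    fun d y => ?_⟩
  have hsw : (Completion.toModel C).switchers = (Completion.toModel C).atom 1 1 0 1 := by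
    ext ω
    rw [mem_atom]
    simp only [switchers, Set.mem_ofPred_eq]
    rcases Fin.exists_fin_two.1 ⟨(Completion.toModel C).Dpot 0 ω, rfl⟩ with h | h <;>
    rcases Fin.exists_fin_two.1 ⟨(Completion.toModel C).Dpot 1 ω, rfl⟩ with h' | h' <;>
    simp [h, h']
  have hpos := hpart.switchers_pos hfirst
  have h1 := Completion.toModel_atom_inter C d 1 1 0 1 (measurableSet_Iic (a := y))
  have hlaw : (C d).law 1 1 0 1 = (C d).κ 1 := by
    unfold Completion.law
    rcases Fin.exists_fin_two.1 ⟨d, rfl⟩ with rfl | rfl <;> simp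
  rw [hlaw, ← Completion.toModel_atom C, ← hsw] at h1
  rw [switcherCdf, condCdf, cond_real_apply _ (Completion.toModel C).measurableSet_switchers]
  refine (congrArg _ h1).trans ?_
  rw [inv_mul_cancel_left₀ hpos.ne']

end FuzzyDiD

/-! ### Completing the data from a feasible cdf -/

lemma exists_measure_of_cdf {K : ℝ → ℝ} (hm : Monotone K) (hc : Continuous K)
    (h0 : Tendsto K atBot (𝓝 0)) (h1 : Tendsto K atTop (𝓝 1)) :
    ∃ μ : Measure ℝ, IsProbabilityMeasure μ ∧ ∀ y, μ.real (Set.Iic y) = K y := by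
  let S : StieltjesFunction ℝ := ⟨K, hm, fun x => hc.continuousWithinAt⟩
  refine ⟨S.measure, S.isProbabilityMeasure h0 h1, fun y => ?_⟩
  rw [measureReal_def, S.measure_Iic h0, sub_zero, ENNReal.toReal_ofReal (hm.le_of_tendsto h0 y)]

/-- A linear relation between the cdfs of three laws is one between the laws. -/
lemma real_mix_of_Iic {μ ν ρ : Measure ℝ} [IsProbabilityMeasure μ] [IsProbabilityMeasure ν]
    [IsProbabilityMeasure ρ] {a b c : ℝ} (ha : 0 ≤ a) (hc : 0 ≤ c)
    (h : ∀ y, a * μ.real (Set.Iic y) + b * ν.real (Set.Iic y) = c * ρ.real (Set.Iic y))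
    (A : Set ℝ) : a * μ.real A + b * ν.real A = c * ρ.real A := by
  have key : ∀ {μ ν ρ : Measure ℝ} [IsProbabilityMeasure μ] [IsProbabilityMeasure ν]
      [IsProbabilityMeasure ρ] {a b c : ℝ}, 0 ≤ a → 0 ≤ b → 0 ≤ c →
      (∀ y, a * μ.real (Set.Iic y) + b * ν.real (Set.Iic y) = c * ρ.real (Set.Iic y)) →
      a * μ.real A + b * ν.real A = c * ρ.real A := by
    intro μ ν ρ _ _ _ a b c ha hb hc h
    have i1 : IsFiniteMeasure (ENNReal.ofReal a • μ) := μ.smul_finite ENNReal.ofReal_ne_top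
    have i2 : IsFiniteMeasure (ENNReal.ofReal b • ν) := ν.smul_finite ENNReal.ofReal_ne_top
    have i3 : IsFiniteMeasure (ENNReal.ofReal c • ρ) := ρ.smul_finite ENNReal.ofReal_ne_top
    have e1 : ∀ S, (ENNReal.ofReal a • μ + ENNReal.ofReal b • ν).real S
        = a * μ.real S + b * ν.real S := by
      intro S
      rw [measureReal_add_apply, measureReal_ennreal_smul_apply, measureReal_ennreal_smul_apply,
        ENNReal.toReal_ofReal ha, ENNReal.toReal_ofReal hb]
    have e2 : ∀ S, (ENNReal.ofReal c • ρ).real S = c * ρ.real S := by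
      intro S
      rw [measureReal_ennreal_smul_apply, ENNReal.toReal_ofReal hc]
    have : ENNReal.ofReal a • μ + ENNReal.ofReal b • ν = ENNReal.ofReal c • ρ :=
      Measure.ext_of_Iic _ _ fun y => (measureReal_eq_measureReal_iff).1 (by rw [e1, e2, h])
    rw [← e1, ← e2, this]
  rcases le_total 0 b with hb | hb
  · exact key ha hb hc h
  -- A negative coefficient is moved to the other side, so that both members are genuine measures
  -- and agree because they agree on half-lines.
  · have := key (μ := ρ) (ν := ν) (ρ := μ) hc (neg_nonneg.2 hb) ha fun y => by linarith [h y]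
    linarith

/-- Two regular cdfs on the same interval differ by a change of variable. -/
lemma RegCdf.exists_change_of_variable {I : Set ℝ} {Φ p : ℝ → ℝ} (hΦ : RegCdf I Φ)
    (hp : RegCdf I p) : ∃ φ : ℝ ≃o ℝ, (∀ x, Φ (φ x) = p x) ∧ ∀ x, φ x ≠ x → φ x ∈ I ∧ x ∈ I := by
  have hex : ∀ x, ∃ y, x ∈ I → y ∈ I ∧ Φ y = p x := by
    intro x
    by_cases hx : x ∈ I
    · obtain ⟨y, hy, h⟩ := hΦ.exists_eq ((hp.mem_iff x).1 hx).1 ((hp.mem_iff x).1 hx).2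
      exact ⟨y, fun _ => ⟨hy, h⟩⟩
    · exact ⟨0, fun h => absurd h hx⟩
  choose ψ hψ using hex
  obtain ⟨φ, h1, h2⟩ := exists_orderIso_extend hp.ordConnected (ψ := ψ)
    (fun x hx y hy hxy => hΦ.mono.reflect_lt (by
      rw [(hψ x hx).2, (hψ y hy).2]; exact hp.strict hx hy hxy))
    (fun x hx => (hψ x hx).1)
    (fun y hy => by
      obtain ⟨x, hx, h⟩ := hp.exists_eq ((hΦ.mem_iff y).1 hy).1 ((hΦ.mem_iff y).1 hy).2
      exact ⟨x, hx, hΦ.strict.injOn (hψ x hx).1 hy ((hψ x hx).2.trans h)⟩)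
  refine ⟨φ, fun x => ?_, fun x hx => ?_⟩
  · by_cases hx : x ∈ I
    · rw [h1 x hx, (hψ x hx).2]
    · rw [h2 x hx]
      rcases hΦ.eq_zero_or_one hx with h | h
      · rw [h, hΦ.zero_of_zero hp h]
      · rw [h, hΦ.one_of_one hp h]
  · have hxI : x ∈ I := by_contra fun h => hx (h2 x h)
    exact ⟨by rw [h1 x hxI]; exact (hψ x hxI).1, hxI⟩

namespace FuzzyDiD

variable {M : FuzzyDiD.{u}}

lemma cellLaw_compl_suppY (d g t : Fin 2) : M.cellLaw d g t M.suppYᶜ = 0 := by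
  have hm : MeasurableSet M.suppYᶜ := Completion.measurableSet_suppY.compl
  rw [cellLaw, Measure.map_apply M.measurable_Yobs hm]
  refine cond_absolutelyContinuous ?_
  rw [← Measure.map_apply M.measurable_Yobs hm]
  exact Measure.support_mem_ae

/-- A regular cdf for the stayers of the control group, and laws of the switchers, that satisfy the
accounting identities, complete the data. -/
theorem Standing.exists_completion (hS : M.Standing) (hD : M.DataRestrictions) {d : Fin 2}
    {Φ e : ℝ → ℝ} (hΦ : RegCdf (interior M.suppY) Φ)
    (he : 0 < M.rate d 1 0 → ∀ x, e (M.F d 0 0 x) = M.F d 1 0 x) (κ : Fin 2 → Measure ℝ)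
    (hκ : ∀ g, IsProbabilityMeasure (κ g))
    (h0 : ∀ y, M.rate d 0 1 * M.F d 0 1 y + (M.rate d 0 0 - M.rate d 0 1) * (κ 0).real (Set.Iic y)
      = M.rate d 0 0 * Φ y)
    (h1 : ∀ y, M.rate d 1 1 * M.F d 1 1 y + (M.rate d 1 0 - M.rate d 1 1) * (κ 1).real (Set.Iic y)
      = M.rate d 1 0 * e (Φ y)) :
    ∃ C : M.Completion d, C.κ = κ := by
  have hp := hD.regCdf (hS.rate_control d 0)
  -- With `Φ ∘ φ = F_{d00}`, the `φ`-image of the control law of period 0 has cdf `Φ`. Since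
  -- `F_{d10} = e ∘ F_{d00}`, the same `φ` gives `e ∘ Φ` in the treatment group.
  obtain ⟨φ, hφ, hφI⟩ := hΦ.exists_change_of_variable hp
  have hr : ∀ g, M.rate d g 1 ≠ M.rate d g 0 := by
    intro g
    rcases Fin.exists_fin_two.1 ⟨g, rfl⟩ with rfl | rfl
    · exact hS.lam_control_ne d
    · exact hS.first.rate_ne d
  -- Laws of empty cells have weight zero in every identity and are arbitrary up to their support;
  -- `κ` serves.
  have hpick : ∀ t, ∃ μ : Fin 2 → Measure ℝ, (∀ g, IsProbabilityMeasure (μ g)) ∧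
      (∀ g, 0 < M.rate d g t → μ g = M.cellLaw d g t) ∧
      ∀ g, ¬ 0 < M.rate d g t → μ g = κ g := by
    intro t
    refine ⟨fun g => if 0 < M.rate d g t then M.cellLaw d g t else κ g, fun g => ?_,
      fun g h => if_pos h, fun g h => if_neg h⟩
    by_cases h : 0 < M.rate d g t
    · simp only [h, if_true]; exact isProbabilityMeasure_cellLaw h
    · simp only [h, if_false]; exact hκ g
  obtain ⟨base, pb, b1, b2⟩ := hpick 0
  obtain ⟨top, pt, t1, t2⟩ := hpick 1
  have hφm : Measurable φ := φ.monotone.measurable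
  have pφ : ∀ g, IsProbabilityMeasure ((base g).map φ) := fun g =>
    Measure.isProbabilityMeasure_map hφm.aemeasurable
  have htop : ∀ g y, M.rate d g 1 * (top g).real (Set.Iic y) = M.rate d g 1 * M.F d g 1 y := by
    intro g y
    rcases (M.rate_nonneg d g 1).eq_or_lt with h | h
    · rw [← h]; ring
    · rw [t1 g h, F_eq]
  have hbase : ∀ g y, M.rate d g 0 * ((base g).map φ).real (Set.Iic y)
      = M.rate d g 0 * M.F d g 0 (φ.symm y) := by
    intro g y
    rcases (M.rate_nonneg d g 0).eq_or_lt with h | h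
    · rw [← h]; ring
    · rw [map_measureReal_apply hφm measurableSet_Iic, b1 g h, F_eq]
      congr 2
      ext x
      simp [φ.le_symm_apply]
  have hΦp : ∀ y, M.F d 0 0 (φ.symm y) = Φ y := fun y => by rw [← hφ, φ.apply_symm_apply]
  have mix : ∀ g A, MeasurableSet A → M.rate d g 1 * (top g).real A
      + (M.rate d g 0 - M.rate d g 1) * (κ g).real A = M.rate d g 0 * ((base g).map φ).real A := by
    intro g A _
    refine real_mix_of_Iic (M.rate_nonneg _ _ _) (M.rate_nonneg _ _ _) (fun y => ?_) A
    rw [htop, hbase]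
    rcases Fin.exists_fin_two.1 ⟨g, rfl⟩ with rfl | rfl
    · rw [hΦp]; exact h0 y
    · rw [h1 y]
      rcases (M.rate_nonneg d 1 0).eq_or_lt with h | h
      · rw [← h]; ring
      · rw [← he h, hΦp]
  have φ_mem : ∀ x, φ x ∈ M.suppY ↔ x ∈ M.suppY := by
    intro x
    by_cases hx : φ x = x
    · rw [hx]
    · exact iff_of_true (interior_subset (hφI x hx).1) (interior_subset (hφI x hx).2)
  have hm : MeasurableSet M.suppYᶜ := Completion.measurableSet_suppY.compl
  -- The weight of `κ` in `mix` is nonzero and the two other terms do not charge the complement of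
  -- the support, so neither does `κ`.
  have κ_supp : ∀ g, κ g M.suppYᶜ = 0 := by
    intro g
    have := mix g _ hm
    have e1 : M.rate d g 1 * (top g).real M.suppYᶜ = 0 := by
      rcases (M.rate_nonneg d g 1).eq_or_lt with h | h
      · rw [← h, zero_mul]
      · rw [t1 g h, measureReal_def, cellLaw_compl_suppY, ENNReal.toReal_zero, mul_zero]
    have e2 : M.rate d g 0 * ((base g).map φ).real M.suppYᶜ = 0 := by
      rcases (M.rate_nonneg d g 0).eq_or_lt with h | h
      · rw [← h, zero_mul]
      · have e3 : φ ⁻¹' M.suppYᶜ = M.suppYᶜ := by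
          ext x; exact not_congr (φ_mem x)
        rw [map_measureReal_apply hφm hm, e3, b1 g h, measureReal_def, cellLaw_compl_suppY,
          ENNReal.toReal_zero, mul_zero]
    rw [e1, e2, zero_add, mul_eq_zero] at this
    exact (measureReal_eq_zero_iff).1 (this.resolve_left (sub_ne_zero.2 (hr g).symm))
  have supp : ∀ {μ : Fin 2 → Measure ℝ} {t}, (∀ g, 0 < M.rate d g t → μ g = M.cellLaw d g t) →
      (∀ g, ¬ 0 < M.rate d g t → μ g = κ g) → ∀ g, μ g M.suppYᶜ = 0 := by
    intro μ t h1 h2 g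
    by_cases h : 0 < M.rate d g t
    · rw [h1 g h]; exact cellLaw_compl_suppY d g t
    · rw [h2 g h]; exact κ_supp g
  exact ⟨⟨φ, base, top, κ, pb, pt, hκ, b1, t1, supp b1 b2, supp t1 t2, κ_supp, φ_mem, mix⟩, rfl⟩

lemma _root_.RegCdf.tendsto_unmix {I : Set ℝ} {f Φ : ℝ → ℝ} {l : ℝ} (hf : RegCdf I f) (hl : l ≠ 1)
    (h0 : Tendsto Φ atBot (𝓝 0)) (h1 : Tendsto Φ atTop (𝓝 1)) :
    Tendsto (unmix l f Φ) atBot (𝓝 0) ∧ Tendsto (unmix l f Φ) atTop (𝓝 1) := by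
  have a := (h0.sub (hf.bot.const_mul l)).div_const (1 - l)
  have b := (h1.sub (hf.top.const_mul l)).div_const (1 - l)
  rw [mul_zero, sub_zero, zero_div] at a
  rw [mul_one, div_self (sub_ne_zero.2 hl.symm)] at b
  exact ⟨a, b⟩

/-- Feasible cdfs for the stayers of the control group complete the data. -/
lemma Standing.exists_completion_of_feasible (hS : M.Standing) (hD : M.DataRestrictions) {d : Fin 2}
    (hd : 0 < M.rate d 1 0) {e : ℝ ≃o ℝ}
    (h : CicData (interior M.suppY) (M.F d 0 1) (M.treatedF d) e (M.lam 0 d) (M.lam 1 d))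
    (he : ∀ x, e (M.F d 0 0 x) = M.F d 1 0 x) {Φ : ℝ → ℝ}
    (hΦ : Feasible (interior M.suppY) (M.F d 0 1) (M.treatedF d) e (M.lam 0 d) (M.lam 1 d) Φ) :
    ∃ C : M.Completion d, ∀ y, (C.κ 1).real (Set.Iic y)
      = unmix (M.lam 1 d) (M.treatedF d) (fun y => e (Φ y)) y := by
  have r0 := hS.rate_control d 0
  obtain ⟨a0, a1⟩ := RegCdf.tendsto_unmix h.hf h.l_ne hΦ.reg.bot hΦ.reg.top
  have he0 : Tendsto (fun y => e (Φ y)) atBot (𝓝 0) := by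
    have := (e.continuous.tendsto 0).comp hΦ.reg.bot
    rwa [h.e0] at this
  have he1 : Tendsto (fun y => e (Φ y)) atTop (𝓝 1) := by
    have := (e.continuous.tendsto 1).comp hΦ.reg.top
    rwa [h.e1] at this
  obtain ⟨b0, b1⟩ := RegCdf.tendsto_unmix h.hg h.l'_ne he0 he1
  obtain ⟨μ0, p0, hμ0⟩ := exists_measure_of_cdf hΦ.slopes.K
    ((hΦ.reg.cont.sub (continuous_const.mul h.hf.cont)).div_const _) a0 a1
  obtain ⟨μ1, p1, hμ1⟩ := exists_measure_of_cdf hΦ.slopes.C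
    (((e.continuous.comp hΦ.reg.cont).sub (continuous_const.mul h.hg.cont)).div_const _) b0 b1
  obtain ⟨C, hC⟩ := hS.exists_completion hD hΦ.reg (fun _ => he) ![μ0, μ1] (fun g => by
    rcases Fin.exists_fin_two.1 ⟨g, rfl⟩ with rfl | rfl
    · exact p0
    · exact p1) (fun y => by
    simp only [Matrix.cons_val_zero]
    have hl : M.lam 0 d * M.rate d 0 0 = M.rate d 0 1 := div_mul_cancel₀ _ r0.ne'
    have hne : 1 - M.lam 0 d ≠ 0 := sub_ne_zero.2 h.l_ne.symm
    rw [hμ0, unmix, ← hl]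
    field_simp
    ring) (fun y => by
    simp only [Matrix.cons_val_one, Matrix.cons_val_zero]
    have hl : M.lam 1 d * M.rate d 1 0 = M.rate d 1 1 := div_mul_cancel₀ _ hd.ne'
    have hne : 1 - M.lam 1 d ≠ 0 := sub_ne_zero.2 h.l'_ne.symm
    have hg := lam_mul_treatedF (M := M) d y
    have e1 : M.rate d 1 1 * M.F d 1 1 y = M.rate d 1 0 * (M.lam 1 d * M.treatedF d y) := by
      rw [hg, ← hl]; ring
    rw [hμ1, unmix, e1, ← hl]
    field_simp
    ring)
  refine ⟨C, fun y => ?_⟩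
  rw [hC]
  exact hμ1 y

/-- Cdfs `F k` that approximate the lower bound `L`. -/
structure LowApprox (I : Set ℝ) (L H : ℝ → ℝ) (F : ℕ → ℝ → ℝ) : Prop where
  lim : ∀ y ∈ I, Tendsto (fun k => F k y) atTop (𝓝 (L y))
  tail : (Tendsto L atTop (𝓝 1) ∧ Tendsto H atBot (𝓝 0)) ∨
    ((∀ c ∈ I, ∀ᶠ k in atTop, ∀ y ≤ c, F k y = L y) ∧ ∀ k, ∃ c ∈ I, ∀ y, c ≤ y → H y ≤ F k y)

/-- Cdfs `F k` that approximate the upper bound `H`. -/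
structure HighApprox (I : Set ℝ) (L H : ℝ → ℝ) (F : ℕ → ℝ → ℝ) : Prop where
  lim : ∀ y ∈ I, Tendsto (fun k => F k y) atTop (𝓝 (H y))
  quant : ∀ x ∈ I, ∀ x₀ ∈ I, x₀ < x → H x₀ < 1 → ∀ᶠ k in atTop, H x₀ ≤ F k x
  tail : (Tendsto L atTop (𝓝 1) ∧ Tendsto H atBot (𝓝 0)) ∨
    ((∀ c ∈ I, ∀ᶠ k in atTop, ∀ y, c ≤ y → F k y = H y) ∧ ∀ k, ∃ c ∈ I, ∀ y ≤ c, F k y ≤ L y)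

lemma _root_.CicData.tendsto_cLow {I : Set ℝ} {f g : ℝ → ℝ} {e : ℝ ≃o ℝ} {l l' : ℝ}
    (h : CicData I f g e l l') (hl : 1 < l ∨ 1 < l') : Tendsto (cLow f g e l l') atTop (𝓝 1) := by
  have h1 := (e.continuous.tendsto 1).comp (h.tendsto_low_top hl)
  rw [h.e1] at h1
  have b := (h1.sub (h.hg.top.const_mul l')).div_const (1 - l')
  rw [mul_one, div_self (sub_ne_zero.2 h.l'_ne.symm)] at b
  exact b

lemma _root_.CicData.tendsto_cHigh {I : Set ℝ} {f g : ℝ → ℝ} {e : ℝ ≃o ℝ} {l l' : ℝ}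
    (h : CicData I f g e l l') (hl : 1 < l ∨ 1 < l') : Tendsto (cHigh f g e l l') atBot (𝓝 0) := by
  have h1 := ((h.reflect.tendsto_cLow hl).comp tendsto_neg_atBot_atTop).const_sub 1
  rw [sub_self] at h1
  refine h1.congr fun y => ?_
  rw [Function.comp_apply, h.cLow_reflect, neg_neg]
  ring

/-- Here `C_d(·)` is `F_{d11}` whatever its argument and the bounds are the same cdf. For a
completion, give the control switchers the observed law, that is `Φ = F_{d01}`; the transform `e`
enters with weight zero, hence the identity. -/
lemma Standing.completion_of_rate_zero (hS : M.Standing) (hD : M.DataRestrictions)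
    {d : Fin 2} (hd : M.rate d 1 0 = 0) :
    (∃ C : M.Completion d, ∀ y, (C.κ 1).real (Set.Iic y) = M.F d 1 1 y) ∧
      M.cicLow d = M.F d 1 1 ∧ M.cicHigh d = M.F d 1 1 ∧
      RegCdf (interior M.suppY) (M.F d 1 1) := by
  have h11 : 0 < M.rate d 1 1 := (M.rate_nonneg d 1 1).lt_of_ne' fun h =>
    hS.first.rate_ne d (h.trans hd.symm)
  have h01 := hS.rate_control d 1
  have hg := hD.regCdf h11
  have hcop : ∀ T, M.Cop d T = M.F d 1 1 := by
    intro T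
    ext y
    rw [Cop, hd, zero_mul, sub_zero, sub_zero, mul_div_cancel_left₀ _ h11.ne']
  refine ⟨?_, ?_, ?_, hg⟩
  · obtain ⟨C, hC⟩ := hS.exists_completion hD (hD.regCdf h01) (e := id)
      (fun h => absurd hd h.ne') ![M.cellLaw d 0 1, M.cellLaw d 1 1] (fun g => by
        rcases Fin.exists_fin_two.1 ⟨g, rfl⟩ with rfl | rfl
        · exact isProbabilityMeasure_cellLaw h01
        · exact isProbabilityMeasure_cellLaw h11) (fun y => by
        simp only [Matrix.cons_val_zero, F_eq]; ring) (fun y => by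
        simp only [Matrix.cons_val_one, Matrix.cons_val_zero, F_eq, hd]; ring)
    refine ⟨C, fun y => ?_⟩
    rw [hC, F_eq]
    rfl
  · ext y
    rw [cicLow, hcop]
    exact (hg.mono.map_isGreatest isGreatest_Iic).csSup_eq
  · ext y
    rw [cicHigh, hcop]
    exact (hg.mono.map_isLeast isLeast_Ici).csInf_eq

/-- Completions of the data that approach the lower CIC bound. -/
theorem IncreasingBounds.exists_lowApprox (hI : M.IncreasingBounds) (hS : M.Standing)
    (hD : M.DataRestrictions) (d : Fin 2) :
    ∃ C : ℕ → M.Completion d, LowApprox (interior M.suppY) (M.cicLow d) (M.cicHigh d)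
      fun k y => ((C k).κ 1).real (Set.Iic y) := by
  rcases (M.rate_nonneg d 1 0).eq_or_lt with hd | hd
  · obtain ⟨⟨C, hC⟩, hL, hH, hg⟩ := hS.completion_of_rate_zero hD hd.symm
    refine ⟨fun _ => C, fun y _ => ?_, Or.inl ?_⟩
    · simp only [hC, hL]; exact tendsto_const_nhds
    · rw [hL, hH]; exact ⟨hg.top, hg.bot⟩
  · obtain ⟨e, h, hInc, he, hL, hH⟩ := hI.exists_incData hS hD hd
    obtain ⟨Φ, hΦ, hlim, -, htail⟩ := h.lowSeq hInc
    choose C hC using fun k => hS.exists_completion_of_feasible hD hd h he (hΦ k)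
    refine ⟨C, fun y hy => ?_, ?_⟩
    · simp only [hC, hL]; exact hlim y hy
    -- If one ratio exceeds `1`, both bounds have the limits of proper cdfs at the ends that matter.
    -- Mass can be missing only when both ratios are below `1`, and then the last clause of the
    -- feasible sequence applies.
    · by_cases hl : 1 < M.lam 0 d ∨ 1 < M.lam 1 d
      · left
        rw [hL, hH]; exact ⟨h.tendsto_cLow hl, h.tendsto_cHigh hl⟩
      · rw [not_or, not_lt, not_lt] at hl
        right
        simp only [hC, hL, hH]
        exact htail (hl.1.lt_of_ne h.l_ne) (hl.2.lt_of_ne h.l'_ne)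

/-- Completions of the data that approach the upper CIC bound. -/
theorem IncreasingBounds.exists_highApprox (hI : M.IncreasingBounds) (hS : M.Standing)
    (hD : M.DataRestrictions) (d : Fin 2) :
    ∃ C : ℕ → M.Completion d, HighApprox (interior M.suppY) (M.cicLow d) (M.cicHigh d)
      fun k y => ((C k).κ 1).real (Set.Iic y) := by
  rcases (M.rate_nonneg d 1 0).eq_or_lt with hd | hd
  · obtain ⟨⟨C, hC⟩, hL, hH, hg⟩ := hS.completion_of_rate_zero hD hd.symm
    refine ⟨fun _ => C, fun y _ => ?_, fun x _ x₀ _ hx _ => ?_, Or.inl ?_⟩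
    · simp only [hC, hH]; exact tendsto_const_nhds
    · simp only [hC, hH]; exact Eventually.of_forall fun _ => hg.mono hx.le
    · rw [hL, hH]; exact ⟨hg.top, hg.bot⟩
  · obtain ⟨e, h, hInc, he, hL, hH⟩ := hI.exists_incData hS hD hd
    obtain ⟨Φ, hΦ, hlim, hquant, htail⟩ := h.highSeq hInc
    choose C hC using fun k => hS.exists_completion_of_feasible hD hd h he (hΦ k)
    refine ⟨C, fun y hy => ?_, ?_, ?_⟩
    · simp only [hC, hH]; exact hlim y hy
    · simp only [hC, hH]; exact hquant
    · by_cases hl : 1 < M.lam 0 d ∨ 1 < M.lam 1 d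
      · left
        rw [hL, hH]; exact ⟨h.tendsto_cLow hl, h.tendsto_cHigh hl⟩
      · rw [not_or, not_lt, not_lt] at hl
        right
        simp only [hC, hL, hH]
        exact htail (hl.1.lt_of_ne h.l_ne) (hl.2.lt_of_ne h.l'_ne)

end FuzzyDiD

/-! ### Convergence of means and quantiles -/

/-- Fatou from below, domination by the limit from above. No integrability is needed, so the limit
may be infinite. -/
lemma tendsto_lintegral_of_le_limit {α : Type*} [MeasurableSpace α] {μ : Measure α}
    {f : ℕ → α → ENNReal} {g : α → ENNReal} (hf : ∀ k, Measurable (f k)) (hle : ∀ k x, f k x ≤ g x)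
    (hlim : ∀ᵐ x ∂μ, Tendsto (fun k => f k x) atTop (𝓝 (g x))) :
    Tendsto (fun k => ∫⁻ x, f k x ∂μ) atTop (𝓝 (∫⁻ x, g x ∂μ)) := by
  refine tendsto_of_le_liminf_of_limsup_le ?_
    (limsup_le_of_le (h := Eventually.of_forall fun k => lintegral_mono (hle k)))
  calc ∫⁻ x, g x ∂μ = ∫⁻ x, liminf (fun k => f k x) atTop ∂μ :=
        lintegral_congr_ae (hlim.mono fun x hx => hx.liminf_eq.symm)
    _ ≤ _ := lintegral_liminf_le hf

section Tails

variable {F : ℕ → ℝ → ℝ} {G K : ℝ → ℝ} (hF : ∀ k, Monotone (F k))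
  (hlim : ∀ᵐ y, Tendsto (fun k => F k y) atTop (𝓝 (G y)))
include hF hlim

lemma tendsto_upT_of_ge (hle : ∀ k y, G y ≤ F k y) (c : ℝ) :
    Tendsto (fun k => upT c (F k)) atTop (𝓝 (upT c G)) :=
  tendsto_lintegral_of_le_limit
    (fun k => (measurable_const.sub (hF k).measurable).ennreal_ofReal)
    (fun k y => ENNReal.ofReal_le_ofReal (by linarith [hle k y]))
    (ae_restrict_of_ae (hlim.mono fun _ hy => ENNReal.tendsto_ofReal (hy.const_sub 1)))

lemma tendsto_loT_of_le (hle : ∀ k y, F k y ≤ G y) (c : ℝ) :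
    Tendsto (fun k => loT c (F k)) atTop (𝓝 (loT c G)) :=
  tendsto_lintegral_of_le_limit
    (fun k => (hF k).measurable.ennreal_ofReal)
    (fun k y => ENNReal.ofReal_le_ofReal (hle k y))
    (ae_restrict_of_ae (hlim.mono fun _ hy => ENNReal.tendsto_ofReal hy))

lemma tendsto_upT_of_dominated (hK : ∀ k y, K y ≤ F k y) {c : ℝ} (hc : upT c K < ⊤) :
    Tendsto (fun k => upT c (F k)) atTop (𝓝 (upT c G)) :=
  tendsto_lintegral_of_dominated_convergence _
    (fun k => (measurable_const.sub (hF k).measurable).ennreal_ofReal)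
    (fun k => Eventually.of_forall fun y => ENNReal.ofReal_le_ofReal (by linarith [hK k y])) hc.ne
    (ae_restrict_of_ae (hlim.mono fun _ hy => ENNReal.tendsto_ofReal (hy.const_sub 1)))

lemma tendsto_loT_of_dominated (hK : ∀ k y, F k y ≤ K y) {c : ℝ} (hc : loT c K < ⊤) :
    Tendsto (fun k => loT c (F k)) atTop (𝓝 (loT c G)) :=
  tendsto_lintegral_of_dominated_convergence _
    (fun k => (hF k).measurable.ennreal_ofReal)
    (fun k => Eventually.of_forall fun y => ENNReal.ofReal_le_ofReal (hK k y)) hc.ne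
    (ae_restrict_of_ae (hlim.mono fun _ hy => ENNReal.tendsto_ofReal hy))

end Tails

lemma upT_lt_top_of {F : ℝ → ℝ} (h0 : ∀ y, 0 ≤ F y) {c c' : ℝ} (h : upT c' F < ⊤) :
    upT c F < ⊤ := by
  have h1 : Set.Ioi c ⊆ Set.Ioc c c' ∪ Set.Ioi c' := fun y hy => by
    rcases le_or_gt y c' with h | h
    · exact Or.inl ⟨hy, h⟩
    · exact Or.inr h
  refine ((lintegral_mono_set h1).trans (lintegral_union_le _ _ _)).trans_lt
    (ENNReal.add_lt_top.2 ⟨?_, h⟩)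
  refine (setLIntegral_mono measurable_const (g := fun _ => 1) fun y _ => ?_).trans_lt ?_
  · rw [ENNReal.ofReal_le_one]; linarith [h0 y]
  · rw [setLIntegral_one, Real.volume_Ioc]; exact ENNReal.ofReal_lt_top

lemma loT_lt_top_of {F : ℝ → ℝ} (h0 : ∀ y, F y ≤ 1) {c c' : ℝ} (h : loT c' F < ⊤) :
    loT c F < ⊤ := by
  have h1 : Set.Iic c ⊆ Set.Ioc c' c ∪ Set.Iic c' := fun y hy => by
    rcases le_or_gt y c' with h | h
    · exact Or.inr h
    · exact Or.inl ⟨h, hy⟩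
  refine ((lintegral_mono_set h1).trans (lintegral_union_le _ _ _)).trans_lt
    (ENNReal.add_lt_top.2 ⟨?_, h⟩)
  refine (setLIntegral_mono measurable_const (g := fun _ => 1) fun y _ => ?_).trans_lt ?_
  · rw [ENNReal.ofReal_le_one]; exact h0 y
  · rw [setLIntegral_one, Real.volume_Ioc]; exact ENNReal.ofReal_lt_top

lemma EReal.tendsto_sub' {α : Type*} {l : Filter α} {x y : α → EReal} {a b : EReal}
    (hx : Tendsto x l (𝓝 a)) (hy : Tendsto y l (𝓝 b)) (h1 : a ≠ ⊤ ∨ b ≠ ⊤) (h2 : a ≠ ⊥ ∨ b ≠ ⊥) :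
    Tendsto (fun k => x k - y k) l (𝓝 (a - b)) := by
  have hn : Tendsto (fun k => -y k) l (𝓝 (-b)) := (continuous_neg.tendsto b).comp hy
  exact (EReal.continuousAt_add (p := (a, -b)) (by simpa using h1) (by simpa using h2)).tendsto.comp
    (hx.prodMk_nhds hn)

lemma tendsto_mean_ereal {c : ℝ} {u l : ℕ → ENNReal} {U Λ : ENNReal} (hu : Tendsto u atTop (𝓝 U))
    (hl : Tendsto l atTop (𝓝 Λ)) (h : U ≠ ⊤ ∨ Λ ≠ ⊤) :
    Tendsto (fun k => (c : EReal) + (u k : EReal) - (l k : EReal)) atTop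
      (𝓝 ((c : EReal) + (U : EReal) - (Λ : EReal))) := by
  have hu' : Tendsto (fun k => (u k : EReal)) atTop (𝓝 (U : EReal)) :=
    (continuous_coe_ennreal_ereal.tendsto U).comp hu
  have hl' : Tendsto (fun k => (l k : EReal)) atTop (𝓝 (Λ : EReal)) :=
    (continuous_coe_ennreal_ereal.tendsto Λ).comp hl
  have h1 : Tendsto (fun k => (c : EReal) + (u k : EReal)) atTop (𝓝 ((c : EReal) + (U : EReal))) :=
    (EReal.continuousAt_add (p := ((c : EReal), (U : EReal))) (by simp) (by simp)).tendsto.comp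
      (tendsto_const_nhds.prodMk_nhds hu')
  refine EReal.tendsto_sub' h1 hl' (h.imp (fun hU => ?_) (by simp)) (Or.inr (by simp))
  rw [← EReal.coe_ennreal_toReal hU, ← EReal.coe_add]
  exact EReal.coe_ne_top _

namespace FuzzyDiD

variable {M : FuzzyDiD.{u}} {N : FuzzyDiD.{0}}

lemma mem_interior_suppY_of (hD : M.DataRestrictions) {y : ℝ} (h1 : M.yLow < y)
    (h2 : (y : EReal) < M.yHigh) : y ∈ interior M.suppY := by
  obtain ⟨_, ⟨s, hs, rfl⟩, hsy⟩ := sInf_lt_iff.1 h1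
  obtain ⟨_, ⟨t, ht, rfl⟩, hty⟩ := lt_sSup_iff.1 h2
  exact mem_interior.2 ⟨Set.Ioo s t, Set.Ioo_subset_Icc_self.trans (hD.1.out hs ht), isOpen_Ioo,
    EReal.coe_lt_coe_iff.1 hsy, EReal.coe_lt_coe_iff.1 hty⟩

lemma bounds_of_mem_interior {y : ℝ} (hy : y ∈ interior M.suppY) :
    M.yLow < y ∧ (y : EReal) < M.yHigh := by
  obtain ⟨ε, hε, hb⟩ := Metric.isOpen_iff.1 isOpen_interior y hy
  have m1 : y - ε / 2 ∈ M.suppY := interior_subset (hb (by simpa [abs_of_pos hε] using hε))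
  have m2 : y + ε / 2 ∈ M.suppY := interior_subset (hb (by simpa [abs_of_pos hε] using hε))
  exact ⟨(sInf_le (Set.mem_image_of_mem _ m1)).trans_lt (EReal.coe_lt_coe_iff.2 (by linarith)),
    (EReal.coe_lt_coe_iff.2 (by linarith)).trans_le (le_sSup (Set.mem_image_of_mem _ m2))⟩

namespace Admissible

variable (hN : M.Admissible N) (hS : M.Standing)
include hN

lemma cicOn (d : Fin 2) (hS : M.Standing) (y : ℝ) :
    M.cicLowOn d y ≤ N.switcherCdf d y ∧ N.switcherCdf d y ≤ M.cicHighOn d y := by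
  rw [← cicLowOn_congr hN.1, ← cicHighOn_congr hN.1]
  exact cicOn_bounds (hN.standing hS) hN.2.2.2.1 hN.2.2.2.2.1 hN.2.2.2.2.2 d y

lemma quantile (hS : M.Standing) (d : Fin 2) {q : ℝ} (hq : q ∈ Set.Ioo (0 : ℝ) 1) :
    max (genInv (M.cicHigh d) q) M.yLow ≤ genInv (N.switcherCdf d) q ∧
      genInv (N.switcherCdf d) q ≤ min (genInv (M.cicLow d) q) M.yHigh := by
  rw [← cicLow_congr hN.1, ← cicHigh_congr hN.1, ← yLow_congr hN.1, ← yHigh_congr hN.1]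
  exact genInv_bounds (hN.standing hS) hN.2.2.2.1 hN.2.2.2.2.1 hN.2.2.2.2.2 d hq

lemma cdf_of_lt (d : Fin 2) {y : ℝ} (hy : (y : EReal) < M.yLow) : N.switcherCdf d y = 0 := by
  rw [← yLow_congr hN.1] at hy
  exact switcherCdf_eq_zero hN.2.2.2.2.2 hy

lemma cdf_of_ge (hS : M.Standing) (d : Fin 2) {y : ℝ} (hy : M.yHigh ≤ (y : EReal)) :
    N.switcherCdf d y = 1 := by
  rw [← yHigh_congr hN.1] at hy
  exact switcherCdf_eq_one (hN.standing hS) hN.2.2.2.2.2 hy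

lemma iInf_low (hS : M.Standing) (d : Fin 2) : ⨅ y, M.cicLowOn d y = 0 := by
  rw [← cicLowOn_congr hN.1]
  exact iInf_cicLowOn (hN.standing hS) hN.2.2.2.1 hN.2.2.2.2.1 hN.2.2.2.2.2 d

lemma iSup_high (hS : M.Standing) (d : Fin 2) : ⨆ y, M.cicHighOn d y = 1 := by
  rw [← cicHighOn_congr hN.1]
  exact iSup_cicHighOn (hN.standing hS) hN.2.2.2.1 hN.2.2.2.2.1 hN.2.2.2.2.2 d

end Admissible

section Sequences

variable {N : ℕ → FuzzyDiD.{0}} (hN : ∀ k, M.Admissible (N k)) (hS : M.Standing)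
  (hM : M.MonotoneInvariant) (hD : M.DataRestrictions) {d : Fin 2}
include hN hS hM hD

-- Off the support interval the cdfs of admissible processes are frozen at `0` or `1`, and at a
-- finite upper end they equal `1`. Convergence is unknown only at a finite lower end, a single null
-- point.
omit hM in
lemma ae_tendsto_cdfOn {K : ℝ → ℝ}
    (h : ∀ y ∈ interior M.suppY, Tendsto (fun k => (N k).switcherCdf d y) atTop (𝓝 (K y))) :
    ∀ᵐ y : ℝ, Tendsto (fun k => (N k).switcherCdf d y) atTop
      (𝓝 (cdfOnInterval M.yLow M.yHigh K y)) := by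
  have hc : ∀ᵐ y : ℝ, y ≠ M.yLow.toReal := by
    rw [ae_iff]; simp
  filter_upwards [hc] with y hy
  rw [cdfOnInterval]
  split_ifs with h1 h2
  · simp only [fun k => (hN k).cdf_of_lt d h1]; exact tendsto_const_nhds
  · simp only [fun k => (hN k).cdf_of_ge hS d h2]; exact tendsto_const_nhds
  · refine h y (mem_interior_suppY_of hD (lt_of_le_of_ne (not_lt.1 h1) fun h3 => hy ?_)
      (not_le.1 h2))
    rw [h3, EReal.toReal_coe]

omit hM hD in
lemma eventually_integrable_tails (c : ℝ)
    (hu : ∀ k, upT c ((N k).switcherCdf d) < ⊤)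
    (hl : ∀ᶠ k in atTop, loT c ((N k).switcherCdf d) < ⊤) :
    ∀ᶠ k in atTop, Integrable ((N k).Y d) (cond (N k).P (N k).switchers) := by
  filter_upwards [hl] with k hk
  exact (integrable_iff_tails ((hN k).standing hS) d c).2 ⟨hu k, hk⟩

omit hM hD in
lemma tendsto_integral_of_tails {K : ℝ → ℝ} (c : ℝ) (hK : SubCdf K)
    (hKi : Integrable (fun y : ℝ => y) (stieltjesOf K))
    (hI : ∀ᶠ k in atTop, Integrable ((N k).Y d) (cond (N k).P (N k).switchers))
    (hu : Tendsto (fun k => upT c ((N k).switcherCdf d)) atTop (𝓝 (upT c K)))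
    (hl : Tendsto (fun k => loT c ((N k).switcherCdf d)) atTop (𝓝 (loT c K)))
    (hf : upT c K ≠ ⊤ ∨ loT c K ≠ ⊤) :
    Tendsto (fun k => ((∫ y, y ∂((N k).switLaw d) : ℝ) : EReal)) atTop (𝓝 (extMean K)) := by
  rw [hK.extMean_eq c hKi]
  refine (tendsto_mean_ereal hu hl hf).congr' ?_
  filter_upwards [hI] with k hk
  have := ((hN k).standing hS).isProb d
  have hk' : Integrable (fun y : ℝ => y) ((N k).switLaw d) := by
    rw [switLaw, integrable_map_measure (by fun_prop) ((N k).measurable_Y d).aemeasurable]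
    exact hk
  rw [integral_eq_ereal _ c hk', ← funext ((N k).switcherCdf_eq d)]

/-- The approximating cdfs lie above their limit, so their upper tails always converge, possibly to
infinity. The lower tails lack this monotone control. Either the bounds are proper, and the lower
tail of the upper bound dominates; or the approximations eventually coincide with the limit on a
left half-line, and the lower tail is eventually constant. In the second case each upper tail is
finite because far to the right the approximation lies above the upper bound. -/
lemma tendsto_mean_low (hE : M.MomentsExist) (hA : LowApprox (interior M.suppY) (M.cicLow d)
      (M.cicHigh d) fun k => (N k).switcherCdf d) :
    (∀ᶠ k in atTop, Integrable ((N k).Y d) (cond (N k).P (N k).switchers)) ∧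
      Tendsto (fun k => ((∫ y, y ∂((N k).switLaw d) : ℝ) : EReal)) atTop
        (𝓝 (extMean (M.cicLowOn d))) := by
  have sL := subCdf_cicLowOn hS hM hD d
  have sH := subCdf_cicHighOn hS hM hD d
  have hmono : ∀ k, Monotone ((N k).switcherCdf d) := fun k => switcherCdf_mono d
  have hlim := ae_tendsto_cdfOn hN hS hD hA.lim
  have hlo : ∀ k y, M.cicLowOn d y ≤ (N k).switcherCdf d y := fun k y => ((hN k).cicOn d hS y).1
  have hhi : ∀ k y, (N k).switcherCdf d y ≤ M.cicHighOn d y := fun k y => ((hN k).cicOn d hS y).2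
  have hiL := (hN 0).iInf_low hS d
  have hsH := (hN 0).iSup_high hS d
  obtain ⟨c, hc⟩ := (hD.regCdf (hS.rate_control 0 0)).nonempty
  have hu := tendsto_upT_of_ge hmono hlim hlo c
  have hlL : loT c (M.cicLowOn d) < ⊤ := sL.loT_lt_top c (hE d).2 hiL
  rcases hA.tail with ⟨hL1, hH0⟩ | ⟨hbot, htop⟩
  · have hsL : ⨆ y, M.cicLowOn d y = 1 := by
      refine sL.iSup_eq_one_of_le hL1 ?_
      filter_upwards [M.eventually_yLow_le] with y hy
      rw [cicLowOn, cdfOnInterval, if_neg (not_lt.2 hy)]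
      split_ifs
      · exact (subCdf_cicLow hS hM hD d).le_one y
      · exact le_rfl
    have hiH : ⨅ y, M.cicHighOn d y = 0 := by
      refine sH.iInf_eq_zero_of_le hH0 ?_
      filter_upwards [M.eventually_lt_yHigh] with y hy
      rw [cicHighOn, cdfOnInterval, if_neg (not_le.2 hy)]
      split_ifs
      · exact (subCdf_cicHigh hS hM hD d).nonneg y
      · exact le_rfl
    have hlH := sH.loT_lt_top c (hE d).1 hiH
    have huL := sL.upT_lt_top c (hE d).2 hsL
    have hI := eventually_integrable_tails hN hS (d := d) c
      (fun k => (upT_anti (hlo k)).trans_lt huL)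
      (Eventually.of_forall fun k => (loT_mono (hhi k)).trans_lt hlH)
    exact ⟨hI, tendsto_integral_of_tails hN hS c sL (hE d).2 hI hu
      (tendsto_loT_of_dominated hmono hlim hhi hlH) (Or.inr hlL.ne)⟩
  · have hleq : ∀ᶠ k in atTop, loT c ((N k).switcherCdf d) = loT c (M.cicLowOn d) := by
      filter_upwards [hbot c hc] with k hk
      refine setLIntegral_congr_fun measurableSet_Iic fun y hy => ?_
      have hyc : (y : EReal) < M.yHigh :=
        (EReal.coe_le_coe_iff.2 hy).trans_lt (bounds_of_mem_interior hc).2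
      rw [cicLowOn, cdfOnInterval, if_neg (not_le.2 hyc)]
      split_ifs with h1
      · rw [(hN k).cdf_of_lt d h1]
      · rw [← hk y hy]
    have huk : ∀ k, upT c ((N k).switcherCdf d) < ⊤ := by
      intro k
      obtain ⟨c', hc', h⟩ := htop k
      refine upT_lt_top_of (switcherCdf_nonneg d) (c' := c') (lt_of_le_of_lt ?_
        (sH.upT_lt_top c' (hE d).1 hsH))
      refine setLIntegral_mono' measurableSet_Ioi fun y hy => ENNReal.ofReal_le_ofReal ?_
      have hyc : M.yLow < (y : EReal) :=
        (bounds_of_mem_interior hc').1.trans (EReal.coe_lt_coe_iff.2 hy)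
      rw [cicHighOn, cdfOnInterval, if_neg (not_lt.2 hyc.le)]
      split_ifs with h2
      · rw [(hN k).cdf_of_ge hS d h2]
      · linarith [h y (le_of_lt hy)]
    have hI := eventually_integrable_tails hN hS (d := d) c huk
      (hleq.mono fun k hk => by rw [hk]; exact hlL)
    exact ⟨hI, tendsto_integral_of_tails hN hS c sL (hE d).2 hI hu
      (tendsto_const_nhds.congr' (hleq.mono fun k hk => hk.symm)) (Or.inr hlL.ne)⟩

/-- The mirror situation: lower tails converge by domination from their limit, and the upper tails
are either dominated by that of the lower bound or eventually constant. -/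
lemma tendsto_mean_high (hE : M.MomentsExist) (hA : HighApprox (interior M.suppY) (M.cicLow d)
      (M.cicHigh d) fun k => (N k).switcherCdf d) :
    (∀ᶠ k in atTop, Integrable ((N k).Y d) (cond (N k).P (N k).switchers)) ∧
      Tendsto (fun k => ((∫ y, y ∂((N k).switLaw d) : ℝ) : EReal)) atTop
        (𝓝 (extMean (M.cicHighOn d))) := by
  have sL := subCdf_cicLowOn hS hM hD d
  have sH := subCdf_cicHighOn hS hM hD d
  have hmono : ∀ k, Monotone ((N k).switcherCdf d) := fun k => switcherCdf_mono d
  have hlim := ae_tendsto_cdfOn hN hS hD hA.lim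
  have hlo : ∀ k y, M.cicLowOn d y ≤ (N k).switcherCdf d y := fun k y => ((hN k).cicOn d hS y).1
  have hhi : ∀ k y, (N k).switcherCdf d y ≤ M.cicHighOn d y := fun k y => ((hN k).cicOn d hS y).2
  have hiL := (hN 0).iInf_low hS d
  have hsH := (hN 0).iSup_high hS d
  obtain ⟨c, hc⟩ := (hD.regCdf (hS.rate_control 0 0)).nonempty
  have hl := tendsto_loT_of_le hmono hlim hhi c
  have huH : upT c (M.cicHighOn d) < ⊤ := sH.upT_lt_top c (hE d).1 hsH
  rcases hA.tail with ⟨hL1, hH0⟩ | ⟨htop, hbot⟩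
  · have hsL : ⨆ y, M.cicLowOn d y = 1 := by
      refine sL.iSup_eq_one_of_le hL1 ?_
      filter_upwards [M.eventually_yLow_le] with y hy
      rw [cicLowOn, cdfOnInterval, if_neg (not_lt.2 hy)]
      split_ifs
      · exact (subCdf_cicLow hS hM hD d).le_one y
      · exact le_rfl
    have hiH : ⨅ y, M.cicHighOn d y = 0 := by
      refine sH.iInf_eq_zero_of_le hH0 ?_
      filter_upwards [M.eventually_lt_yHigh] with y hy
      rw [cicHighOn, cdfOnInterval, if_neg (not_le.2 hy)]
      split_ifs
      · exact (subCdf_cicHigh hS hM hD d).nonneg y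
      · exact le_rfl
    have hlH := sH.loT_lt_top c (hE d).1 hiH
    have huL := sL.upT_lt_top c (hE d).2 hsL
    have hI := eventually_integrable_tails hN hS (d := d) c
      (fun k => (upT_anti (hlo k)).trans_lt huL)
      (Eventually.of_forall fun k => (loT_mono (hhi k)).trans_lt hlH)
    exact ⟨hI, tendsto_integral_of_tails hN hS c sH (hE d).1 hI
      (tendsto_upT_of_dominated hmono hlim hlo huL) hl (Or.inl huH.ne)⟩
  · have hueq : ∀ᶠ k in atTop, upT c ((N k).switcherCdf d) = upT c (M.cicHighOn d) := by
      filter_upwards [htop c hc] with k hk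
      refine setLIntegral_congr_fun measurableSet_Ioi fun y hy => ?_
      have hyc : M.yLow < (y : EReal) :=
        (bounds_of_mem_interior hc).1.trans (EReal.coe_lt_coe_iff.2 hy)
      rw [cicHighOn, cdfOnInterval, if_neg (not_lt.2 hyc.le)]
      split_ifs with h1
      · rw [(hN k).cdf_of_ge hS d h1]
      · rw [← hk y (le_of_lt hy)]
    have hlk : ∀ k, loT c ((N k).switcherCdf d) < ⊤ := by
      intro k
      obtain ⟨c', hc', h⟩ := hbot k
      refine loT_lt_top_of (switcherCdf_le_one d) (c' := c') (lt_of_le_of_lt ?_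
        (sL.loT_lt_top c' (hE d).2 hiL))
      refine setLIntegral_mono' measurableSet_Iic fun y hy => ENNReal.ofReal_le_ofReal ?_
      have hyc : (y : EReal) < M.yHigh :=
        (EReal.coe_le_coe_iff.2 hy).trans_lt (bounds_of_mem_interior hc').2
      rw [cicLowOn, cdfOnInterval, if_neg (not_le.2 hyc)]
      split_ifs with h2
      · rw [(hN k).cdf_of_lt d h2]
      · exact h y hy
    have hI : ∀ᶠ k in atTop, Integrable ((N k).Y d) (cond (N k).P (N k).switchers) := by
      filter_upwards [hueq] with k hk
      exact (integrable_iff_tails ((hN k).standing hS) d c).2 ⟨hk ▸ huH, hlk k⟩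
    exact ⟨hI, tendsto_integral_of_tails hN hS c sH (hE d).1 hI
      (tendsto_const_nhds.congr' (hueq.mono fun k hk => hk.symm)) hl (Or.inl huH.ne)⟩

-- Pointwise convergence is enough here. The quantiles are at most the limiting one, and left of it
-- the limiting cdf is strictly below `q`, hence so are eventually the approximations.
omit hM in
lemma tendsto_quantile_low {q : ℝ} (hq : q ∈ Set.Ioo (0 : ℝ) 1)
    (hA : LowApprox (interior M.suppY) (M.cicLow d) (M.cicHigh d) fun k => (N k).switcherCdf d) :
    Tendsto (fun k => genInv ((N k).switcherCdf d) q) atTop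
      (𝓝 (min (genInv (M.cicLow d) q) M.yHigh)) := by
  have hle := fun k => ((hN k).quantile hS d hq).2
  have hinv : ∀ k w, (N k).switcherCdf d w < q → (w : EReal) ≤ genInv ((N k).switcherCdf d) q := by
    intro k w hw
    refine le_sInf ?_
    rintro _ ⟨x, hx, rfl⟩
    refine EReal.coe_le_coe_iff.2 (le_of_not_gt fun h => ?_)
    exact absurd (le_trans hx (switcherCdf_mono d h.le)) (not_le.2 hw)
  refine tendsto_order.2 ⟨fun z hz => ?_, fun z hz => Eventually.of_forall fun k => (hle k).trans_lt hz⟩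
  obtain ⟨w, hzw, hw⟩ := EReal.lt_iff_exists_real_btwn.1 hz
  obtain ⟨w', hww', hw'⟩ := EReal.lt_iff_exists_real_btwn.1 hw
  rcases lt_or_ge (w : EReal) M.yLow with h | h
  · refine Eventually.of_forall fun k => hzw.trans_le (hinv k w ?_)
    rw [(hN k).cdf_of_lt d h]; exact hq.1
  · have hI := mem_interior_suppY_of hD (h.trans_lt hww') (hw'.trans_le (min_le_right _ _))
    have hL : M.cicLow d w' < q := by
      by_contra hc
      exact absurd (hw'.trans_le (min_le_left _ _))
        (not_lt.2 (sInf_le (Set.mem_image_of_mem _ (not_lt.1 hc))))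
    filter_upwards [(hA.lim w' hI).eventually (gt_mem_nhds hL)] with k hk
    exact (hzw.trans hww').trans_le (hinv k w' hk)

/-- Pointwise convergence does not suffice: the approximations lie below `H`, which may equal `q` on
an interval without their reaching `q` there. The field `quant` makes them reach `H x₀` at any later
point when `H x₀ < 1`; if `H x₀` is already `1`, then `q < 1` leaves room and convergence is enough.
-/
lemma tendsto_quantile_high {q : ℝ} (hq : q ∈ Set.Ioo (0 : ℝ) 1)
    (hA : HighApprox (interior M.suppY) (M.cicLow d) (M.cicHigh d) fun k => (N k).switcherCdf d) :
    Tendsto (fun k => genInv ((N k).switcherCdf d) q) atTop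
      (𝓝 (max (genInv (M.cicHigh d) q) M.yLow)) := by
  have hge := fun k => ((hN k).quantile hS d hq).1
  have hinv : ∀ k w, q ≤ (N k).switcherCdf d w → genInv ((N k).switcherCdf d) q ≤ (w : EReal) :=
    fun k w hw => sInf_le (Set.mem_image_of_mem _ hw)
  have hHm := (subCdf_cicHigh hS hM hD d).mono
  refine tendsto_order.2 ⟨fun z hz => Eventually.of_forall fun k => hz.trans_le (hge k),
    fun z hz => ?_⟩
  obtain ⟨w, hw, hwz⟩ := EReal.lt_iff_exists_real_btwn.1 hz
  rcases le_or_gt M.yHigh (w : EReal) with h | h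
  · refine Eventually.of_forall fun k => (hinv k w ?_).trans_lt hwz
    rw [(hN k).cdf_of_ge hS d h]; exact hq.2.le
  · obtain ⟨_, ⟨x1, hx1, rfl⟩, hx1w⟩ := sInf_lt_iff.1 ((le_max_left _ _).trans_lt hw)
    have hlw : M.yLow < (w : EReal) := (le_max_right _ _).trans_lt hw
    have hwI := mem_interior_suppY_of hD hlw h
    obtain ⟨x2, h2, hx2w⟩ := EReal.lt_iff_exists_real_btwn.1 (max_lt hlw hx1w)
    have hx2I := mem_interior_suppY_of hD ((le_max_left _ _).trans_lt h2) (hx2w.trans h)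
    have hx12 : x1 ≤ x2 := EReal.coe_le_coe_iff.1 ((le_max_right _ _).trans h2.le)
    have hqx : q ≤ M.cicHigh d x2 := le_trans hx1 (hHm hx12)
    rcases lt_or_ge (M.cicHigh d x2) 1 with h3 | h3
    · filter_upwards [hA.quant w hwI x2 hx2I (EReal.coe_lt_coe_iff.1 hx2w) h3] with k hk
      exact (hinv k w (hqx.trans hk)).trans_lt hwz
    · have h4 : q < M.cicHigh d w :=
        (hq.2.trans_le h3).trans_le (hHm (EReal.coe_lt_coe_iff.1 hx2w).le)
      filter_upwards [(hA.lim w hwI).eventually (lt_mem_nhds h4)] with k hk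
      exact (hinv k w hk.le).trans_lt hwz

omit hM hD in
lemma quantile_ne (d : Fin 2) {q : ℝ} (hq : q ∈ Set.Ioo (0 : ℝ) 1) :
    genInv ((N 0).switcherCdf d) q ≠ ⊤ ∧ genInv ((N 0).switcherCdf d) q ≠ ⊥ := by
  obtain ⟨hb, ht⟩ := tendsto_switcherCdf ((hN 0).standing hS) d
  obtain ⟨x, hx⟩ := (ht.eventually (lt_mem_nhds hq.2)).exists
  obtain ⟨y, hy⟩ := (hb.eventually (gt_mem_nhds hq.1)).exists
  have hle : genInv ((N 0).switcherCdf d) q ≤ (x : EReal) := sInf_le ⟨x, hx.le, rfl⟩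
  refine ⟨(hle.trans_lt (EReal.coe_lt_top x)).ne, ((EReal.bot_lt_coe y).trans_le (le_sInf ?_)).ne'⟩
  rintro _ ⟨z, hz, rfl⟩
  refine EReal.coe_le_coe_iff.2 (le_of_not_gt fun h => ?_)
  exact absurd (le_trans hz (switcherCdf_mono d h.le)) (not_le.2 hy)

/-- For `d = 1` the bounds are proper cdfs, so the bounds on the quantiles are finite. This excludes
`∞ - ∞` when the difference with the possibly infinite quantile for `d = 0` is taken to the limit.
-/
lemma quantile_one_ne {q : ℝ} (hq : q ∈ Set.Ioo (0 : ℝ) 1) :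
    (max (genInv (M.cicHigh 1) q) M.yLow ≠ ⊤ ∧ max (genInv (M.cicHigh 1) q) M.yLow ≠ ⊥) ∧
      min (genInv (M.cicLow 1) q) M.yHigh ≠ ⊤ ∧ min (genInv (M.cicLow 1) q) M.yHigh ≠ ⊥ := by
  obtain ⟨h1, h2⟩ := (hN 0).quantile hS 1 hq
  obtain ⟨ht, hb⟩ := quantile_ne hN hS 1 hq
  refine ⟨⟨(h1.trans_lt (lt_top_iff_ne_top.2 ht)).ne, fun h => ?_⟩, fun h => ?_,
    ((bot_lt_iff_ne_bot.2 hb).trans_le h2).ne'⟩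
  · rw [max_eq_bot] at h
    have hi := iInf_cicHighOn_one hS hM hD
    have hlt : ⨅ y, M.cicHighOn 1 y < q := by rw [hi]; exact hq.1
    obtain ⟨y, hy⟩ := exists_lt_of_ciInf_lt hlt
    rw [cicHighOn, cdfOnInterval, h.2, if_neg not_lt_bot] at hy
    split_ifs at hy with h3
    · exact absurd hq.2 (not_lt.2 hy.le)
    · have : (y : EReal) ≤ genInv (M.cicHigh 1) q := by
        refine le_sInf ?_
        rintro _ ⟨z, hz, rfl⟩
        refine EReal.coe_le_coe_iff.2 (le_of_not_gt fun h => ?_)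
        exact absurd (le_trans hz ((subCdf_cicHigh hS hM hD 1).mono h.le)) (not_le.2 hy)
      rw [h.1] at this
      exact absurd this (not_le.2 (EReal.bot_lt_coe y))
  · rw [min_eq_top] at h
    have hi := iSup_cicLowOn_one hS hM hD
    have hlt : q < ⨆ y, M.cicLowOn 1 y := by rw [hi]; exact hq.2
    obtain ⟨y, hy⟩ := exists_lt_of_lt_ciSup hlt
    rw [cicLowOn, cdfOnInterval, h.2] at hy
    split_ifs at hy with h3 h4
    · exact absurd hq.1 (not_lt.2 hy.le)
    · exact absurd (EReal.coe_lt_top y) (not_lt.2 h4)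
    · have : genInv (M.cicLow 1) q ≤ (y : EReal) := sInf_le (Set.mem_image_of_mem _ hy.le)
      rw [h.1] at this
      exact absurd this (not_le.2 (EReal.coe_lt_top y))

end Sequences

/-! ### Sharpness of the CIC bounds -/

section Sharpness

variable (hS : M.Standing) (hM : M.MonotoneInvariant) (hD : M.DataRestrictions)
  (hI : M.IncreasingBounds)
include hS hM hD hI

omit hM in
/-- Admissible processes approaching simultaneously, for each `d`, the chosen CIC bound. -/
lemma exists_admissible_seq (s : Fin 2 → Prop) : ∃ N : ℕ → FuzzyDiD.{0}, (∀ k, M.Admissible (N k)) ∧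
    ∀ d, (s d → LowApprox (interior M.suppY) (M.cicLow d) (M.cicHigh d)
        fun k => (N k).switcherCdf d) ∧
      (¬ s d → HighApprox (interior M.suppY) (M.cicLow d) (M.cicHigh d)
        fun k => (N k).switcherCdf d) := by
  have hex : ∀ d, ∃ C : ℕ → M.Completion d,
      (s d → LowApprox (interior M.suppY) (M.cicLow d) (M.cicHigh d)
        fun k y => ((C k).κ 1).real (Set.Iic y)) ∧
      (¬ s d → HighApprox (interior M.suppY) (M.cicLow d) (M.cicHigh d)
        fun k y => ((C k).κ 1).real (Set.Iic y)) := by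
    intro d
    by_cases h : s d
    · obtain ⟨C, hC⟩ := hI.exists_lowApprox hS hD d
      exact ⟨C, fun _ => hC, fun h' => absurd h h'⟩
    · obtain ⟨C, hC⟩ := hI.exists_highApprox hS hD d
      exact ⟨C, fun h' => absurd h' h, fun _ => hC⟩
  -- Nothing couples the completions for `d = 0` and `d = 1`, so each may approach its own bound
  -- within one process.
  choose C hC using hex
  have key := fun k => hS.admissible_toModel hD fun d => C d k
  refine ⟨fun k => Completion.toModel fun d => C d k, fun k => (key k).1, fun d => ?_⟩
  have e : (fun k => (Completion.toModel fun d => C d k).switcherCdf d)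
      = fun k y => ((C d k).κ 1).real (Set.Iic y) := by
    ext k y; exact (key k).2 d y
  rw [e]
  exact hC d

omit hM in
/-- The CIC bounds on the cdfs among switchers are sharp. -/
theorem cic_bounds_sharp (d : Fin 2) :
    (∃ N : ℕ → FuzzyDiD.{0}, (∀ k, M.Admissible (N k)) ∧ ∀ y ∈ interior M.suppY,
      Tendsto (fun k => (N k).switcherCdf d y) atTop (𝓝 (M.cicLow d y))) ∧
    (∃ N : ℕ → FuzzyDiD.{0}, (∀ k, M.Admissible (N k)) ∧ ∀ y ∈ interior M.suppY,
      Tendsto (fun k => (N k).switcherCdf d y) atTop (𝓝 (M.cicHigh d y))) := by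
  obtain ⟨N, hN, h⟩ := exists_admissible_seq hS hD hI fun _ => True
  obtain ⟨N', hN', h'⟩ := exists_admissible_seq hS hD hI fun _ => False
  exact ⟨⟨N, hN, ((h d).1 trivial).lim⟩, N', hN', ((h' d).2 not_false).lim⟩

/-- The CIC bounds on the quantile treatment effects among switchers are sharp. -/
theorem cic_lqte_sharp {q : ℝ} (hq : q ∈ Set.Ioo (0 : ℝ) 1) :
    (∃ N : ℕ → FuzzyDiD.{0}, (∀ k, M.Admissible (N k)) ∧
      Tendsto (fun k => (N k).lqte q) atTop (𝓝 (M.tauLow q))) ∧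
    (∃ N : ℕ → FuzzyDiD.{0}, (∀ k, M.Admissible (N k)) ∧
      Tendsto (fun k => (N k).lqte q) atTop (𝓝 (M.tauHigh q))) := by
  -- A lower cdf means larger outcomes: the smallest effect combines the lower cdf for `Y(0)` with
  -- the upper cdf for `Y(1)`, the largest effect the reverse.
  obtain ⟨N, hN, h⟩ := exists_admissible_seq hS hD hI fun d => d = 0
  obtain ⟨N', hN', h'⟩ := exists_admissible_seq hS hD hI fun d => d = 1
  obtain ⟨⟨a1, a2⟩, b1, b2⟩ := quantile_one_ne hN hS hM hD hq
  exact ⟨⟨N, hN, EReal.tendsto_sub' (tendsto_quantile_high hN hS hM hD hq ((h 1).2 one_ne_zero))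
      (tendsto_quantile_low hN hS hD hq ((h 0).1 rfl)) (Or.inl a1) (Or.inl a2)⟩,
    N', hN', EReal.tendsto_sub' (tendsto_quantile_low hN' hS hD hq ((h' 1).1 rfl))
      (tendsto_quantile_high hN' hS hM hD hq ((h' 0).2 zero_ne_one)) (Or.inl b1) (Or.inl b2)⟩

omit hS hM hD hI in
lemma tendsto_late {N : ℕ → FuzzyDiD.{0}} (hN : ∀ k, M.Admissible (N k)) {m1 m0 : EReal}
    (h1 : (∀ᶠ k in atTop, Integrable ((N k).Y 1) (cond (N k).P (N k).switchers)) ∧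
      Tendsto (fun k => ((∫ y, y ∂((N k).switLaw 1) : ℝ) : EReal)) atTop (𝓝 m1))
    (h0 : (∀ᶠ k in atTop, Integrable ((N k).Y 0) (cond (N k).P (N k).switchers)) ∧
      Tendsto (fun k => ((∫ y, y ∂((N k).switLaw 0) : ℝ) : EReal)) atTop (𝓝 m0))
    (ht : m1 ≠ ⊤) (hb : m1 ≠ ⊥) :
    ∃ N : ℕ → FuzzyDiD.{0}, (∀ k, M.Admissible (N k)) ∧
      (∀ k d, Integrable ((N k).Y d) (cond (N k).P (N k).switchers)) ∧
      Tendsto (fun k => ((N k).late : EReal)) atTop (𝓝 (m1 - m0)) := by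
  -- Integrability is known only for large indices; dropping the first `n` terms provides it for all
  -- of them.
  obtain ⟨n, hn⟩ := eventually_atTop.1 (h1.1.and h0.1)
  have hint : ∀ k d, Integrable ((N (k + n)).Y d) (cond (N (k + n)).P (N (k + n)).switchers) := by
    intro k d
    have := hn (k + n) (Nat.le_add_left n k)
    rcases Fin.exists_fin_two.1 ⟨d, rfl⟩ with rfl | rfl
    · exact this.2
    · exact this.1
  refine ⟨fun k => N (k + n), fun k => hN _, hint, ?_⟩
  have := EReal.tendsto_sub' ((tendsto_add_atTop_iff_nat n).2 h1.2)
    ((tendsto_add_atTop_iff_nat n).2 h0.2) (Or.inl ht) (Or.inl hb)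
  exact this.congr fun k => (late_eq (hint k 1) (hint k 0)).symm

omit hS hM hD hI in
lemma extMean_ne {F : ℝ → ℝ} (h : SubCdf F) (hI : Integrable (fun y : ℝ => y) (stieltjesOf F))
    (h1 : ⨆ y, F y = 1) (h0 : ⨅ y, F y = 0) : extMean F ≠ ⊤ ∧ extMean F ≠ ⊥ := by
  rw [h.extMean_eq 0 hI, ← EReal.coe_ennreal_toReal (h.upT_lt_top 0 hI h1).ne,
    ← EReal.coe_ennreal_toReal (h.loT_lt_top 0 hI h0).ne, ← EReal.coe_add, ← EReal.coe_sub]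
  exact ⟨EReal.coe_ne_top _, EReal.coe_ne_bot _⟩

/-- The CIC bounds on the effect among switchers are sharp. -/
theorem cic_late_sharp (hE : M.MomentsExist) :
    (∃ N : ℕ → FuzzyDiD.{0}, (∀ k, M.Admissible (N k)) ∧
      (∀ k d, Integrable ((N k).Y d) (cond (N k).P (N k).switchers)) ∧
      Tendsto (fun k => ((N k).late : EReal)) atTop (𝓝 M.wCicLow)) ∧
    (∃ N : ℕ → FuzzyDiD.{0}, (∀ k, M.Admissible (N k)) ∧
      (∀ k d, Integrable ((N k).Y d) (cond (N k).P (N k).switchers)) ∧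
      Tendsto (fun k => ((N k).late : EReal)) atTop (𝓝 M.wCicHigh)) := by
  obtain ⟨N, hN, h⟩ := exists_admissible_seq hS hD hI fun d => d = 0
  obtain ⟨N', hN', h'⟩ := exists_admissible_seq hS hD hI fun d => d = 1
  have hH := extMean_ne (subCdf_cicHighOn hS hM hD 1) (hE 1).1 ((hN 0).iSup_high hS 1)
    (iInf_cicHighOn_one hS hM hD)
  have hL := extMean_ne (subCdf_cicLowOn hS hM hD 1) (hE 1).2 (iSup_cicLowOn_one hS hM hD)
    ((hN 0).iInf_low hS 1)
  exact ⟨tendsto_late hN (tendsto_mean_high hN hS hM hD hE ((h 1).2 one_ne_zero))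
      (tendsto_mean_low hN hS hM hD hE ((h 0).1 rfl)) hH.1 hH.2,
    tendsto_late hN' (tendsto_mean_low hN' hS hM hD hE ((h' 1).1 rfl))
      (tendsto_mean_high hN' hS hM hD hE ((h' 0).2 zero_ne_one)) hL.1 hL.2⟩

end Sharpness

end FuzzyDiD

end

theorem theorem6 (M : FuzzyDiD.{u})
    (hPart : M.Participation) (hFS : M.FirstStage)
    (hRate : ∀ t, 0 < M.rate 1 0 t ∧ M.rate 1 0 t < 1)
    (hChange : M.rate 1 0 1 ≠ M.rate 1 0 0) :
    -- TC bounds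
    (M.ConditionalCommonTrends → Bornology.IsBounded M.suppY → M.OutcomesInBounds →
      M.tcLow ≤ M.late ∧ M.late ≤ M.tcHigh) ∧
    -- CIC bounds
    (M.MonotoneInvariant → M.DataRestrictions →
      -- bounds on the cdfs of the switchers
      (∀ d y, M.cicLow d y ≤ M.switcherCdf d y ∧ M.switcherCdf d y ≤ M.cicHigh d y) ∧
      -- bounds on the LATE
      (M.OutcomesInBounds → M.MomentsExist →
        Integrable (M.Y 1) (cond M.P M.switchers) ∧
        (M.wCicLow ≠ ⊥ → M.wCicHigh ≠ ⊤ → Integrable (M.Y 0) (cond M.P M.switchers)) ∧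
        (Integrable (M.Y 0) (cond M.P M.switchers) →
          M.wCicLow ≤ (M.late : EReal) ∧ (M.late : EReal) ≤ M.wCicHigh)) ∧
      -- bounds on the LQTE
      (M.OutcomesInBounds → ∀ q ∈ Set.Ioo (0 : ℝ) 1,
        M.tauLow q ≤ M.lqte q ∧ M.lqte q ≤ M.tauHigh q) ∧
      -- sharpness
      (M.IncreasingBounds →
        (∀ d,
          (∃ N : ℕ → FuzzyDiD.{0}, (∀ k, M.Admissible (N k)) ∧
            ∀ y ∈ interior M.suppY,
              Tendsto (fun k => (N k).switcherCdf d y) atTop (𝓝 (M.cicLow d y))) ∧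
          (∃ N : ℕ → FuzzyDiD.{0}, (∀ k, M.Admissible (N k)) ∧
            ∀ y ∈ interior M.suppY,
              Tendsto (fun k => (N k).switcherCdf d y) atTop (𝓝 (M.cicHigh d y)))) ∧
        (M.MomentsExist →
          (∃ N : ℕ → FuzzyDiD.{0}, (∀ k, M.Admissible (N k)) ∧
            (∀ k d, Integrable ((N k).Y d) (cond (N k).P (N k).switchers)) ∧
            Tendsto (fun k => ((N k).late : EReal)) atTop (𝓝 M.wCicLow)) ∧
          (∃ N : ℕ → FuzzyDiD.{0}, (∀ k, M.Admissible (N k)) ∧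
            (∀ k d, Integrable ((N k).Y d) (cond (N k).P (N k).switchers)) ∧
            Tendsto (fun k => ((N k).late : EReal)) atTop (𝓝 M.wCicHigh))) ∧
        (∀ q ∈ Set.Ioo (0 : ℝ) 1,
          (∃ N : ℕ → FuzzyDiD.{0}, (∀ k, M.Admissible (N k)) ∧
            Tendsto (fun k => (N k).lqte q) atTop (𝓝 (M.tauLow q))) ∧
          (∃ N : ℕ → FuzzyDiD.{0}, (∀ k, M.Admissible (N k)) ∧
            Tendsto (fun k => (N k).lqte q) atTop (𝓝 (M.tauHigh q)))))) := by
  have hS : M.Standing := ⟨hPart, hFS, hRate, hChange⟩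
  refine ⟨fun hT hb hB => FuzzyDiD.tc_bounds hPart hFS hRate hChange hT hb hB,
    fun hM hD => ⟨FuzzyDiD.cic_bounds hS hM hD, fun hB hE => FuzzyDiD.cic_late hS hM hD hB hE,
      fun hB q hq => FuzzyDiD.cic_lqte hS hM hD hB hq, fun hI =>
        ⟨FuzzyDiD.cic_bounds_sharp hS hD hI, FuzzyDiD.cic_late_sharp hS hM hD hI,
          fun q hq => FuzzyDiD.cic_lqte_sharp hS hM hD hI hq⟩⟩⟩
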